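/- Let $\mathbb K$ be a field of characteristic zero and let $\mathsf{DY}^1$ be the colored PROP (the $\mathbb K$-linear strict symmetric monoidal category whose objects are the finite words in two letters $[1]$ and $[V_1]$) generated by morphisms $\mu:[1]\otimes[1]\to[1]$, $\delta:[1]\to[1]\otimes[1]$, $\pi:[1]\otimes[V_1]\to[V_1]$, $\pi^*:[V_1]\to[1]\otimes[V_1]$, subject to the relations saying that $([1],\mu,\delta)$ is a Lie bialgebra and that $([V_1],\pi,\pi^*)$ is a Drinfeld–Yetter module over it; that is (composing from right to left in these formulas, with $\mathrm{sw}$ the symmetry of $[1]\otimes[1]$): $\mu$ is antisymmetric and satisfies the Jacobi identity, $\delta$ is antisymmetric and satisfies the co-Jacobi identity, $\delta\mu=(\mathrm{id}-\mathrm{sw})(\mathrm{id}\otimes\mu)(\delta\otimes\mathrm{id})(\mathrm{id}-\mathrm{sw})$, and $$\pi(\mu\otimes\mathrm{id})=\pi(\mathrm{id}\otimes\pi)-\pi(\mathrm{id}\otimes\pi)(\mathrm{sw}\otimes\mathrm{id}),$$ $$(\delta\otimes\mathrm{id})\pi^*=(\mathrm{sw}\otimes\mathrm{id})(\mathrm{id}\otimes\pi^*)\pi^*-(\mathrm{id}\otimes\pi^*)\pi^*,$$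 $$\pi^*\pi=(\mathrm{id}\otimes\pi)(\mathrm{sw}\otimes\mathrm{id})(\mathrm{id}\otimes\pi^*)+(\mu\otimes\mathrm{id})(\mathrm{id}\otimes\pi^*)-(\mathrm{id}\otimes\pi)(\delta\otimes\mathrm{id}).$$ From now on $f\circ g$ means first $f$, then $g$. The universal Drinfeld–Yetter algebra is $\mathfrak U^1_{\mathsf{DY}}=\mathrm{End}_{\mathsf{DY}^1}([V_1])$. For $n\ge 0$ and $\sigma\in\mathfrak S_n$ let $r_n^\sigma=\pi^{*(n)}\circ(\sigma\otimes\mathrm{id}_{[V_1]})\circ\pi^{(n)}$. Here $\pi^{*(n)}:[V_1]\to[1]^{\otimes n}\otimes[V_1]$ and $\pi^{(n)}:[1]^{\otimes n}\otimes[V_1]\to[V_1]$ are the iterated coaction and action, $\pi^{*(n+1)}=\pi^*\circ(\mathrm{id}_{[1]}\otimes\pi^{*(n)})$, $\pi^{(n+1)}=(\mathrm{id}_{[1]}\otimes\pi^{(n)})\circ\pi$, $\pi^{*(0)}=\pi^{(0)}=\mathrm{id}$, and $\sigma$ acts on $[1]^{\otimes n}$ as the permutation morphism taking the string at position $p$ to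 position $\sigma(p)$. *Looms.* For $n,m\ge 1$ consider the following square tiles, where $0\le k\le m-1$ and $0\le\ell\le n-1$. Horizontal strings run from the left edge to the right edge, vertical strings from the bottom edge to the top edge. 1. $k+1$ horizontal strings crossing $\ell+1$ vertical strings. 2. $\ell+1$ vertical strings and one string from the left edge to the top edge, leaving to the left of the vertical strings. 3. $\ell+1$ vertical strings and one string from the left edge to the top edge, crossing the vertical strings and leaving to their right. 4. $k+1$ horizontal strings and one string from the left edge, entering above them, to the top edge. 5. $k+1$ horizontal strings and one string from the left edge, entering below them and crossing them, to the top edge. 6. $k+1$ horizontal strings. 7. $\ell+1$ vertical strings. 8. No strings. An $n\times m$ Drinfeld–Yetter loom is a filling $L$ of the grid with $n$ rows (numbered from the top) and $m$ columns (numbered from the left) by such tiles such that the numbers of strings on the two sides of every interior edge agree; the total number of strings on the left and bottom boundary of the grid is $n+m$, and so is that on the top and right boundary; there is no tile of type 6 or 8 in the first row and no tile of type 7 or 8 in the first column. For $n=0$ (resp. $m=0$) there is, by convention, exactly one loom, consisting of $m$ vertical (resp. $n$ horizontal) strings. Write $\mathfrak L_{n,m}$ for the set of $n\times m$ looms. A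 loom is positive (resp. negative) if it has an even (resp. odd) number of tiles of types 3 and 5. *The permutation $\tilde\gamma(\sigma,L,\tau)$.* Let $\sigma\in\mathfrak S_n$, $\tau\in\mathfrak S_m$, $L\in\mathfrak L_{n,m}$. Glue $\sigma$ to the left edge and $\tau$ to the top edge of $L$, moving strings of the same tile together: the bundle at outer left position $p$ enters row $\sigma(p)$, and the bundle leaving the top of column $j$ goes to outer top position $\tau(j)$. Number the $n+m$ ingoing strings along the left (top to bottom) and then the bottom (left to right), and the $n+m$ outgoing strings along the top (left to right) and then the right (top to bottom). Then $\tilde\gamma(\sigma,L,\tau)\in\mathfrak S_{n+m}$ maps the number at which a string enters to the number at which it leaves. For $\pi\in\mathfrak S_{n+m}$ let $P^{\sigma,\tau,\pi}_{n,m}$ (resp. $N^{\sigma,\tau,\pi}_{n,m}$) be the number of positive (resp. negative) looms $L\in\mathfrak L_{n,m}$ with $\tilde\gamma(\sigma,L,\tau)=\pi$. **Statement.** For all $n,m\ge0$, $\sigma\in\mathfrak S_n$ and $\tau\in\mathfrak S_m$, the following identity holds in $\mathfrak U^1_{\mathsf{DY}}$: $$r_n^\sigma\circ r_m^\tau=\sum_{\pi\in\mathfrak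 S_{n+m}}\bigl(P^{\sigma,\tau,\pi}_{n,m}-N^{\sigma,\tau,\pi}_{n,m}\bigr)\,r_{n+m}^\pi .$$ -/

import Mathlib

open CategoryTheory

namespace DrinfeldYetter

universe u

/-! ## The colored PROP of a Drinfeld–Yetter module over a Lie bialgebra -/

/-- The two colors: the Lie bialgebra object `[1]` and the module object `[V₁]`. -/
inductive Color : Type
  | lie
  | mod

/-- Formal expressions for the morphisms of a `K`-linear strict symmetric monoidal category whose
objects are the words in the two colors, generated by a bracket `mu`, a cobracket `delta`, an
action `act` and a coaction `coact`. Here `comp f g` is "first `f`, then `g`". -/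
inductive Term (K : Type u) : List Color → List Color → Type u
  | id (a : List Color) : Term K a a
  | comp {a b c : List Color} : Term K a b → Term K b c → Term K a c
  | tensor {a b c d : List Color} : Term K a b → Term K c d → Term K (a ++ c) (b ++ d)
  | braid (a b : List Color) : Term K (a ++ b) (b ++ a)
  | zero (a b : List Color) : Term K a b
  | add {a b : List Color} : Term K a b → Term K a b → Term K a b
  | smul {a b : List Color} : K → Term K a b → Term K a b
  | mu : Term K [.lie, .lie] [.lie]
  | delta : Term K [.lie] [.lie, .lie]
  | act : Term K [.lie, .mod] [.mod]
  | coact : Term K [.mod] [.lie, .mod]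

/-- The identity expression between two equal words. -/
def Term.cast {K : Type u} {a b : List Color} (h : a = b) : Term K a b := h ▸ Term.id a

namespace Term

variable {K : Type u}

/-- The symmetry of two Lie strings. -/
def swap : Term K [.lie, .lie] [.lie, .lie] := braid [.lie] [.lie]

/-- The sum of the three cyclic permutations of three Lie strings. -/
def cyc : Term K [.lie, .lie, .lie] [.lie, .lie, .lie] :=
  add (add (id [.lie, .lie, .lie]) (braid [.lie] [.lie, .lie])) (braid [.lie, .lie] [.lie])

/-- `μ ⊗ id_[1]` -/
def muId : Term K [.lie, .lie, .lie] [.lie, .lie] := tensor mu (id [.lie])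

/-- `id_[1] ⊗ μ` -/
def idMu : Term K [.lie, .lie, .lie] [.lie, .lie] := tensor (id [.lie]) mu

/-- `δ ⊗ id_[1]` -/
def deltaId : Term K [.lie, .lie] [.lie, .lie, .lie] := tensor delta (id [.lie])

/-- `id_[2] - (12)` -/
def alt [Field K] : Term K [.lie, .lie] [.lie, .lie] := add (id [.lie, .lie]) (smul (-1) swap)

/-- `μ ⊗ id_[V]` -/
def muMod : Term K [.lie, .lie, .mod] [.lie, .mod] := tensor mu (id [.mod])

/-- `δ ⊗ id_[V]` -/
def deltaMod : Term K [.lie, .mod] [.lie, .lie, .mod] := tensor delta (id [.mod])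

/-- `(12) ⊗ id_[V]` -/
def swapMod : Term K [.lie, .lie, .mod] [.lie, .lie, .mod] := tensor swap (id [.mod])

/-- `id_[1] ⊗ π` -/
def idAct : Term K [.lie, .lie, .mod] [.lie, .mod] := tensor (id [.lie]) act

/-- `id_[1] ⊗ π*` -/
def idCoact : Term K [.lie, .mod] [.lie, .lie, .mod] := tensor (id [.lie]) coact

end Term

open Term in
/-- The congruence on expressions generated by the axioms of a `K`-linear strict symmetric monoidal
category, by the axioms of a Lie bialgebra and by those of a Drinfeld–Yetter module. -/
inductive Rel (K : Type u) [Field K] :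
    {a b : List Color} → Term K a b → Term K a b → Prop
  -- equivalence relation
  | refl {a b : List Color} (f : Term K a b) : Rel K f f
  | symm {a b : List Color} {f g : Term K a b} : Rel K f g → Rel K g f
  | trans {a b : List Color} {f g h : Term K a b} : Rel K f g → Rel K g h → Rel K f h
  -- compatibility with the operations
  | comp_congr {a b c : List Color} {f f' : Term K a b} {g g' : Term K b c} :
      Rel K f f' → Rel K g g' → Rel K (comp f g) (comp f' g')
  | tensor_congr {a b c d : List Color} {f f' : Term K a b} {g g' : Term K c d} :
      Rel K f f' → Rel K g g' → Rel K (tensor f g) (tensor f' g')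
  | add_congr {a b : List Color} {f f' g g' : Term K a b} :
      Rel K f f' → Rel K g g' → Rel K (add f g) (add f' g')
  | smul_congr {a b : List Color} (r : K) {f f' : Term K a b} :
      Rel K f f' → Rel K (smul r f) (smul r f')
  -- the morphisms between two objects form a `K`-vector space
  | add_assoc {a b : List Color} (f g h : Term K a b) :
      Rel K (add (add f g) h) (add f (add g h))
  | add_comm {a b : List Color} (f g : Term K a b) : Rel K (add f g) (add g f)
  | zero_add {a b : List Color} (f : Term K a b) : Rel K (add (zero a b) f) f
  | smul_add {a b : List Color} (r : K) (f g : Term K a b) :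
      Rel K (smul r (add f g)) (add (smul r f) (smul r g))
  | add_smul {a b : List Color} (r s : K) (f : Term K a b) :
      Rel K (smul (r + s) f) (add (smul r f) (smul s f))
  | mul_smul {a b : List Color} (r s : K) (f : Term K a b) :
      Rel K (smul (r * s) f) (smul r (smul s f))
  | one_smul {a b : List Color} (f : Term K a b) : Rel K (smul 1 f) f
  | zero_smul {a b : List Color} (f : Term K a b) : Rel K (smul 0 f) (zero a b)
  -- category axioms
  | id_comp {a b : List Color} (f : Term K a b) : Rel K (comp (id a) f) f
  | comp_id {a b : List Color} (f : Term K a b) : Rel K (comp f (id b)) f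
  | comp_assoc {a b c d : List Color} (f : Term K a b) (g : Term K b c) (h : Term K c d) :
      Rel K (comp (comp f g) h) (comp f (comp g h))
  -- composition and tensor product are bilinear
  | add_comp {a b c : List Color} (f f' : Term K a b) (g : Term K b c) :
      Rel K (comp (add f f') g) (add (comp f g) (comp f' g))
  | comp_add {a b c : List Color} (f : Term K a b) (g g' : Term K b c) :
      Rel K (comp f (add g g')) (add (comp f g) (comp f g'))
  | smul_comp {a b c : List Color} (r : K) (f : Term K a b) (g : Term K b c) :
      Rel K (comp (smul r f) g) (smul r (comp f g))
  | comp_smul {a b c : List Color} (r : K) (f : Term K a b) (g : Term K b c) :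
      Rel K (comp f (smul r g)) (smul r (comp f g))
  | add_tensor {a b c d : List Color} (f f' : Term K a b) (g : Term K c d) :
      Rel K (tensor (add f f') g) (add (tensor f g) (tensor f' g))
  | tensor_add {a b c d : List Color} (f : Term K a b) (g g' : Term K c d) :
      Rel K (tensor f (add g g')) (add (tensor f g) (tensor f g'))
  | smul_tensor {a b c d : List Color} (r : K) (f : Term K a b) (g : Term K c d) :
      Rel K (tensor (smul r f) g) (smul r (tensor f g))
  | tensor_smul {a b c d : List Color} (r : K) (f : Term K a b) (g : Term K c d) :
      Rel K (tensor f (smul r g)) (smul r (tensor f g))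
  -- the tensor product is a strictly associative and strictly unital bifunctor
  | tensor_id (a b : List Color) : Rel K (tensor (id a) (id b)) (id (a ++ b))
  | tensor_comp {a b c a' b' c' : List Color} (f : Term K a b) (g : Term K b c)
      (f' : Term K a' b') (g' : Term K b' c') :
      Rel K (tensor (comp f g) (comp f' g')) (comp (tensor f f') (tensor g g'))
  | tensor_assoc {a b c d x y : List Color} (f : Term K a b) (g : Term K c d) (h : Term K x y) :
      Rel K (comp (tensor (tensor f g) h) (cast (List.append_assoc b d y)))
        (comp (cast (List.append_assoc a c x)) (tensor f (tensor g h)))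
  | unit_tensor {a b : List Color} (f : Term K a b) : Rel K (tensor (id []) f) f
  | tensor_unit {a b : List Color} (f : Term K a b) :
      Rel K (comp (tensor f (id [])) (cast (List.append_nil b)))
        (comp (cast (List.append_nil a)) f)
  -- the braiding is natural, satisfies the hexagon identity and is a symmetry
  | braid_natural {a b c d : List Color} (f : Term K a b) (g : Term K c d) :
      Rel K (comp (tensor f g) (braid b d)) (comp (braid a c) (tensor g f))
  | braid_hexagon (a b c : List Color) :
      Rel K (comp (cast (List.append_assoc a b c))
          (comp (braid a (b ++ c)) (cast (List.append_assoc b c a))))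
        (comp (tensor (braid a b) (id c))
          (comp (cast (List.append_assoc b a c)) (tensor (id b) (braid a c))))
  | braid_symm (a b : List Color) : Rel K (comp (braid a b) (braid b a)) (id (a ++ b))
  -- antisymmetry of the bracket: `[x, y] + [y, x] = 0`
  | mu_antisymm : Rel K (add mu (comp swap mu)) (zero _ _)
  -- Jacobi rule: the cyclic sum of `[[x, y], z]` vanishes
  | jacobi : Rel K (comp cyc (comp muId mu)) (zero _ _)
  -- antisymmetry of the cobracket
  | delta_antisymm : Rel K (add delta (comp delta swap)) (zero _ _)
  -- coJacobi rule
  | cojacobi : Rel K (comp (comp delta deltaId) cyc) (zero _ _)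
  -- cocycle condition
  | cocycle : Rel K (comp mu delta) (comp alt (comp (comp deltaId idMu) alt))
  -- Lie action: `[x, y] v = x (y v) - y (x v)`
  | lie_action :
      Rel K (comp muMod act)
        (add (comp idAct act) (smul (-1) (comp swapMod (comp idAct act))))
  -- Lie coaction
  | lie_coaction :
      Rel K (comp coact deltaMod)
        (add (comp (comp coact idCoact) swapMod) (smul (-1) (comp coact idCoact)))
  -- Drinfeld–Yetter relation
  | drinfeld_yetter :
      Rel K (comp act coact)
        (add (add (comp idCoact (comp swapMod idAct)) (comp idCoact muMod))
          (smul (-1) (comp deltaMod idAct)))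

/-- The congruence as a setoid. -/
def relSetoid (K : Type u) [Field K] (a b : List Color) : Setoid (Term K a b) :=
  ⟨Rel K, ⟨Rel.refl, Rel.symm, Rel.trans⟩⟩

/-- The morphisms `a ⟶ b` of the colored PROP. -/
def Hom (K : Type u) [Field K] (a b : List Color) : Type u := Quotient (relSetoid K a b)

namespace Hom

variable {K : Type u} [Field K] {a b c d x y : List Color}

/-- The class of an expression. -/
def mk (f : Term K a b) : Hom K a b := Quotient.mk (relSetoid K a b) f

theorem sound {f g : Term K a b} (h : Rel K f g) : mk f = mk g := Quotient.sound h

theorem ind {p : Hom K a b → Prop} (h : ∀ f, p (mk f)) (f : Hom K a b) : p f := Quotient.ind h f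

/-- The identity. -/
def id (K : Type u) [Field K] (a : List Color) : Hom K a a := mk (.id a)

/-- Composition: first `f`, then `g`. -/
def comp (f : Hom K a b) (g : Hom K b c) : Hom K a c :=
  Quotient.map₂ Term.comp (fun _ _ h _ _ h' => Rel.comp_congr h h') f g

/-- Tensor product of morphisms. -/
def tensor (f : Hom K a b) (g : Hom K c d) : Hom K (a ++ c) (b ++ d) :=
  Quotient.map₂ Term.tensor (fun _ _ h _ _ h' => Rel.tensor_congr h h') f g

/-- The symmetry. -/
def braid (K : Type u) [Field K] (a b : List Color) : Hom K (a ++ b) (b ++ a) := mk (.braid a b)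

/-- The universal Lie bracket. -/
def mu (K : Type u) [Field K] : Hom K [.lie, .lie] [.lie] := mk .mu

/-- The universal Lie cobracket. -/
def delta (K : Type u) [Field K] : Hom K [.lie] [.lie, .lie] := mk .delta

/-- The universal action. -/
def act (K : Type u) [Field K] : Hom K [.lie, .mod] [.mod] := mk .act

/-- The universal coaction. -/
def coact (K : Type u) [Field K] : Hom K [.mod] [.lie, .mod] := mk .coact

instance : Zero (Hom K a b) := ⟨mk (.zero a b)⟩

instance : Add (Hom K a b) :=
  ⟨Quotient.map₂ Term.add (fun _ _ h _ _ h' => Rel.add_congr h h')⟩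

instance : SMul K (Hom K a b) :=
  ⟨fun r => Quotient.map (Term.smul r) (fun _ _ h => Rel.smul_congr r h)⟩

theorem zero_smul' (f : Hom K a b) :
    (0 : K) • f = 0 := by
  induction f using ind with | h f
  exact sound (Rel.zero_smul f)

theorem add_smul' (r s : K) (f : Hom K a b) :
    (r + s) • f = r • f + s • f := by
  induction f using ind with | h f
  exact sound (Rel.add_smul r s f)

theorem mul_smul' (r s : K) (f : Hom K a b) :
    (r * s) • f = r • (s • f) := by
  induction f using ind with | h f
  exact sound (Rel.mul_smul r s f)

theorem one_smul' (f : Hom K a b) :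
    (1 : K) • f = f := by
  induction f using ind with | h f
  exact sound (Rel.one_smul f)

theorem smul_add' (r : K) (f g : Hom K a b) :
    r • (f + g) = r • f + r • g := by
  induction f using ind with | h f
  induction g using ind with | h g
  exact sound (Rel.smul_add r f g)

theorem zero_add' (f : Hom K a b) :
    0 + f = f := by
  induction f using ind with | h f
  exact sound (Rel.zero_add f)

theorem add_comm' (f g : Hom K a b) :
    f + g = g + f := by
  induction f using ind with | h f
  induction g using ind with | h g
  exact sound (Rel.add_comm f g)

theorem add_assoc' (f g h : Hom K a b) :
    f + g + h = f + (g + h) := by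
  induction f using ind with | h f
  induction g using ind with | h g
  induction h using ind with | h h
  exact sound (Rel.add_assoc f g h)

instance addCommGroup : AddCommGroup (Hom K a b) where
  add_assoc := add_assoc'
  zero_add := zero_add'
  add_zero f := by rw [add_comm', zero_add']
  nsmul := nsmulRec
  neg f := (-1 : K) • f
  zsmul := @zsmulRec _ _ _ ⟨fun f => (-1 : K) • f⟩ nsmulRec
  neg_add_cancel f := by
    calc (-1 : K) • f + f = (-1 : K) • f + (1 : K) • f := by rw [one_smul']
      _ = 0 := by rw [← add_smul', neg_add_cancel, zero_smul']
  add_comm := add_comm'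

instance module : Module K (Hom K a b) where
  one_smul := one_smul'
  mul_smul := mul_smul'
  smul_zero r := by rw [← zero_smul' (0 : Hom K a b), ← mul_smul', mul_zero]
  smul_add := smul_add'
  add_smul := add_smul'
  zero_smul := zero_smul'

theorem id_comp (f : Hom K a b) :
    comp (id K a) f = f := by
  induction f using ind with | h f
  exact sound (Rel.id_comp f)

theorem comp_id (f : Hom K a b) :
    comp f (id K b) = f := by
  induction f using ind with | h f
  exact sound (Rel.comp_id f)

theorem comp_assoc (f : Hom K a b) (g : Hom K b c) (h : Hom K c d) :
    comp (comp f g) h = comp f (comp g h) := by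
  induction f using ind with | h f
  induction g using ind with | h g
  induction h using ind with | h h
  exact sound (Rel.comp_assoc f g h)

theorem add_comp (f f' : Hom K a b) (g : Hom K b c) :
    comp (f + f') g = comp f g + comp f' g := by
  induction f using ind with | h f
  induction f' using ind with | h f'
  induction g using ind with | h g
  exact sound (Rel.add_comp f f' g)

theorem comp_add (f : Hom K a b) (g g' : Hom K b c) :
    comp f (g + g') = comp f g + comp f g' := by
  induction f using ind with | h f
  induction g using ind with | h g
  induction g' using ind with | h g'
  exact sound (Rel.comp_add f g g')

theorem smul_comp (r : K) (f : Hom K a b) (g : Hom K b c) :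
    comp (r • f) g = r • comp f g := by
  induction f using ind with | h f
  induction g using ind with | h g
  exact sound (Rel.smul_comp r f g)

theorem comp_smul (r : K) (f : Hom K a b) (g : Hom K b c) :
    comp f (r • g) = r • comp f g := by
  induction f using ind with | h f
  induction g using ind with | h g
  exact sound (Rel.comp_smul r f g)

theorem add_tensor (f f' : Hom K a b) (g : Hom K c d) :
    tensor (f + f') g = tensor f g + tensor f' g := by
  induction f using ind with | h f
  induction f' using ind with | h f'
  induction g using ind with | h g
  exact sound (Rel.add_tensor f f' g)

theorem tensor_add (f : Hom K a b) (g g' : Hom K c d) :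
    tensor f (g + g') = tensor f g + tensor f g' := by
  induction f using ind with | h f
  induction g using ind with | h g
  induction g' using ind with | h g'
  exact sound (Rel.tensor_add f g g')

theorem smul_tensor (r : K) (f : Hom K a b) (g : Hom K c d) :
    tensor (r • f) g = r • tensor f g := by
  induction f using ind with | h f
  induction g using ind with | h g
  exact sound (Rel.smul_tensor r f g)

theorem tensor_smul (r : K) (f : Hom K a b) (g : Hom K c d) :
    tensor f (r • g) = r • tensor f g := by
  induction f using ind with | h f
  induction g using ind with | h g
  exact sound (Rel.tensor_smul r f g)

theorem tensor_id : tensor (id K a) (id K b) = id K (a ++ b) := sound (Rel.tensor_id a b)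

theorem tensor_comp (f : Hom K a b) (g : Hom K b c)
    {a' b' c' : List Color} (f' : Hom K a' b') (g' : Hom K b' c') :
    tensor (comp f g) (comp f' g') = comp (tensor f f') (tensor g g') := by
  induction f using ind with | h f
  induction g using ind with | h g
  induction f' using ind with | h f'
  induction g' using ind with | h g'
  exact sound (Rel.tensor_comp f g f' g')

/-- The identity between equal words. -/
def cast (K : Type u) [Field K] (h : a = b) : Hom K a b := mk (.cast h)

theorem tensor_assoc (f : Hom K a b) (g : Hom K c d) (h : Hom K x y) :
    comp (tensor (tensor f g) h) (cast K (List.append_assoc b d y)) =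
      comp (cast K (List.append_assoc a c x)) (tensor f (tensor g h)) := by
  induction f using ind with | h f
  induction g using ind with | h g
  induction h using ind with | h h
  exact sound (Rel.tensor_assoc f g h)

theorem unit_tensor (f : Hom K a b) :
    tensor (id K []) f = f := by
  induction f using ind with | h f
  exact sound (Rel.unit_tensor f)

theorem tensor_unit (f : Hom K a b) :
    comp (tensor f (id K [])) (cast K (List.append_nil b)) =
      comp (cast K (List.append_nil a)) f := by
  induction f using ind with | h f
  exact sound (Rel.tensor_unit f)

theorem braid_natural (f : Hom K a b) (g : Hom K c d) :
    comp (tensor f g) (braid K b d) = comp (braid K a c) (tensor g f) := by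
  induction f using ind with | h f
  induction g using ind with | h g
  exact sound (Rel.braid_natural f g)

theorem braid_hexagon (a b c : List Color) :
    comp (cast K (List.append_assoc a b c))
        (comp (braid K a (b ++ c)) (cast K (List.append_assoc b c a))) =
      comp (tensor (braid K a b) (id K c))
        (comp (cast K (List.append_assoc b a c)) (tensor (id K b) (braid K a c))) :=
  sound (Rel.braid_hexagon a b c)

theorem braid_symm (a b : List Color) :
    comp (braid K a b) (braid K b a) = id K (a ++ b) := sound (Rel.braid_symm a b)

theorem cast_rfl : cast K (rfl : a = a) = id K a := rfl

theorem cast_comp_cast (h : a = b) (h' : b = c) :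
    comp (cast K h) (cast K h') = cast K (h.trans h') := by
  subst h; subst h'; exact id_comp _

theorem cast_tensor_cast (h : a = b) (h' : c = d) :
    tensor (cast K h) (cast K h') = cast K (by rw [h, h'] : a ++ c = b ++ d) := by
  subst h; subst h'; exact tensor_id

end Hom

/-- The objects of the colored PROP `DY¹` over `K`: words in the two colors. -/
@[ext]
structure DY (K : Type u) : Type where
  word : List Color

section Instances

variable {K : Type u} [Field K]

instance : Category (DY K) where
  Hom X Y := Hom K X.word Y.word
  id X := Hom.id K X.word
  comp f g := Hom.comp f g
  id_comp := Hom.id_comp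
  comp_id := Hom.comp_id
  assoc := Hom.comp_assoc

instance : Preadditive (DY K) where
  homGroup _ _ := Hom.addCommGroup
  add_comp _ _ _ := Hom.add_comp
  comp_add _ _ _ := Hom.comp_add

instance : Linear K (DY K) where
  homModule _ _ := Hom.module
  smul_comp _ _ _ := Hom.smul_comp
  comp_smul _ _ _ f r g := Hom.comp_smul r f g

/-- Equal words are isomorphic through the identity. -/
def castIso {X Y : DY K} (h : X.word = Y.word) : X ≅ Y where
  hom := Hom.cast K h
  inv := Hom.cast K h.symm
  hom_inv_id := Hom.cast_comp_cast h h.symm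
  inv_hom_id := Hom.cast_comp_cast h.symm h

instance : MonoidalCategoryStruct (DY K) where
  tensorObj X Y := ⟨X.word ++ Y.word⟩
  tensorUnit := ⟨[]⟩
  tensorHom f g := Hom.tensor f g
  whiskerLeft X _ _ f := Hom.tensor (Hom.id K X.word) f
  whiskerRight f Y := Hom.tensor f (Hom.id K Y.word)
  associator X Y Z := castIso (List.append_assoc X.word Y.word Z.word)
  leftUnitor _ := castIso rfl
  rightUnitor X := castIso (List.append_nil X.word)

/-- `DY¹` is a (strict) monoidal category. -/
instance : MonoidalCategory (DY K) := MonoidalCategory.ofTensorHom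
  (id_tensorHom_id := fun _ _ => Hom.tensor_id)
  (id_tensorHom := fun _ _ _ _ => rfl)
  (tensorHom_id := fun _ _ => rfl)
  (tensorHom_comp_tensorHom := fun f f' g g' => (Hom.tensor_comp f g f' g').symm)
  (associator_naturality := fun f g h => Hom.tensor_assoc f g h)
  (leftUnitor_naturality := fun f =>
    (Hom.comp_id _).trans ((Hom.unit_tensor f).trans (Hom.id_comp _).symm))
  (rightUnitor_naturality := fun f => Hom.tensor_unit f)
  (pentagon := fun W X Y Z => by
    refine Eq.trans (congrArg₂ Hom.comp (Hom.cast_tensor_cast _ rfl)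
      (congrArg₂ Hom.comp rfl (Hom.cast_tensor_cast rfl _))) ?_
    refine Eq.trans (congrArg₂ Hom.comp rfl (Hom.cast_comp_cast _ _)) ?_
    exact (Hom.cast_comp_cast _ _).trans (Hom.cast_comp_cast _ _).symm)
  (triangle := fun X Y => by
    refine Eq.trans (congrArg₂ Hom.comp rfl (Hom.cast_tensor_cast rfl rfl)) ?_
    exact (Hom.cast_comp_cast _ _).trans (Hom.cast_tensor_cast _ rfl).symm)

instance : MonoidalPreadditive (DY K) where
  whiskerLeft_zero {X Y Z} := by
    have h := Hom.tensor_smul (0 : K) (Hom.id K X.word) (0 : Hom K Y.word Z.word)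
    rw [Hom.zero_smul', Hom.zero_smul'] at h
    exact h
  zero_whiskerRight {X Y Z} := by
    have h := Hom.smul_tensor (0 : K) (0 : Hom K Y.word Z.word) (Hom.id K X.word)
    rw [Hom.zero_smul', Hom.zero_smul'] at h
    exact h
  whiskerLeft_add f g := Hom.tensor_add _ f g
  add_whiskerRight f g := Hom.add_tensor f g _

instance : MonoidalLinear K (DY K) where
  whiskerLeft_smul _ _ _ r f := Hom.tensor_smul r _ f
  smul_whiskerRight r _ _ f _ := Hom.smul_tensor r f _

/-- The symmetry as an isomorphism. -/
def braidIso (X Y : DY K) : MonoidalCategoryStruct.tensorObj X Y ≅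
    MonoidalCategoryStruct.tensorObj Y X where
  hom := Hom.braid K X.word Y.word
  inv := Hom.braid K Y.word X.word
  hom_inv_id := Hom.braid_symm _ _
  inv_hom_id := Hom.braid_symm _ _

/-- `DY¹` is a symmetric monoidal category. -/
instance : SymmetricCategory (DY K) where
  braiding := braidIso
  braiding_naturality_right _ _ _ f := Hom.braid_natural _ f
  braiding_naturality_left f _ := Hom.braid_natural f _
  hexagon_forward X Y Z := Hom.braid_hexagon X.word Y.word Z.word
  hexagon_reverse X Y Z := by
    let e₁ := MonoidalCategoryStruct.associator Z X Y ≪≫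
      braidIso Z (MonoidalCategoryStruct.tensorObj X Y) ≪≫
      MonoidalCategoryStruct.associator X Y Z
    let e₂ := MonoidalCategory.whiskerRightIso (braidIso Z X) Y ≪≫
      MonoidalCategoryStruct.associator X Z Y ≪≫
      MonoidalCategory.whiskerLeftIso X (braidIso Z Y)
    have h : e₁ = e₂ := Iso.ext (Hom.braid_hexagon Z.word X.word Y.word)
    have h' := congrArg Iso.inv h
    simp only [e₁, e₂, Iso.trans_inv, Category.assoc] at h'
    exact h'
  symmetry X Y := Hom.braid_symm X.word Y.word

end Instances

/-! ## The universal Drinfeld–Yetter algebra and its elements `r_n^σ` -/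

section Algebra

variable (K : Type u) [Field K]

/-- The module object `[V₁]`. -/
def V : DY K := ⟨[.mod]⟩

/-- The word of the object `[n]`: the `n`-th tensor power of the Lie bialgebra object. -/
abbrev lies (n : ℕ) : List Color := List.replicate n .lie

variable {K} in
/-- `id_[1] ⊗ f` -/
def consLie {a b : List Color} (f : Hom K a b) : Hom K (.lie :: a) (.lie :: b) :=
  Hom.tensor (.id K [.lie]) f

/-- The iterated action `x₁ ⊗ ⋯ ⊗ xₙ ⊗ v ↦ x₁ (x₂ (⋯ (xₙ v)))`. -/
def iterAct : (n : ℕ) → Hom K (lies n ++ [.mod]) [.mod]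
  | 0 => .id K [.mod]
  | n + 1 => .comp (consLie (iterAct n)) (.act K)

/-- The iterated coaction; the leg produced by the first coaction is the first tensor factor. -/
def iterCoact : (n : ℕ) → Hom K [.mod] (lies n ++ [.mod])
  | 0 => .id K [.mod]
  | n + 1 => .comp (.coact K) (consLie (iterCoact n))

/-- The permutation morphism of `[n + 1]` which moves the first string to position `q` and keeps
the order of the other strings. -/
def insertMor : (n : ℕ) → Fin (n + 1) → Hom K (lies (n + 1)) (lies (n + 1))
  | 0, _ => .id K _
  | n + 1, q =>
    Fin.cases (.id K _)
      (fun k => .comp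
        (.tensor (.braid K [.lie] [.lie]) (.id K (lies n)) :
          Hom K (.lie :: .lie :: lies n) (.lie :: .lie :: lies n))
        (consLie (insertMor n k))) q

/-- The permutation induced by `σ` on the strings other than the first one, so that
`σ i.succ = (σ 0).succAbove (restPerm σ i)`. -/
def restPerm {n : ℕ} (σ : Equiv.Perm (Fin (n + 1))) : Equiv.Perm (Fin n) :=
  Equiv.removeNone ((finSuccEquiv n).symm.trans (σ.trans (finSuccEquiv' (σ 0))))

theorem succAbove_restPerm {n : ℕ} (σ : Equiv.Perm (Fin (n + 1))) (i : Fin n) :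
    (σ 0).succAbove (restPerm σ i) = σ i.succ := by
  have hne : σ i.succ ≠ σ 0 := fun h => Fin.succ_ne_zero i (σ.injective h)
  obtain ⟨k, hk⟩ := Fin.exists_succAbove_eq hne
  have h1 : ((finSuccEquiv n).symm.trans (σ.trans (finSuccEquiv' (σ 0)))) (some i) = some k := by
    simp [← hk]
  have h2 := Equiv.removeNone_some _ ⟨k, h1⟩
  rw [h1] at h2
  have h3 : restPerm σ i = k := Option.some_injective _ h2
  rw [h3, hk]

/-- The permutation morphism `[n] ⟶ [n]` of `σ`: the string entering at position `p` leaves at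
position `σ p`. -/
def permMor : (n : ℕ) → Equiv.Perm (Fin n) → Hom K (lies n) (lies n)
  | 0, _ => .id K []
  | n + 1, σ => .comp (consLie (permMor n (restPerm σ))) (insertMor K n (σ 0))

/-- The element `r_n^σ` of the universal Drinfeld–Yetter algebra `End [V₁]`: `n` coactions,
followed by the permutation `σ`, followed by `n` actions. -/
def r {n : ℕ} (σ : Equiv.Perm (Fin n)) : End (V K) :=
  Hom.comp (iterCoact K n)
    (.comp (.tensor (permMor K n σ) (.id K [.mod])) (iterAct K n))

end Algebra

/-! ## Drinfeld–Yetter looms -/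

/-- The tiles of `n × m` looms. A tile carries horizontal strings, going from its left edge to the
right, and vertical strings, going from its bottom edge to the top. There are `k + 1` horizontal
and `l + 1` vertical strings that go straight, where `k < m` and `l < n`. -/
inductive Tile (n m : ℕ) : Type
  /-- the horizontal strings cross the vertical ones -/
  | cross (k : Fin m) (l : Fin n)
  /-- besides the vertical strings, one string enters from the left and leaves through the top,
  to the left of the vertical strings -/
  | bracketLeft (l : Fin n)
  /-- besides the vertical strings, one string enters from the left, crosses them and leaves
  through the top, to their right -/
  | bracketRight (l : Fin n)
  /-- besides the horizontal strings, one string enters from the left, above them, and leaves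
  through the top -/
  | cobracketAbove (k : Fin m)
  /-- besides the horizontal strings, one string enters from the left, below them, crosses them
  and leaves through the top -/
  | cobracketBelow (k : Fin m)
  /-- only horizontal strings -/
  | horizontal (k : Fin m)
  /-- only vertical strings -/
  | vertical (l : Fin n)
  /-- no strings -/
  | empty
  deriving DecidableEq, Fintype

namespace Tile

variable {n m : ℕ}

/-- The number of strings on the top edge. -/
def top : Tile n m → ℕ
  | cross _ l => l + 1
  | bracketLeft l => l + 2
  | bracketRight l => l + 2
  | cobracketAbove _ => 1
  | cobracketBelow _ => 1
  | horizontal _ => 0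
  | vertical l => l + 1
  | empty => 0

/-- The number of strings on the bottom edge. -/
def bottom : Tile n m → ℕ
  | cross _ l => l + 1
  | bracketLeft l => l + 1
  | bracketRight l => l + 1
  | cobracketAbove _ => 0
  | cobracketBelow _ => 0
  | horizontal _ => 0
  | vertical l => l + 1
  | empty => 0

/-- The number of strings on the left edge. -/
def left : Tile n m → ℕ
  | cross k _ => k + 1
  | bracketLeft _ => 1
  | bracketRight _ => 1
  | cobracketAbove k => k + 2
  | cobracketBelow k => k + 2
  | horizontal k => k + 1
  | vertical _ => 0
  | empty => 0

/-- The number of strings on the right edge. -/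
def right : Tile n m → ℕ
  | cross k _ => k + 1
  | bracketLeft _ => 0
  | bracketRight _ => 0
  | cobracketAbove k => k + 1
  | cobracketBelow k => k + 1
  | horizontal k => k + 1
  | vertical _ => 0
  | empty => 0

/-- The tiles which contribute a sign. -/
def negative : Tile n m → Bool
  | bracketRight _ => true
  | cobracketBelow _ => true
  | _ => false

/-- The effect of a tile on its strings. Given the labels of the strings on the left edge (from top
to bottom) and on the bottom edge (from left to right), it returns the labels of the strings on the
top edge (from left to right) and on the right edge (from top to bottom). -/
def pass : Tile n m → List ℕ → List ℕ → List ℕ × List ℕ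
  | bracketLeft _, l, b => (l ++ b, [])
  | bracketRight _, l, b => (b ++ l, [])
  | cobracketAbove _, l, b => (l.take 1 ++ b, l.drop 1)
  | cobracketBelow _, l, b => (l.drop (l.length - 1) ++ b, l.take (l.length - 1))
  | _, l, b => (b, l)

end Tile

section Loom

variable {n m : ℕ}

/-- The number of strings on the left end of row `i` of a tiling (one if there are no columns). -/
def leftWeight (L : Fin n → Fin m → Tile n m) (i : Fin n) : ℕ :=
  if h : 0 < m then (L i ⟨0, h⟩).left else 1

/-- The number of strings on the right end of row `i` of a tiling (one if there are no columns). -/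
def rightWeight (L : Fin n → Fin m → Tile n m) (i : Fin n) : ℕ :=
  if h : 0 < m then (L i ⟨m - 1, Nat.sub_one_lt_of_lt h⟩).right else 1

/-- The number of strings on the top end of column `j` of a tiling (one if there are no rows). -/
def topWeight (L : Fin n → Fin m → Tile n m) (j : Fin m) : ℕ :=
  if h : 0 < n then (L ⟨0, h⟩ j).top else 1

/-- The number of strings on the bottom end of column `j` of a tiling (one if there are no rows). -/
def bottomWeight (L : Fin n → Fin m → Tile n m) (j : Fin m) : ℕ :=
  if h : 0 < n then (L ⟨n - 1, Nat.sub_one_lt_of_lt h⟩ j).bottom else 1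

/-- The conditions on a tiling of the grid with `n` rows and `m` columns to be a loom. If `n = 0`
or `m = 0` there is exactly one tiling, and it stands for `m` vertical or `n` horizontal strings. -/
structure IsLoom (L : Fin n → Fin m → Tile n m) : Prop where
  bottom_eq_top : ∀ (i i' : Fin n) (j : Fin m), (i' : ℕ) = i + 1 → (L i j).bottom = (L i' j).top
  right_eq_left : ∀ (i : Fin n) (j j' : Fin m), (j' : ℕ) = j + 1 → (L i j).right = (L i j').left
  ingoing : ∑ i, leftWeight L i + ∑ j, bottomWeight L j = n + m
  outgoing : ∑ i, rightWeight L i + ∑ j, topWeight L j = n + m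
  first_row : ∀ (i : Fin n) (j : Fin m), (i : ℕ) = 0 →
    (∀ k, L i j ≠ .horizontal k) ∧ L i j ≠ .empty
  first_column : ∀ (i : Fin n) (j : Fin m), (j : ℕ) = 0 →
    (∀ l, L i j ≠ .vertical l) ∧ L i j ≠ .empty

/-- The set of `n × m` Drinfeld–Yetter looms. -/
def Loom (n m : ℕ) : Type := {L : Fin n → Fin m → Tile n m // IsLoom L}

/-- Let strings run through a row of tiles: from the labels on the left end and on the bottom edges
to the labels on the top edges and on the right end. -/
def rowPass : {q : ℕ} → (Fin q → Tile n m) → List ℕ → (Fin q → List ℕ) →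
    (Fin q → List ℕ) × List ℕ
  | 0, _, l, b => (b, l)
  | _ + 1, T, l, b =>
    let first := (T 0).pass l (b 0)
    let rest := rowPass (Fin.tail T) first.2 (Fin.tail b)
    (Fin.cons first.1 rest.1, rest.2)

/-- Let strings run through a grid of tiles, the rows being counted from top to bottom: from the
labels on the left ends and on the bottom ends to the labels on the top ends and on the right
ends. -/
def gridPass {q : ℕ} : {p : ℕ} → (Fin p → Fin q → Tile n m) → (Fin p → List ℕ) →
    (Fin q → List ℕ) → (Fin q → List ℕ) × (Fin p → List ℕ)
  | 0, _, l, b => (b, l)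
  | _ + 1, L, l, b =>
    let below := gridPass (Fin.tail L) (Fin.tail l) b
    let first := rowPass (L 0) (l 0) below.1
    (first.1, Fin.cons first.2 below.2)

/-- Consecutive lists of consecutive labels, starting at `s`, of the prescribed lengths. -/
def chunks : {q : ℕ} → (Fin q → ℕ) → ℕ → Fin q → List ℕ
  | 0, _, _ => Fin.elim0
  | _ + 1, w, s => Fin.cons (List.range' s (w 0)) (chunks (Fin.tail w) (s + w 0))

/-- The concatenation of finitely many lists. -/
def concat {q : ℕ} (f : Fin q → List ℕ) : List ℕ := (List.ofFn f).flatten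

/-- Glue `σ` to the left edge and `τ` to the top edge of a tiling, moving together the strings which
belong to the same tile: the bundle of strings at the outer left position `p` enters row `σ p`, and
the bundle leaving column `j` ends at the outer top position `τ j`. Number the ingoing strings
`0, 1, 2, …`, on the left from top to bottom and then on the bottom from left to right. The result
is the list of the numbers of the outgoing strings, on the top from left to right and then on the
right from top to bottom. -/
def outgoingList (σ : Equiv.Perm (Fin n)) (L : Fin n → Fin m → Tile n m)
    (τ : Equiv.Perm (Fin m)) : List ℕ :=
  let l : Fin n → List ℕ := fun i => chunks (fun p => leftWeight L (σ p)) 0 (σ.symm i)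
  let b : Fin m → List ℕ := chunks (bottomWeight L) (∑ i, leftWeight L i)
  let out := gridPass L l b
  concat (fun q => out.1 (τ.symm q)) ++ concat out.2

theorem concat_succ {q : ℕ} (f : Fin (q + 1) → List ℕ) :
    concat f = f 0 ++ concat (Fin.tail f) := by
  simp only [concat, List.ofFn_succ, List.flatten_cons]
  rfl

theorem concat_comp_perm {q : ℕ} (f : Fin q → List ℕ) (τ : Equiv.Perm (Fin q)) :
    (concat (fun i => f (τ i))).Perm (concat f) :=
  (Equiv.Perm.ofFn_comp_perm τ f).flatten

theorem pass_perm (t : Tile n m) (l b : List ℕ) :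
    ((t.pass l b).1 ++ (t.pass l b).2).Perm (l ++ b) := by
  cases t <;> simp only [Tile.pass, List.append_nil]
  case cobracketAbove =>
    rw [List.append_assoc]
    conv_rhs => rw [← List.take_append_drop 1 l, List.append_assoc]
    exact List.Perm.append_left _ List.perm_append_comm
  case cobracketBelow =>
    conv_rhs => rw [← List.take_append_drop (l.length - 1) l, List.append_assoc]
    exact List.perm_append_comm
  case bracketLeft => rfl
  all_goals exact List.perm_append_comm

theorem rowPass_perm : {q : ℕ} → (T : Fin q → Tile n m) → (l : List ℕ) → (b : Fin q → List ℕ) →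
    (concat (rowPass T l b).1 ++ (rowPass T l b).2).Perm (l ++ concat b)
  | 0, _, _, _ => by simp [rowPass, concat]
  | _ + 1, T, l, b => by
    have ih := rowPass_perm (Fin.tail T) ((T 0).pass l (b 0)).2 (Fin.tail b)
    have h := pass_perm (T 0) l (b 0)
    simp only [rowPass, concat_succ, Fin.cons_zero, Fin.tail_cons, List.append_assoc]
    refine (List.Perm.append_left _ ih).trans ?_
    rw [← List.append_assoc, ← List.append_assoc]
    exact List.Perm.append_right _ h

theorem gridPass_perm {q : ℕ} : {p : ℕ} → (L : Fin p → Fin q → Tile n m) →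
    (l : Fin p → List ℕ) → (b : Fin q → List ℕ) →
    (concat (gridPass L l b).1 ++ concat (gridPass L l b).2).Perm (concat l ++ concat b)
  | 0, _, _, _ => by simp [gridPass, concat]
  | _ + 1, L, l, b => by
    have ih := gridPass_perm (Fin.tail L) (Fin.tail l) b
    have h := rowPass_perm (L 0) (l 0) (gridPass (Fin.tail L) (Fin.tail l) b).1
    simp only [gridPass, concat_succ, Fin.cons_zero, Fin.tail_cons]
    rw [← List.append_assoc]
    refine (List.Perm.append_right _ h).trans ?_
    rw [List.append_assoc, List.append_assoc]
    exact List.Perm.append_left _ ih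

theorem concat_chunks : {q : ℕ} → (w : Fin q → ℕ) → (s : ℕ) →
    concat (chunks w s) = List.range' s (∑ i, w i)
  | 0, _, _ => by simp [concat]
  | _ + 1, w, s => by
    rw [concat_succ, chunks, Fin.cons_zero, Fin.tail_cons, concat_chunks, Fin.sum_univ_succ]
    simp [Fin.tail, List.range'_append_1]

theorem outgoingList_perm (σ : Equiv.Perm (Fin n)) (L : Fin n → Fin m → Tile n m)
    (τ : Equiv.Perm (Fin m)) :
    (outgoingList σ L τ).Perm
      (List.range (∑ i, leftWeight L i + ∑ j, bottomWeight L j)) := by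
  unfold outgoingList
  refine (List.Perm.append_right _ (concat_comp_perm _ τ.symm)).trans ?_
  refine (gridPass_perm L _ _).trans ?_
  refine (List.Perm.append_right _ (concat_comp_perm _ σ.symm)).trans ?_
  rw [concat_chunks, concat_chunks, Equiv.sum_comp σ (leftWeight L), List.range_eq_range',
    ← List.range'_append_1, zero_add]

/-- The permutation `γ̃(σ, L, τ)`: it sends the position of an ingoing string to the position at
which the string leaves. -/
noncomputable def gamma (σ : Equiv.Perm (Fin n)) (L : Loom n m) (τ : Equiv.Perm (Fin m)) :
    Equiv.Perm (Fin (n + m)) :=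
  have h : (outgoingList σ L.1 τ).Perm (List.range (n + m)) :=
    L.2.ingoing ▸ outgoingList_perm σ L.1 τ
  have hlen : (outgoingList σ L.1 τ).length = n + m := by simpa using h.length_eq
  (Equiv.ofBijective
    (fun q : Fin (n + m) => (⟨(outgoingList σ L.1 τ)[(q : ℕ)]'(by rw [hlen]; exact q.2),
      List.mem_range.1 (h.mem_iff.1 (List.getElem_mem _))⟩ : Fin (n + m)))
    (Finite.injective_iff_bijective.1 fun p q hpq => Fin.ext
      ((List.Nodup.getElem_inj_iff (h.nodup_iff.2 List.nodup_range)).1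
        (congrArg Fin.val hpq)))).symm

/-- The number of sign-contributing tiles of a loom. -/
def negCount (L : Loom n m) : ℕ :=
  (Finset.univ.filter fun p : Fin n × Fin m => (L.1 p.1 p.2).negative = true).card

/-- The number of positive looms associated with `π`. -/
noncomputable def posLooms (σ : Equiv.Perm (Fin n)) (τ : Equiv.Perm (Fin m))
    (π : Equiv.Perm (Fin (n + m))) : ℕ :=
  Nat.card {L : Loom n m // gamma σ L τ = π ∧ (-1 : ℤ) ^ negCount L = 1}

/-- The number of negative looms associated with `π`. -/
noncomputable def negLooms (σ : Equiv.Perm (Fin n)) (τ : Equiv.Perm (Fin m))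
    (π : Equiv.Perm (Fin (n + m))) : ℕ :=
  Nat.card {L : Loom n m // gamma σ L τ = π ∧ (-1 : ℤ) ^ negCount L = -1}

end Loom

end DrinfeldYetter

/-! An element `r K σ` is a chord diagram on the module line: `n` coactions, each opening a Lie
string, followed by `n` actions, each absorbing one. Such a diagram is recorded by a word in letters
`coact x` and `act x`, and the words with all coactions before all actions evaluate exactly to the
elements `r` (`eval_normalWord`). The product of `r K σ` and `r K τ` is the word in which the
actions of the first factor stand before the coactions of the second, so the task is to move the
former past the latter.

The elementary move is `eval_exchange`. The Drinfeld–Yetter relation replaces an action of `x`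
followed by a coaction of `y` by the exchanged pair, plus a bracket term, minus a cobracket term.
The bracket slides forward along the string `y` to the action absorbing it, where the Lie action
relation resolves it into the two orders of acting by `x` and `y`. The cobracket slides backward
along the string `x` to the coaction creating it, where the Lie coaction relation resolves it into
two orders of creation. The result is five words on the same chords, with signs and without any
bracket or cobracket.

Arrange the exchanges in a grid, with the actions of the first factor as rows and the coactions of
the second as columns. The five terms are the tiles of types 1 to 5. A bracket absorbs the string of
its row, so the row continues with tiles 7 and 8; a cobracket removes the string of its column, so
the column continues downwards with tiles 6 and 8. Iterating gives a signed sum over all consistent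
tilings by shapes (`eval_row`, `eval_grid`).

Three further facts finish the proof. A word with distinct labels determines its morphism, which is
coherence for permutations of strings (`IsPerm.unique`, `Mor.unique`). Consistent tilings by shapes
are the same as looms, since the count of boundary strings forces at most one string on each right
and bottom end and all other multiplicities follow by counting (`IsLoom.ends`, `skeleton_injective`,
`isLoom_fillSkeleton`). Finally, running strings through a loom reproduces the substitutions of
labels made by the expansion (`gridPass_rowBundle`), so each term is the `r` of the loom's
permutation (`eval_gridWord_skeleton`). -/

namespace DrinfeldYetter

universe u v

/-! ### String calculus: spectator strings, crossings and the Drinfeld–Yetter relations. -/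

section Calculus

variable {K : Type u} [Field K]

local infixr:80 " ⨾ " => Hom.comp

namespace Hom

variable {a b c d : List Color}

theorem neg_def (f : Hom K a b) : -f = (-1 : K) • f := rfl

theorem neg_comp (f : Hom K a b) (g : Hom K b c) : comp (-f) g = -comp f g := smul_comp _ f g

theorem comp_neg (f : Hom K a b) (g : Hom K b c) : comp f (-g) = -comp f g := comp_smul _ f g

theorem sub_comp (f f' : Hom K a b) (g : Hom K b c) :
    comp (f - f') g = comp f g - comp f' g := by
  rw [sub_eq_add_neg, add_comp, neg_comp, sub_eq_add_neg]

theorem comp_sub (f : Hom K a b) (g g' : Hom K b c) :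
    comp f (g - g') = comp f g - comp f g' := by
  rw [sub_eq_add_neg, comp_add, comp_neg, sub_eq_add_neg]

theorem tensor_sub (f : Hom K a b) (g g' : Hom K c d) :
    tensor f (g - g') = tensor f g - tensor f g' := by
  rw [sub_eq_add_neg, sub_eq_add_neg, tensor_add, neg_def, tensor_smul, ← neg_def]

end Hom

variable {a b c : List Color}

theorem consLie_id (a : List Color) : consLie (Hom.id K a) = Hom.id K (.lie :: a) := Hom.tensor_id

theorem consLie_comp (f : Hom K a b) (g : Hom K b c) :
    consLie (f ⨾ g) = consLie f ⨾ consLie g := by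
  refine Eq.trans ?_ (Hom.tensor_comp (Hom.id K [.lie]) (Hom.id K [.lie]) f g)
  rw [Hom.id_comp]; rfl

theorem consLie_add (f g : Hom K a b) : consLie (f + g) = consLie f + consLie g :=
  Hom.tensor_add _ f g

theorem consLie_sub (f g : Hom K a b) : consLie (f - g) = consLie f - consLie g :=
  Hom.tensor_sub _ f g

/-- The crossing of the first two strings. -/
def cross (K : Type u) [Field K] (X : List Color) : Hom K (.lie :: .lie :: X) (.lie :: .lie :: X) :=
  Hom.tensor (Hom.braid K [.lie] [.lie]) (Hom.id K X)

/-- The bracket of the first two strings. -/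
def bracket (K : Type u) [Field K] (X : List Color) : Hom K (.lie :: .lie :: X) (.lie :: X) :=
  Hom.tensor (Hom.mu K) (Hom.id K X)

/-- The cobracket of the first string. -/
def cobracket (K : Type u) [Field K] (X : List Color) : Hom K (.lie :: X) (.lie :: .lie :: X) :=
  Hom.tensor (Hom.delta K) (Hom.id K X)

/-- Associativity holds in the PROP only up to casts. When the first two words are explicit, both
bracketings have definitionally equal types, so `eq_of_heq` turns this into an honest equation. -/
theorem tensor_assoc_of_eq {a₁ b₁ a₂ b₂ a₃ b₃ : List Color} (f : Hom K a₁ b₁) (g : Hom K a₂ b₂)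
    (h : Hom K a₃ b₃) : HEq (Hom.tensor (Hom.tensor f g) h) (Hom.tensor f (Hom.tensor g h)) := by
  have key : ∀ {a b a' b' : List Color} (ha : a = a') (hb : b = b') (p : Hom K a b)
      (q : Hom K a' b'), p ⨾ Hom.cast K hb = Hom.cast K ha ⨾ q → HEq p q := by
    intro a b a' b' ha hb p q h
    subst ha hb
    rw [Hom.cast_rfl, Hom.cast_rfl, Hom.comp_id, Hom.id_comp] at h
    exact heq_of_eq h
  exact key _ _ _ _ (Hom.tensor_assoc f g h)

theorem consLie_consLie (f : Hom K a b) :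
    consLie (consLie f) = Hom.tensor (Hom.id K [.lie, .lie]) f := by
  have h := eq_of_heq (tensor_assoc_of_eq (Hom.id K [.lie]) (Hom.id K [.lie]) f)
  rw [Hom.tensor_id] at h
  exact h.symm

theorem tensor_id_comp (f : Hom K a b) (g : Hom K b c) (X : List Color) :
    Hom.tensor (f ⨾ g) (Hom.id K X) = Hom.tensor f (Hom.id K X) ⨾ Hom.tensor g (Hom.id K X) := by
  rw [← Hom.tensor_comp, Hom.id_comp]

theorem tensor_consLie (f : Hom K a b) (X : List Color) :
    Hom.tensor (consLie f) (Hom.id K X) = consLie (Hom.tensor f (Hom.id K X)) :=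
  eq_of_heq (tensor_assoc_of_eq (Hom.id K [.lie]) f (Hom.id K X))

theorem cross_lie (X : List Color) :
    Hom.tensor (cross K [.lie]) (Hom.id K X) = cross K (.lie :: X) := by
  have h := eq_of_heq (tensor_assoc_of_eq (Hom.braid K [.lie] [.lie]) (Hom.id K [.lie]) (Hom.id K X))
  rw [Hom.tensor_id] at h
  exact h

theorem bracket_lie (X : List Color) :
    Hom.tensor (bracket K [.lie]) (Hom.id K X) = bracket K (.lie :: X) := by
  have h := eq_of_heq (tensor_assoc_of_eq (Hom.mu K) (Hom.id K [.lie]) (Hom.id K X))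
  rw [Hom.tensor_id] at h
  exact h

theorem cobracket_lie (X : List Color) :
    Hom.tensor (cobracket K [.lie]) (Hom.id K X) = cobracket K (.lie :: X) := by
  have h := eq_of_heq (tensor_assoc_of_eq (Hom.delta K) (Hom.id K [.lie]) (Hom.id K X))
  rw [Hom.tensor_id] at h
  exact h

theorem cross_cross (X : List Color) : cross K X ⨾ cross K X = Hom.id K (.lie :: .lie :: X) := by
  refine (tensor_id_comp (Hom.braid K [.lie] [.lie]) (Hom.braid K [.lie] [.lie]) X).symm.trans ?_
  rw [Hom.braid_symm]
  exact Hom.tensor_id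

theorem interchange {p q : List Color} (f : Hom K p q) (g : Hom K a b) :
    Hom.tensor f (Hom.id K a) ⨾ Hom.tensor (Hom.id K q) g =
      Hom.tensor (Hom.id K p) g ⨾ Hom.tensor f (Hom.id K b) := by
  rw [← Hom.tensor_comp, ← Hom.tensor_comp, Hom.id_comp, Hom.id_comp, Hom.comp_id, Hom.comp_id]

theorem cross_natural (f : Hom K a b) :
    cross K a ⨾ consLie (consLie f) = consLie (consLie f) ⨾ cross K b := by
  rw [consLie_consLie]
  exact interchange (Hom.braid K [.lie] [.lie]) f

theorem bracket_natural (f : Hom K a b) :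
    bracket K a ⨾ consLie f = consLie (consLie f) ⨾ bracket K b := by
  rw [consLie_consLie]
  exact interchange (Hom.mu K) f

theorem cobracket_natural (f : Hom K a b) :
    cobracket K a ⨾ consLie (consLie f) = consLie f ⨾ cobracket K b := by
  rw [consLie_consLie]
  exact interchange (Hom.delta K) f

theorem braid_one_two : Hom.braid K [.lie] [.lie, .lie] =
    cross K [.lie] ⨾ consLie (Hom.braid K [.lie] [.lie]) := by
  have h := Hom.braid_hexagon (K := K) [.lie] [.lie] [.lie]
  have h1 : Hom.cast K (List.append_assoc [Color.lie] [.lie] [.lie]) = Hom.id K _ := rfl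
  rw [h1, Hom.id_comp, Hom.comp_id, Hom.id_comp] at h
  exact h

theorem braid_one_two_tensor (X : List Color) :
    Hom.tensor (Hom.braid K [.lie] [.lie, .lie]) (Hom.id K X) =
      cross K (.lie :: X) ⨾ consLie (cross K X) := by
  rw [braid_one_two, tensor_id_comp, cross_lie, tensor_consLie]
  rfl

/-- This is naturality of the braiding of one string with two, applied to the crossing of those two;
the hexagon splits that braiding into elementary crossings. Replacing the crossing by `mu` or
`delta` gives the two sliding lemmas below. -/
theorem yang_baxter (X : List Color) :
    consLie (cross K X) ⨾ cross K (.lie :: X) ⨾ consLie (cross K X) =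
      cross K (.lie :: X) ⨾ consLie (cross K X) ⨾ cross K (.lie :: X) := by
  have h := congrArg (fun f => Hom.tensor f (Hom.id K X))
    (Hom.braid_natural (Hom.id K [.lie]) (Hom.braid K [.lie] [.lie]))
  have h2 := ((tensor_id_comp _ _ X).symm.trans h).trans (tensor_id_comp _ _ X)
  have h3 := braid_one_two_tensor (K := K) X
  have h4 := tensor_consLie (Hom.braid K [.lie] [.lie]) X
  have h5 := cross_lie (K := K) X
  refine Eq.trans ?_ (h2.trans ?_)
  · exact (congrArg₂ Hom.comp h4 h3).symm
  · refine (congrArg₂ Hom.comp h3 h5).trans ?_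
    rw [Hom.comp_assoc]

theorem consLie_bracket_cross (X : List Color) :
    consLie (bracket K X) ⨾ cross K X =
      cross K (.lie :: X) ⨾ consLie (cross K X) ⨾ bracket K (.lie :: X) := by
  have h := congrArg (fun f => Hom.tensor f (Hom.id K X))
    (Hom.braid_natural (Hom.id K [.lie]) (Hom.mu K))
  have h2 := ((tensor_id_comp _ _ X).symm.trans h).trans (tensor_id_comp _ _ X)
  have h3 := braid_one_two_tensor (K := K) X
  have h4 := tensor_consLie (Hom.mu K) X
  have h5 := bracket_lie (K := K) X
  refine Eq.trans ?_ (h2.trans ?_)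
  · exact (congrArg₂ Hom.comp h4 rfl).symm
  · refine (congrArg₂ Hom.comp h3 h5).trans ?_
    rw [Hom.comp_assoc]

theorem consLie_cobracket_cross (X : List Color) :
    consLie (cobracket K X) ⨾ cross K (.lie :: X) ⨾ consLie (cross K X) =
      cross K X ⨾ cobracket K (.lie :: X) := by
  have h := congrArg (fun f => Hom.tensor f (Hom.id K X))
    (Hom.braid_natural (Hom.id K [.lie]) (Hom.delta K))
  have h2 := ((tensor_id_comp _ _ X).symm.trans h).trans (tensor_id_comp _ _ X)
  have h3 := braid_one_two_tensor (K := K) X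
  have h4 := tensor_consLie (Hom.delta K) X
  have h5 := cobracket_lie (K := K) X
  refine Eq.trans ?_ (h2.trans ?_)
  · exact (congrArg₂ Hom.comp h4 h3).symm
  · exact congrArg₂ Hom.comp rfl h5

theorem comp_comp_eq {x y z w : List Color} {f : Hom K x y} {g : Hom K y z} {h : Hom K x z}
    (e : f ⨾ g = h) (k : Hom K z w) : f ⨾ g ⨾ k = h ⨾ k := by
  rw [← Hom.comp_assoc, e]

theorem cross_cross_assoc {X Y : List Color} (k : Hom K (.lie :: .lie :: X) Y) :
    cross K X ⨾ cross K X ⨾ k = k := by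
  rw [comp_comp_eq (cross_cross X), Hom.id_comp]

theorem consLie_cross_cross (X : List Color) :
    consLie (cross K X) ⨾ consLie (cross K X) = Hom.id K (.lie :: .lie :: .lie :: X) := by
  rw [← consLie_comp, cross_cross, consLie_id]

theorem consLie_cross_cross_assoc {X Y : List Color} (k : Hom K (.lie :: .lie :: .lie :: X) Y) :
    consLie (cross K X) ⨾ consLie (cross K X) ⨾ k = k := by
  rw [comp_comp_eq (consLie_cross_cross X), Hom.id_comp]

/-- The Drinfeld–Yetter relations for an action and a coaction on the word `X`. -/
structure IsModule (X : List Color) (a : Hom K (.lie :: X) X) (c : Hom K X (.lie :: X)) :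
    Prop where
  act_coact : a ⨾ c =
    consLie c ⨾ cross K X ⨾ consLie a + consLie c ⨾ bracket K X - cobracket K X ⨾ consLie a
  bracket_act : bracket K X ⨾ a = consLie a ⨾ a - cross K X ⨾ consLie a ⨾ a
  coact_cobracket : c ⨾ cobracket K X = c ⨾ consLie c ⨾ cross K X - c ⨾ consLie c

theorem isModule_mod : IsModule (K := K) [.mod] (Hom.act K) (Hom.coact K) where
  act_coact := by
    refine (Hom.sound Rel.drinfeld_yetter).trans ?_
    rw [sub_eq_add_neg]
    rfl
  bracket_act := by
    refine (Hom.sound Rel.lie_action).trans ?_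
    rw [sub_eq_add_neg]
    rfl
  coact_cobracket := by
    refine (Hom.sound Rel.lie_coaction).trans ?_
    rw [← Hom.comp_assoc, sub_eq_add_neg]
    rfl

/-- A spectator string does not disturb the relations: the acting string and the coaction leg simply
cross it. Each relation for `X`, whiskered by the spectator, is conjugated by crossings; the
Yang–Baxter equation and the sliding of brackets and cobrackets through a crossing bring it to the
required form. -/
theorem IsModule.cons {X : List Color} {a : Hom K (.lie :: X) X} {c : Hom K X (.lie :: X)}
    (h : IsModule X a c) :
    IsModule (.lie :: X) (cross K X ⨾ consLie a) (consLie c ⨾ cross K X) where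
  act_coact := by
    have h1 := congrArg consLie h.act_coact
    rw [consLie_comp, consLie_sub, consLie_add] at h1
    simp only [consLie_comp] at h1
    have e1 : cross K X ⨾ consLie (consLie c) ⨾ consLie (cross K X) ⨾ consLie (consLie a) ⨾
        cross K X = consLie (consLie c) ⨾ consLie (cross K X) ⨾ cross K (.lie :: X) ⨾
          consLie (cross K X) ⨾ consLie (consLie a) := by
      rw [← cross_natural, comp_comp_eq (cross_natural c), Hom.comp_assoc]
      have yb := comp_comp_eq (yang_baxter (K := K) X) (consLie (consLie a))
      simp only [Hom.comp_assoc] at yb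
      rw [yb]
    have e2 : cross K X ⨾ consLie (consLie c) ⨾ consLie (bracket K X) ⨾ cross K X =
        consLie (consLie c) ⨾ consLie (cross K X) ⨾ bracket K (.lie :: X) := by
      rw [comp_comp_eq (cross_natural c), Hom.comp_assoc, consLie_bracket_cross,
        cross_cross_assoc]
    have e3 : cross K X ⨾ consLie (cobracket K X) ⨾ consLie (consLie a) ⨾ cross K X =
        cobracket K (.lie :: X) ⨾ consLie (cross K X) ⨾ consLie (consLie a) := by
      have hc : cross K X ⨾ consLie (cobracket K X) ⨾ cross K (.lie :: X) =
          cobracket K (.lie :: X) ⨾ consLie (cross K X) := by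
        have := congrArg (fun f => cross K X ⨾ f ⨾ consLie (cross K X))
          (consLie_cobracket_cross (K := K) X)
        simp only [Hom.comp_assoc, consLie_cross_cross, Hom.comp_id, cross_cross_assoc] at this
        exact this
      have := congrArg (fun f => f ⨾ consLie (consLie a)) hc
      simp only [Hom.comp_assoc] at this
      rw [← cross_natural, this]
    rw [Hom.comp_assoc, comp_comp_eq h1]
    simp only [Hom.sub_comp, Hom.comp_sub, Hom.add_comp, Hom.comp_add, Hom.comp_assoc,
      consLie_comp, e1, e2, e3]
  bracket_act := by
    have h1 := congrArg consLie h.bracket_act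
    rw [consLie_comp, consLie_sub] at h1
    simp only [consLie_comp] at h1
    have e1 : bracket K (.lie :: X) ⨾ cross K X =
        consLie (cross K X) ⨾ cross K (.lie :: X) ⨾ consLie (bracket K X) := by
      have := congrArg (fun f => consLie (cross K X) ⨾ cross K (.lie :: X) ⨾ f ⨾ cross K X)
        (consLie_bracket_cross (K := K) X)
      simp only [Hom.comp_assoc, cross_cross, Hom.comp_id, cross_cross_assoc,
        consLie_cross_cross_assoc] at this
      exact this.symm
    have e2 := congrArg (fun f => f ⨾ consLie (consLie a) ⨾ consLie a) (yang_baxter (K := K) X)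
    simp only [Hom.comp_assoc] at e2
    have e3 := comp_comp_eq (cross_natural a) (consLie a)
    simp only [Hom.comp_assoc] at e3
    have e4 := congrArg (fun f => f ⨾ consLie a) e1
    simp only [Hom.comp_assoc] at e4
    rw [e4, h1]
    simp only [Hom.comp_sub, Hom.comp_assoc, consLie_comp, ← e3, e2]
  coact_cobracket := by
    have h1 := congrArg consLie h.coact_cobracket
    rw [consLie_comp, consLie_sub] at h1
    simp only [consLie_comp] at h1
    have e1 := consLie_cobracket_cross (K := K) X
    have e2 := cross_natural c
    have e3 : cross K X ⨾ cobracket K (.lie :: X) =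
        consLie (cobracket K X) ⨾ cross K (.lie :: X) ⨾ consLie (cross K X) := e1.symm
    have e4 := congrArg (fun f => f ⨾ cross K (.lie :: X) ⨾ consLie (cross K X)) h1
    simp only [Hom.sub_comp, Hom.comp_assoc] at e4
    have e5 := comp_comp_eq e2 (consLie (cross K X))
    have e6 := comp_comp_eq e2 (consLie (cross K X) ⨾ cross K (.lie :: X))
    simp only [Hom.comp_assoc] at e5 e6
    rw [Hom.comp_assoc, e3, e4]
    simp only [Hom.comp_assoc, consLie_comp, e5, e6, yang_baxter]

end Calculus

/-! ### Labelled strings and coherence of permutation morphisms. -/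

/-- The letters of a chord word: the coaction creating the string `x` and the action absorbing
it. -/
inductive Letter (α : Type v) : Type v
  | coact (x : α)
  | act (x : α)

namespace Letter

/-- The labels of the coactions of a word. -/
def coacts {α : Type v} : List (Letter α) → List α
  | [] => []
  | .coact x :: W => x :: coacts W
  | .act _ :: W => coacts W

end Letter

section Words

variable {K : Type u} [Field K] {α : Type v}

local infixr:80 " ⨾ " => Hom.comp

/-- The object `[1]^k ⊗ [V₁]`, the strings `[1]` being labelled by the elements of a list. -/
def strands : List α → List Color
  | [] => [.mod]
  | _ :: s => .lie :: strands s

/-- The action of the first string on the module, the other strings being spectators. -/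
def frontAct (K : Type u) [Field K] : (s : List α) → Hom K (.lie :: strands s) (strands s)
  | [] => .act K
  | _ :: s => cross K (strands s) ⨾ consLie (frontAct K s)

/-- The coaction of the module whose leg becomes the first string. -/
def frontCoact (K : Type u) [Field K] : (s : List α) → Hom K (strands s) (.lie :: strands s)
  | [] => .coact K
  | _ :: s => consLie (frontCoact K s) ⨾ cross K (strands s)

theorem isModule_strands : (s : List α) →
    IsModule (K := K) (strands s) (frontAct K s) (frontCoact K s)
  | [] => isModule_mod
  | _ :: s => (isModule_strands s).cons

/-- The morphisms which only permute labelled strings. -/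
inductive IsPerm (K : Type u) [Field K] :
    (s t : List α) → Hom K (strands s) (strands t) → Prop
  | nil : IsPerm K [] [] (Hom.id K _)
  | cons (x : α) {s t : List α} {f : Hom K (strands s) (strands t)} :
      IsPerm K s t f → IsPerm K (x :: s) (x :: t) (consLie f)
  | swap (x y : α) (s : List α) : IsPerm K (x :: y :: s) (y :: x :: s) (cross K (strands s))
  | trans {s t r : List α} {f : Hom K (strands s) (strands t)} {g : Hom K (strands t) (strands r)} :
      IsPerm K s t f → IsPerm K t r g → IsPerm K s r (f ⨾ g)

theorem IsPerm.refl : (s : List α) → IsPerm K s s (Hom.id K _)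
  | [] => .nil
  | x :: s => consLie_id (K := K) (strands s) ▸ IsPerm.cons x (IsPerm.refl s)

theorem IsPerm.perm {s t : List α} {f : Hom K (strands s) (strands t)} (h : IsPerm K s t f) :
    s.Perm t := by
  induction h with
  | nil => exact .nil
  | cons x _ ih => exact ih.cons x
  | swap x y s => exact .swap y x s
  | trans _ _ ih ih' => exact ih.trans ih'

theorem exists_isPerm {s t : List α} (h : s.Perm t) : ∃ f, IsPerm K s t f := by
  induction h with
  | nil => exact ⟨_, .nil⟩
  | cons x _ ih => exact ih.elim fun f hf => ⟨_, hf.cons x⟩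
  | swap x y s => exact ⟨_, .swap y x s⟩
  | trans _ _ ih ih' => exact ih.elim fun f hf => ih'.elim fun g hg => ⟨_, hf.trans hg⟩

/-- The acting string crosses all spectators, so permuting them before or after makes no difference;
for an elementary crossing this is the Yang–Baxter equation. This makes the choice of arrangement of
the open strings immaterial. -/
theorem IsPerm.consLie_frontAct {s t : List α} {f : Hom K (strands s) (strands t)}
    (h : IsPerm K s t f) : consLie f ⨾ frontAct K t = frontAct K s ⨾ f := by
  induction h with
  | nil => rw [consLie_id, Hom.id_comp, Hom.comp_id]
  | @cons x s t f _ ih =>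
    change consLie (consLie f) ⨾ cross K (strands t) ⨾ consLie (frontAct K t) =
      (cross K (strands s) ⨾ consLie (frontAct K s)) ⨾ consLie f
    rw [Hom.comp_assoc, ← consLie_comp, ← ih, consLie_comp, comp_comp_eq (cross_natural f),
      Hom.comp_assoc]
  | swap x y s =>
    -- The identity is stated for an arbitrary word `X`, so that `strands` need only be unfolded by
    -- definitional equality in the final `exact`.
    have key : ∀ {X : List Color} (a : Hom K (.lie :: X) X),
        consLie (cross K X) ⨾ cross K (.lie :: X) ⨾ consLie (cross K X ⨾ consLie a) =
          (cross K (.lie :: X) ⨾ consLie (cross K X ⨾ consLie a)) ⨾ cross K X := by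
      intro X a
      have yb := comp_comp_eq (yang_baxter (K := K) X) (consLie (consLie a))
      simp only [Hom.comp_assoc] at yb
      simp only [consLie_comp, Hom.comp_assoc, yb]
      rw [← cross_natural]
    exact key _
  | @trans s t r f g _ _ ih ih' =>
    rw [consLie_comp, Hom.comp_assoc, ih', comp_comp_eq ih, Hom.comp_assoc]

theorem IsPerm.comp_frontCoact {s t : List α} {f : Hom K (strands s) (strands t)}
    (h : IsPerm K s t f) : f ⨾ frontCoact K t = frontCoact K s ⨾ consLie f := by
  induction h with
  | nil => rw [consLie_id, Hom.id_comp, Hom.comp_id]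
  | @cons x s t f _ ih =>
    change consLie f ⨾ consLie (frontCoact K t) ⨾ cross K (strands t) =
      (consLie (frontCoact K s) ⨾ cross K (strands s)) ⨾ consLie (consLie f)
    rw [Hom.comp_assoc, cross_natural, ← Hom.comp_assoc, ← Hom.comp_assoc, ← consLie_comp,
      ← consLie_comp, ih]
  | swap x y s =>
    have key : ∀ {X : List Color} (c : Hom K X (.lie :: X)),
        cross K X ⨾ consLie (consLie c ⨾ cross K X) ⨾ cross K (.lie :: X) =
          (consLie (consLie c ⨾ cross K X) ⨾ cross K (.lie :: X)) ⨾ consLie (cross K X) := by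
      intro X c
      simp only [consLie_comp, Hom.comp_assoc, yang_baxter]
      rw [comp_comp_eq (cross_natural c), Hom.comp_assoc]
    exact key _
  | @trans s t r f g _ _ ih ih' =>
    rw [Hom.comp_assoc, ih', comp_comp_eq ih, consLie_comp, Hom.comp_assoc]

/-- The first string is moved behind the strings of `w`. -/
def insertAfter (K : Type u) [Field K] (x : α) : (w s : List α) →
    Hom K (.lie :: strands (w ++ s)) (strands (w ++ x :: s))
  | [], _ => Hom.id K _
  | _ :: w, s => cross K (strands (w ++ s)) ⨾ consLie (insertAfter K x w s)

theorem Hom.cast_eq_id {a : List Color} (h : a = a) : Hom.cast K h = Hom.id K a := rfl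

/-- Any composite of crossings factors into the motion of one chosen string `x` and a permutation of
the others. The induction follows the construction of `f`, and distinctness of the labels makes the
position of `x` unambiguous. The factorization takes the place of a presentation of the symmetric
group in the coherence proof. -/
theorem IsPerm.remove {s t : List α} {f : Hom K (strands s) (strands t)} (h : IsPerm K s t f)
    (hn : s.Nodup) (x : α) : ∀ {w w' z z' : List α} (hs : w ++ x :: z = s) (ht : t = w' ++ x :: z'),
    ∃ g, IsPerm K (w ++ z) (w' ++ z') g ∧
      insertAfter K x w z ⨾ Hom.cast K (congrArg strands hs) ⨾ f ⨾ Hom.cast K (congrArg strands ht) =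
        consLie g ⨾ insertAfter K x w' z' := by
  induction h with
  | nil => intro w w' z z' hs; simp at hs
  | @cons y s t f hf ih =>
    intro w w' z z' hs ht
    have hnt : (y :: t).Nodup := ((hf.cons y).perm.nodup_iff).1 hn
    rcases w with _ | ⟨b, w⟩
    · rw [List.nil_append, List.cons.injEq] at hs
      obtain ⟨rfl, rfl⟩ := hs
      rcases w' with _ | ⟨b', w'⟩
      · rw [List.nil_append, List.cons.injEq] at ht
        obtain ⟨-, rfl⟩ := ht
        refine ⟨f, hf, ?_⟩
        have key : ∀ {A B : List Color} (f : Hom K A B), Hom.id K A ⨾ Hom.id K A ⨾ f ⨾ Hom.id K B =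
            f ⨾ Hom.id K B := by
          intro A B f
          simp only [Hom.id_comp]
        exact key (consLie f)
      · rw [List.cons_append, List.cons.injEq] at ht
        obtain ⟨rfl, rfl⟩ := ht
        simp at hnt
    · rw [List.cons_append, List.cons.injEq] at hs
      obtain ⟨rfl, rfl⟩ := hs
      rcases w' with _ | ⟨b', w'⟩
      · rw [List.nil_append, List.cons.injEq] at ht
        obtain ⟨rfl, rfl⟩ := ht
        simp at hn
      · rw [List.cons_append, List.cons.injEq] at ht
        obtain ⟨rfl, rfl⟩ := ht
        obtain ⟨g, hg, e⟩ := ih (List.nodup_cons.1 hn).2 rfl rfl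
        refine ⟨_, hg.cons b, ?_⟩
        have key : ∀ {A B C D : List Color} (i : Hom K (.lie :: A) B) (i' : Hom K (.lie :: C) D)
            (f : Hom K B D) (g : Hom K A C),
            i ⨾ Hom.id K B ⨾ f ⨾ Hom.id K D = consLie g ⨾ i' →
            (cross K A ⨾ consLie i) ⨾ Hom.id K _ ⨾ consLie f ⨾ Hom.id K _ =
              consLie (consLie g) ⨾ cross K C ⨾ consLie i' := by
          intro A B C D i i' f g e
          rw [Hom.id_comp, Hom.comp_id] at e ⊢
          rw [Hom.comp_assoc, ← consLie_comp, e, consLie_comp, comp_comp_eq (cross_natural g),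
            Hom.comp_assoc]
        exact key _ _ _ _ e
  | swap y z s =>
    intro w w' l l' hs ht
    rcases w with _ | ⟨b, _ | ⟨b', w⟩⟩
    · rw [List.nil_append, List.cons.injEq] at hs
      obtain ⟨rfl, rfl⟩ := hs
      obtain ⟨rfl, rfl⟩ : w' = [z] ∧ l' = s := by
        rcases w' with _ | ⟨c, _ | ⟨c', w'⟩⟩ <;> grind
      refine ⟨_, .refl _, ?_⟩
      have key : ∀ X : List Color, Hom.id K _ ⨾ Hom.id K _ ⨾ cross K X ⨾ Hom.id K _ =
          consLie (Hom.id K (.lie :: X)) ⨾ cross K X ⨾ consLie (Hom.id K (.lie :: X)) := by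
        intro X
        simp only [consLie_id, Hom.comp_id, Hom.id_comp]
      exact key _
    · simp only [List.cons_append, List.nil_append, List.cons.injEq] at hs
      obtain ⟨rfl, rfl, rfl⟩ := hs
      obtain ⟨rfl, rfl⟩ : w' = [] ∧ l' = b :: l := by
        rcases w' with _ | ⟨c, _ | ⟨c', w'⟩⟩ <;> grind
      refine ⟨_, .refl _, ?_⟩
      have key : ∀ X : List Color, (cross K X ⨾ consLie (Hom.id K (.lie :: X))) ⨾
          Hom.id K _ ⨾ cross K X ⨾ Hom.id K _ = consLie (Hom.id K (.lie :: X)) ⨾ Hom.id K _ := by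
        intro X
        simp only [consLie_id, Hom.comp_id, Hom.id_comp, cross_cross]
      exact key _
    · simp only [List.cons_append, List.cons.injEq] at hs
      obtain ⟨rfl, rfl, rfl⟩ := hs
      rcases w' with _ | ⟨c, _ | ⟨c', w'⟩⟩
      · exfalso; grind
      · exfalso; grind
      · have ht2 := ht
        simp only [List.cons_append, List.cons.injEq] at ht2
        obtain ⟨rfl, rfl, ht2⟩ := ht2
        have hnx : (w ++ x :: l).Nodup := (List.nodup_cons.1 (List.nodup_cons.1 hn).2).2
        have hnx' : (w' ++ x :: l').Nodup := by rw [← ht2]; exact hnx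
        -- The crossing involves neither occurrence of `x`, and `x` occurs only once, so its
        -- position is the same before and after.
        have e : w = w' ∧ l = l' := by
          rcases List.append_eq_append_iff.1 ht2 with ⟨as, rfl, h4⟩ | ⟨bs, rfl, h4⟩
          · rcases as with _ | ⟨d, as⟩ <;> grind
          · rcases bs with _ | ⟨d, bs⟩ <;> grind
        obtain ⟨rfl, rfl⟩ := e
        refine ⟨_, .swap _ _ _, ?_⟩
        have key : ∀ {A B : List Color} (i : Hom K (.lie :: A) B),
            (cross K (.lie :: A) ⨾ consLie (cross K A ⨾ consLie i)) ⨾ Hom.id K _ ⨾ cross K B ⨾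
              Hom.id K _ = consLie (cross K A) ⨾ cross K (.lie :: A) ⨾
                consLie (cross K A ⨾ consLie i) := by
          intro A B i
          have yb := comp_comp_eq (yang_baxter (K := K) A) (consLie (consLie i))
          simp only [Hom.comp_assoc] at yb
          simp only [consLie_comp, Hom.comp_assoc, Hom.id_comp, Hom.comp_id, yb]
          rw [← cross_natural]
        exact key _
  | @trans s t r f g hf hg ih ih' =>
    intro w w' z z' hs ht
    subst hs ht
    obtain ⟨a, b, rfl⟩ := List.append_of_mem (hf.perm.subset (by simp : x ∈ w ++ x :: z))
    obtain ⟨p, hp, e⟩ := ih hn rfl rfl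
    obtain ⟨q, hq, e'⟩ := ih' (hf.perm.nodup_iff.1 hn) rfl rfl
    refine ⟨_, hp.trans hq, ?_⟩
    simp only [Hom.cast_eq_id, Hom.comp_id, Hom.id_comp] at e e' ⊢
    rw [comp_comp_eq e, Hom.comp_assoc, e', consLie_comp, Hom.comp_assoc]

/-- The source is kept as a variable with an equation, since induction on `IsPerm` needs free
indices; the cast then plays the role of the identity. -/
theorem IsPerm.eq_cast {s t : List α} {f : Hom K (strands s) (strands t)} (h : IsPerm K s t f) :
    s = [] → ∀ e : strands s = strands t, f = Hom.cast K e := by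
  induction h with
  | nil => intro _ e; rfl
  | cons x _ _ => intro h; cases h
  | swap x y s => intro h; cases h
  | trans hf hg ih ih' =>
    rintro rfl e
    obtain rfl := hf.perm.nil_eq
    rw [ih rfl rfl, ih' rfl e]
    exact Hom.cast_comp_cast _ _

/-- Coherence. Detach the first string from both morphisms with `IsPerm.remove`: both become a
permutation of the remaining strings followed by the same insertion, and the permutations agree by
induction. -/
theorem IsPerm.unique : (s : List α) → s.Nodup → ∀ {t : List α}
    {f g : Hom K (strands s) (strands t)}, IsPerm K s t f → IsPerm K s t g → f = g
  | [], _, t, f, g, hf, hg => by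
    obtain rfl := hf.perm.nil_eq
    rw [hf.eq_cast rfl rfl, hg.eq_cast rfl rfl]
  | x :: s, hn, t, f, g, hf, hg => by
    obtain ⟨a, b, rfl⟩ := List.append_of_mem (hf.perm.subset (by simp : x ∈ x :: s))
    obtain ⟨p, hp, e⟩ := hf.remove hn x (w := []) rfl rfl
    obtain ⟨q, hq, e'⟩ := hg.remove hn x (w := []) rfl rfl
    have hpq : p = q := IsPerm.unique s (List.nodup_cons.1 hn).2 hp hq
    rw [hpq, ← e'] at e
    have key : ∀ {A B : List Color} {f g : Hom K A B}, Hom.id K A ⨾ Hom.id K A ⨾ f ⨾ Hom.id K B =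
        Hom.id K A ⨾ Hom.id K A ⨾ g ⨾ Hom.id K B → f = g := by
      intro A B f g h
      simpa only [Hom.id_comp, Hom.comp_id] using h
    exact key e

end Words

/-! ### Chord words, their values and the exchange relation. -/

section ChordWords

variable {K : Type u} [Field K] {α : Type v}

local infixr:80 " ⨾ " => Hom.comp

/-- `Mor K W s t f`: reading the chord word `W` from the state with open strings `s`, up to
permutations of the strings, gives the morphism `f` to the state with open strings `t`. -/
inductive Mor (K : Type u) [Field K] :
    List (Letter α) → (s t : List α) → Hom K (strands s) (strands t) → Prop
  | perm {s t : List α} {p : Hom K (strands s) (strands t)} : IsPerm K s t p → Mor K [] s t p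
  | coact (x : α) {W : List (Letter α)} {s t : List α}
      {f : Hom K (.lie :: strands s) (strands t)} :
      Mor K W (x :: s) t f → Mor K (.coact x :: W) s t (frontCoact K s ⨾ f)
  | act (x : α) {W : List (Letter α)} {s s' t : List α}
      {p : Hom K (strands s) (.lie :: strands s')} {f : Hom K (strands s') (strands t)} :
      IsPerm K s (x :: s') p → Mor K W s' t f → Mor K (.act x :: W) s t (p ⨾ frontAct K s' ⨾ f)

theorem Mor.precomp {W : List (Letter α)} {s t : List α} {f : Hom K (strands s) (strands t)}
    (h : Mor K W s t f) : ∀ {s' : List α} {p : Hom K (strands s') (strands s)},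
    IsPerm K s' s p → Mor K W s' t (p ⨾ f) := by
  induction h with
  | perm h => exact fun hp => .perm (hp.trans h)
  | coact x _ ih =>
    intro s' p hp
    rw [comp_comp_eq hp.comp_frontCoact, Hom.comp_assoc]
    exact .coact x (ih (hp.cons x))
  | act x hq h ih =>
    intro s' p hp
    rw [← Hom.comp_assoc]
    exact .act x (hp.trans hq) h

theorem Mor.append {P W : List (Letter α)} {s t r : List α} {f : Hom K (strands s) (strands t)}
    {g : Hom K (strands t) (strands r)} (h : Mor K P s t f) (h' : Mor K W t r g) :
    Mor K (P ++ W) s r (f ⨾ g) := by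
  induction h with
  | perm h => exact h'.precomp h
  | coact x _ ih =>
    rw [Hom.comp_assoc]
    exact .coact x (ih h')
  | act x hq h ih =>
    rw [Hom.comp_assoc, Hom.comp_assoc]
    exact .act x hq (ih h')

theorem Mor.split {W : List (Letter α)} {r : List α} : (P : List (Letter α)) → {s : List α} →
    {h : Hom K (strands s) (strands r)} → Mor K (P ++ W) s r h →
    ∃ t f g, Mor K P s t f ∧ Mor K W t r g
  | [], s, h, hh => ⟨s, Hom.id K _, h, .perm (.refl s), hh⟩
  | .coact x :: P, s, h, hh => by
    cases hh with | coact _ hh =>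
    obtain ⟨t, f, g, hf, hg⟩ := Mor.split P hh
    exact ⟨t, _, g, .coact x hf, hg⟩
  | .act x :: P, s, h, hh => by
    cases hh with | act _ hp hh =>
    obtain ⟨t, f, g, hf, hg⟩ := Mor.split P hh
    exact ⟨t, _, g, .act x hp hf, hg⟩

/-- A string that `W` does not touch can be carried along. The crossing contained in `frontCoact` or
`frontAct` of the longer list is cancelled by an explicit swap, which the definition of `Mor`
allows. -/
theorem Mor.cons (x : α) {W : List (Letter α)} {s t : List α}
    {f : Hom K (strands s) (strands t)} (h : Mor K W s t f) :
    Mor K W (x :: s) (x :: t) (consLie f) := by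
  induction h with
  | perm h => exact .perm (h.cons x)
  | @coact y W s t f _ ih =>
    have h1 := Mor.coact y (ih.precomp (.swap y x s))
    have key : ∀ {A B : List Color} (c : Hom K A (.lie :: A)) (f : Hom K (.lie :: A) B),
        (consLie c ⨾ cross K A) ⨾ cross K A ⨾ consLie f = consLie (c ⨾ f) := by
      intro A B c f
      rw [Hom.comp_assoc, cross_cross_assoc, consLie_comp]
    exact key (frontCoact K s) f ▸ h1
  | @act y W s s' t p f hp _ ih =>
    have h1 := Mor.act y ((hp.cons x).trans (.swap x y s')) ih
    have key : ∀ {A B C : List Color} (p : Hom K A (.lie :: B)) (a : Hom K (.lie :: B) B)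
        (f : Hom K B C), (consLie p ⨾ cross K B) ⨾ (cross K B ⨾ consLie a) ⨾ consLie f =
          consLie (p ⨾ a ⨾ f) := by
      intro A B C p a f
      rw [Hom.comp_assoc, Hom.comp_assoc, cross_cross_assoc, consLie_comp, consLie_comp]
    exact key p (frontAct K s') f ▸ h1

/-- Conversely, a string not absorbed within `W` can be deleted. Only the existence of some morphism
`g` is needed: `Mor.cons` restores the string afterwards, and `Mor.unique` guarantees that the value
has not changed. -/
theorem Mor.uncons {x : α} {W : List (Letter α)} {s₁ t₁ : List α}
    {f : Hom K (strands s₁) (strands t₁)} (h : Mor K W s₁ t₁ f) : .act x ∉ W →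
    ∀ {s t : List α}, s₁.Perm (x :: s) → t₁.Perm (x :: t) → ∃ g, Mor K W s t g := by
  induction h with
  | perm h =>
    intro _ s t hs ht
    obtain ⟨g, hg⟩ := exists_isPerm (K := K)
      ((List.perm_cons x).1 ((hs.symm.trans h.perm).trans ht))
    exact ⟨g, .perm hg⟩
  | coact y _ ih =>
    intro hx s t hs ht
    obtain ⟨g, hg⟩ := ih (fun h => hx (List.mem_cons_of_mem _ h)) (s := y :: s)
      ((hs.cons y).trans (.swap x y s)) ht
    exact ⟨_, .coact y hg⟩
  | @act y W s₁ s₁' _ _ _ hp _ ih =>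
    intro hx s t hs ht
    have hne : x ≠ y := fun h => hx (h ▸ List.mem_cons_self)
    have hperm := hp.perm.symm.trans hs
    have hmem : x ∈ s₁' := by
      have := hperm.symm.subset (List.mem_cons_self (a := x) (l := s))
      simpa [hne] using this
    obtain ⟨a, b, rfl⟩ := List.append_of_mem hmem
    have h1 : (x :: y :: (a ++ b)).Perm (x :: s) :=
      ((List.Perm.swap y x (a ++ b)).trans ((List.perm_middle.symm).cons y)).trans hperm
    obtain ⟨g, hg⟩ := ih (fun h => hx (List.mem_cons_of_mem _ h)) (s := a ++ b)
      List.perm_middle ht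
    obtain ⟨q, hq⟩ := exists_isPerm (K := K) ((List.perm_cons x).1 h1).symm
    exact ⟨_, .act y hq hg⟩

/-- The only freedom in reading a word is the arrangement of the open strings. Two arrangements
differ by a permutation morphism `q`; it is unique because labels are distinct, and it commutes past
the action by `IsPerm.consLie_frontAct`. -/
theorem Mor.unique : (W : List (Letter α)) → {s t : List α} → (s ++ Letter.coacts W).Nodup →
    {f g : Hom K (strands s) (strands t)} → Mor K W s t f → Mor K W s t g → f = g
  | [], s, t, hn, f, g, hf, hg => by
    cases hf with | perm hf =>
    cases hg with | perm hg =>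
    exact hf.unique s (by simpa [Letter.coacts] using hn) hg
  | .coact x :: W, s, t, hn, f, g, hf, hg => by
    cases hf with | coact _ hf =>
    cases hg with | coact _ hg =>
    exact congrArg _ (Mor.unique W (s := x :: s) (List.perm_middle.nodup_iff.1 hn) hf hg)
  | .act x :: W, s, t, hn, f, g, hf, hg => by
    cases hf with | @act _ _ _ s' _ p f hp hf =>
    cases hg with | @act _ _ _ s'' _ p' g hp' hg =>
    have hn' : (x :: s').Nodup := hp.perm.nodup_iff.1 hn.of_append_left
    obtain ⟨q, hq⟩ := exists_isPerm (K := K)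
      ((List.perm_cons x).1 (hp.perm.symm.trans hp'.perm))
    have hn'' : (s' ++ Letter.coacts W).Nodup := by
      have := (hp.perm.append_right (Letter.coacts W)).nodup_iff.1 hn
      exact (List.nodup_cons.1 this).2
    have e : p' = p ⨾ consLie q := hp'.unique s hn.of_append_left (hp.trans (hq.cons x))
    have e' := Mor.unique W hn'' hf (hg.precomp hq)
    rw [e, e', Hom.comp_assoc, comp_comp_eq hq.consLie_frontAct, Hom.comp_assoc]

/-- The word defines an endomorphism of `[V₁]`. -/
def IsClosed (K : Type u) [Field K] (W : List (Letter α)) : Prop :=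
  ∃ f : Hom K (strands ([] : List α)) (strands ([] : List α)), Mor K W [] [] f

open Classical in
/-- The endomorphism of `[V₁]` defined by a chord word. -/
noncomputable def eval (K : Type u) [Field K] (W : List (Letter α)) : Hom K [.mod] [.mod] :=
  if h : IsClosed K W then h.choose else 0

theorem Mor.eval_eq {W : List (Letter α)} {f : Hom K (strands ([] : List α)) (strands [])}
    (h : Mor K W [] [] f) (hn : (Letter.coacts W).Nodup) : eval K W = f := by
  have hc : IsClosed K W := ⟨f, h⟩
  refine (dif_pos hc).trans ?_
  exact Mor.unique W (by simpa using hn) hc.choose_spec h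

theorem coacts_append (P W : List (Letter α)) :
    Letter.coacts (P ++ W) = Letter.coacts P ++ Letter.coacts W := by
  induction P with
  | nil => rfl
  | cons a P ih => cases a <;> simp [Letter.coacts, ih]

theorem coact_mem {W : List (Letter α)} {x : α} : x ∈ Letter.coacts W ↔ .coact x ∈ W := by
  induction W with
  | nil => simp [Letter.coacts]
  | cons a W ih => cases a <;> simp [Letter.coacts, ih]

theorem coacts_nodup {W : List (Letter α)} (h : W.Nodup) : (Letter.coacts W).Nodup := by
  induction W with
  | nil => exact .nil
  | cons a W ih =>
    rw [List.nodup_cons] at h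
    cases a
    · exact List.nodup_cons.2 ⟨fun hx => h.1 (coact_mem.1 hx), ih h.2⟩
    · exact ih h.2

section Exchange

variable {x y : α} {U P Q Z : List (Letter α)}

open Letter in
/-- An action followed by a coaction can be exchanged, at the cost of four correction terms. -/
theorem eval_exchange
    (hn : (U ++ coact x :: (P ++ act x :: coact y :: (Q ++ act y :: Z))).Nodup)
    (hc : IsClosed K (U ++ coact x :: (P ++ act x :: coact y :: (Q ++ act y :: Z)))) :
    (IsClosed K (U ++ coact x :: (P ++ coact y :: act x :: (Q ++ act y :: Z))) ∧
      IsClosed K (U ++ coact x :: (P ++ coact y :: (Q ++ act y :: act x :: Z))) ∧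
      IsClosed K (U ++ coact x :: (P ++ coact y :: (Q ++ act x :: act y :: Z))) ∧
      IsClosed K (U ++ coact y :: coact x :: (P ++ act x :: (Q ++ act y :: Z))) ∧
      IsClosed K (U ++ coact x :: coact y :: (P ++ act x :: (Q ++ act y :: Z)))) ∧
    eval K (U ++ coact x :: (P ++ act x :: coact y :: (Q ++ act y :: Z))) =
      eval K (U ++ coact x :: (P ++ coact y :: act x :: (Q ++ act y :: Z))) +
      eval K (U ++ coact x :: (P ++ coact y :: (Q ++ act y :: act x :: Z))) -
      eval K (U ++ coact x :: (P ++ coact y :: (Q ++ act x :: act y :: Z))) +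
      eval K (U ++ coact y :: coact x :: (P ++ act x :: (Q ++ act y :: Z))) -
      eval K (U ++ coact x :: coact y :: (P ++ act x :: (Q ++ act y :: Z))) := by
  have hxP : act x ∉ P := by
    have h1 := (List.nodup_cons.1 hn.of_append_right).2
    rw [List.nodup_middle, List.nodup_cons] at h1
    exact fun h => h1.1 (List.mem_append_left _ h)
  have hyQ : act y ∉ Q := by
    have h1 := (List.nodup_cons.1 hn.of_append_right).2.of_append_right
    have h2 := (List.nodup_cons.1 (List.nodup_cons.1 h1).2).2
    rw [List.nodup_middle, List.nodup_cons] at h2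
    exact fun h => h2.1 (List.mem_append_left _ h)
  -- The string `x` is open throughout `P` and `y` throughout `Q`, and neither is absorbed there.
  -- Deleting these spectators exposes `P` and `Q` as morphisms `p` and `q` on the other strings.
  obtain ⟨s, s₁, s₂, a, p, q, z, hU, hP, hQ, hZ⟩ : ∃ (s s₁ s₂ : List α)
      (a : Hom K (strands []) (strands s)) (p : Hom K (strands s) (strands s₁))
      (q : Hom K (strands s₁) (strands s₂)) (z : Hom K (strands s₂) (strands [])), Mor K U [] s a ∧ Mor K P s s₁ p ∧ Mor K Q s₁ s₂ q ∧ Mor K Z s₂ [] z := by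
    obtain ⟨h, hc⟩ := hc
    obtain ⟨s, a, h, hU, hc⟩ := hc.split
    cases hc with | coact _ hc =>
    obtain ⟨t, _, _, hP, hc⟩ := hc.split
    cases hc with | @act _ _ _ s₁ _ _ _ hp hc =>
    cases hc with | coact _ hc =>
    obtain ⟨t', _, _, hQ, hc⟩ := hc.split
    cases hc with | @act _ _ _ s₂ _ _ z hq hZ =>
    obtain ⟨p, hP⟩ := hP.uncons hxP (.refl _) hp.perm
    obtain ⟨q, hQ⟩ := hQ.uncons hyQ (.refl _) hq.perm
    exact ⟨s, s₁, s₂, a, p, q, z, hU, hP, hQ, hZ⟩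
  -- All six words are now assembled from the same pieces `a`, `p`, `q`, `z`, with spectators `x`
  -- and `y` added where they are open. Comparing values thus becomes an identity of explicit
  -- composites.
  have h₀ := hU.append (.coact x ((hP.cons x).append (.act x (.refl _) (.coact y
    ((hQ.cons y).append (.act y (.refl _) hZ))))))
  have h₁ := hU.append (.coact x ((hP.cons x).append (.coact y (.act x (.swap _ _ _)
    ((hQ.cons y).append (.act y (.refl _) hZ))))))
  have h₂ := hU.append (.coact x ((hP.cons x).append (.coact y
    (((hQ.cons x).cons y).append (.act y (.refl _) (.act x (.refl _) hZ))))))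
  have h₃ := hU.append (.coact x ((hP.cons x).append (.coact y
    (((hQ.cons x).cons y).append (.act x (.swap _ _ _) (.act y (.refl _) hZ))))))
  have h₄ := hU.append (.coact y (.coact x (((hP.cons y).cons x).append
    (.act x (.refl _) ((hQ.cons y).append (.act y (.refl _) hZ))))))
  have h₅ := hU.append (.coact x (.coact y (((hP.cons x).cons y).append
    (.act x (.swap _ _ _) ((hQ.cons y).append (.act y (.refl _) hZ))))))
  refine ⟨⟨⟨_, h₁⟩, ⟨_, h₂⟩, ⟨_, h₃⟩, ⟨_, h₄⟩, ⟨_, h₅⟩⟩, ?_⟩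
  have hm := coacts_nodup hn
  have nd : ∀ {W : List (Letter α)}, (coacts W).Perm
      (coacts (U ++ coact x :: (P ++ act x :: coact y :: (Q ++ act y :: Z)))) →
      (coacts W).Nodup := fun h => h.nodup_iff.2 hm
  have hsw : (coacts U ++ y :: x :: (coacts P ++ (coacts Q ++ coacts Z))).Perm
      (coacts U ++ x :: (coacts P ++ y :: (coacts Q ++ coacts Z))) :=
    .append_left _ ((List.Perm.swap x y _).trans (List.perm_middle.symm.cons x))
  have hsw' : (coacts U ++ x :: y :: (coacts P ++ (coacts Q ++ coacts Z))).Perm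
      (coacts U ++ x :: (coacts P ++ y :: (coacts Q ++ coacts Z))) :=
    .append_left _ (List.perm_middle.symm.cons x)
  rw [h₀.eval_eq hm, h₁.eval_eq (nd (by simp [coacts_append, coacts])),
    h₂.eval_eq (nd (by simp [coacts_append, coacts])),
    h₃.eval_eq (nd (by simp [coacts_append, coacts])),
    h₄.eval_eq (nd (by simpa [coacts_append, coacts] using hsw)),
    h₅.eval_eq (nd (by simpa [coacts_append, coacts] using hsw'))]
  -- `A`, `B` and `C` stand for the open strings where `x` is created, where the exchange takes
  -- place and where `y` is absorbed. Each of the three relations is applied at one of these places.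
  have key : ∀ {A B C V W : List Color} {aB : Hom K (.lie :: B) B} {cB : Hom K B (.lie :: B)}
      {cA : Hom K A (.lie :: A)} {aA : Hom K (.lie :: A) A}
      {aC : Hom K (.lie :: C) C} {cC : Hom K C (.lie :: C)} (_ : IsModule A aA cA)
      (_ : IsModule B aB cB) (_ : IsModule C aC cC)
      (a : Hom K V A) (p : Hom K A B) (q : Hom K B C) (z : Hom K C W),
      a ⨾ cA ⨾ consLie p ⨾ Hom.id K _ ⨾ aB ⨾ cB ⨾ consLie q ⨾ Hom.id K _ ⨾ aC ⨾ z =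
      a ⨾ cA ⨾ consLie p ⨾ (consLie cB ⨾ cross K B) ⨾ cross K B ⨾ (cross K B ⨾ consLie aB) ⨾
          consLie q ⨾ Hom.id K _ ⨾ aC ⨾ z +
        a ⨾ cA ⨾ consLie p ⨾ (consLie cB ⨾ cross K B) ⨾ consLie (consLie q) ⨾ Hom.id K _ ⨾
          (cross K C ⨾ consLie aC) ⨾ Hom.id K _ ⨾ aC ⨾ z -
        a ⨾ cA ⨾ consLie p ⨾ (consLie cB ⨾ cross K B) ⨾ consLie (consLie q) ⨾ cross K C ⨾
          (cross K C ⨾ consLie aC) ⨾ Hom.id K _ ⨾ aC ⨾ z +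
        a ⨾ cA ⨾ (consLie cA ⨾ cross K A) ⨾ consLie (consLie p) ⨾ Hom.id K _ ⨾
          (cross K B ⨾ consLie aB) ⨾ consLie q ⨾ Hom.id K _ ⨾ aC ⨾ z -
        a ⨾ cA ⨾ (consLie cA ⨾ cross K A) ⨾ consLie (consLie p) ⨾ cross K B ⨾
          (cross K B ⨾ consLie aB) ⨾ consLie q ⨾ Hom.id K _ ⨾ aC ⨾ z := by
    intro A B C V W aB cB cA aA aC cC hA hB hC a p q z
    simp only [Hom.id_comp, Hom.comp_assoc, cross_cross_assoc]
    have hb := comp_comp_eq (bracket_natural q) (aC ⨾ z)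
    have hb' := comp_comp_eq hC.bracket_act z
    have hd := comp_comp_eq (cobracket_natural p) (consLie aB ⨾ consLie q ⨾ aC ⨾ z)
    have hd' := comp_comp_eq hA.coact_cobracket
      (consLie (consLie p) ⨾ consLie aB ⨾ consLie q ⨾ aC ⨾ z)
    have hq : ∀ {Y : List Color} (k : Hom K _ Y), _ := fun k => comp_comp_eq (cross_natural q) k
    have hp : ∀ {Y : List Color} (k : Hom K _ Y), _ := fun k => comp_comp_eq (cross_natural p) k
    simp only [Hom.comp_assoc, Hom.sub_comp] at hb hb' hd hd' hq hp
    rw [comp_comp_eq hB.act_coact]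
    simp only [Hom.sub_comp, Hom.add_comp, Hom.comp_add, Hom.comp_sub, Hom.comp_assoc]
    -- The bracket is pushed forward through `q` and resolved at `C`; the cobracket is pulled back
    -- through `p` and resolved at `A`.
    rw [hb, hb', ← hd, hd']
    simp only [hp, hq, cross_cross_assoc, Hom.comp_sub]
    abel
  exact key (isModule_strands s) (isModule_strands s₁) (isModule_strands s₂) a p q z

end Exchange

end ChordWords

/-! ### Words with all coactions first, and the elements `r`. -/

section NormalWords

variable {K : Type u} [Field K] {α : Type v}

local infixr:80 " ⨾ " => Hom.comp

/-- The words `strands s` and `lies n ++ [.mod]` agree only propositionally, because the length of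
`s` is an equation. The cast lemmas that follow transport morphisms between the labelled and the
unlabelled description. -/
theorem strands_eq : {n : ℕ} → {s : List α} → s.length = n → strands s = lies n ++ [.mod]
  | 0, [], _ => rfl
  | _ + 1, _ :: _, h => congrArg (List.cons Color.lie) (strands_eq (Nat.succ.inj h))

theorem cast_comp_comp_cast {a a' b c c' : List Color} {b' : List Color} (ha : a = a')
    (hb : b = b') (hc : c = c') (f : Hom K a' b') (g : Hom K b' c') :
    (Hom.cast K ha ⨾ f ⨾ Hom.cast K hb.symm) ⨾ (Hom.cast K hb ⨾ g ⨾ Hom.cast K hc.symm) =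
      Hom.cast K ha ⨾ (f ⨾ g) ⨾ Hom.cast K hc.symm := by
  subst ha hb hc
  simp only [Hom.cast_rfl, Hom.id_comp, Hom.comp_id]

theorem consLie_cast_comp_cast {a a' b b' : List Color} (ha : a = a') (hb : b = b')
    (ha' : Color.lie :: a = .lie :: a') (hb' : Color.lie :: b' = .lie :: b) (f : Hom K a' b') :
    consLie (Hom.cast K ha ⨾ f ⨾ Hom.cast K hb.symm) =
      Hom.cast K ha' ⨾ consLie f ⨾ Hom.cast K hb' := by
  subst ha hb
  simp only [Hom.cast_rfl, Hom.id_comp, Hom.comp_id]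

theorem cast_cross_cast {a a' : List Color} (h : a = a')
    (h' : Color.lie :: .lie :: a = .lie :: .lie :: a') :
    Hom.cast K h' ⨾ cross K a' ⨾ Hom.cast K h'.symm = cross K a := by
  subst h
  simp only [Hom.cast_rfl, Hom.id_comp, Hom.comp_id]

theorem cast_id_cast {a a' : List Color} (h : a = a') :
    Hom.cast K h ⨾ Hom.id K a' ⨾ Hom.cast K h.symm = Hom.id K a := by
  subst h
  simp only [Hom.cast_rfl, Hom.id_comp]

/-- Add the module string to a morphism of Lie strings. -/
def addMod {a b : List Color} (f : Hom K a b) : Hom K (a ++ [.mod]) (b ++ [.mod]) :=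
  Hom.tensor f (Hom.id K [.mod])

theorem isPerm_insertMor : (n : ℕ) → (q : Fin (n + 1)) → (x : α) → (l t : List α) →
    (hl : (x :: l).length = n + 1) → (ht : t.length = n + 1) → t[q]? = some x →
    t.eraseIdx q = l →
    IsPerm K (x :: l) t (Hom.cast K (strands_eq hl) ⨾ addMod (insertMor K n q) ⨾
      Hom.cast K (strands_eq ht).symm)
  | 0, q, x, [], [y], hl, ht, hx, he => by
    obtain rfl : q = 0 := Fin.fin_one_eq_zero q
    obtain rfl : y = x := by simpa using hx
    have e : addMod (insertMor K 0 0) = Hom.id K _ := Hom.tensor_id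
    have h := IsPerm.refl (K := K) [y]
    rw [e]
    rw [← cast_id_cast (strands_eq hl)] at h
    exact h
  | n + 1, q, x, l, y :: t, hl, ht, hx, he => by
    revert hx he
    refine Fin.cases ?_ (fun k => ?_) q
    · intro hx he
      obtain rfl : y = x := by simpa using hx
      obtain rfl : t = l := by simpa using he
      have e : addMod (insertMor K (n + 1) 0) = Hom.id K _ := Hom.tensor_id
      have h := IsPerm.refl (K := K) (y :: t)
      rw [e]
      rw [← cast_id_cast (strands_eq hl)] at h
      exact h
    · intro hx he
      obtain ⟨l', rfl⟩ : ∃ l', l = y :: l' := ⟨t.eraseIdx k, by simpa using he.symm⟩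
      have he' : t.eraseIdx k = l' := by simpa using he
      have ht' : t.length = n + 1 := by simpa using ht
      have hl' : (x :: l').length = n + 1 := by simpa using hl
      have ih := isPerm_insertMor n k x l' t hl' ht' (by simpa using hx) he'
      have hll : l'.length = n := by simpa using hl'
      have h := IsPerm.trans (.swap x y l') (ih.cons y)
      have e1 : addMod (insertMor K (n + 1) k.succ) =
          (cross K (lies n ++ [.mod]) ⨾ consLie (addMod (insertMor K n k)) :
            Hom K (.lie :: .lie :: (lies n ++ [.mod])) (.lie :: (lies (n + 1) ++ [.mod]))) := by
        refine (tensor_id_comp (Hom.tensor (Hom.braid K [.lie] [.lie]) (Hom.id K (lies n)))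
          (consLie (insertMor K n k)) [.mod]).trans (congrArg₂ Hom.comp ?_ (tensor_consLie _ _))
        have := eq_of_heq (tensor_assoc_of_eq (Hom.braid K [.lie] [.lie]) (Hom.id K (lies n))
          (Hom.id K [.mod]))
        rw [Hom.tensor_id] at this
        exact this
      rw [e1]
      rw [← cast_cross_cast (strands_eq hll) (congrArg (Color.lie :: Color.lie :: ·)
        (strands_eq hll)), consLie_cast_comp_cast (strands_eq hl') (strands_eq ht')
        (congrArg (Color.lie :: ·) (strands_eq hl'))
        (congrArg (Color.lie :: ·) (strands_eq ht').symm)] at h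
      have := cast_comp_comp_cast (K := K) (strands_eq hl) (strands_eq (n := n + 2) (s := y :: x :: l') hl)
        (strands_eq ht) (cross K (lies n ++ [Color.mod])) (consLie (addMod (insertMor K n k)))
      exact this ▸ h

/-- The recursion of `permMor` is matched on labels: deleting the first label from `s` and the entry
at `σ 0` from `t` leaves two lists related by `restPerm σ`, and `insertMor` then carries the first
string to position `σ 0`. -/
theorem isPerm_permMor : (n : ℕ) → (σ : Equiv.Perm (Fin n)) → (s t : List α) →
    (hs : s.length = n) → (ht : t.length = n) → (∀ p : Fin n, t[σ p]? = s[p]?) →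
    IsPerm K s t (Hom.cast K (strands_eq hs) ⨾ addMod (permMor K n σ) ⨾
      Hom.cast K (strands_eq ht).symm)
  | 0, σ, [], [], hs, ht, h => by
    have e : addMod (permMor K 0 σ) = Hom.id K _ := Hom.tensor_id
    rw [e]
    have h := IsPerm.refl (K := K) ([] : List α)
    rw [← cast_id_cast (strands_eq hs)] at h
    exact h
  | n + 1, σ, x :: s, t, hs, ht, h => by
    have hx : t[σ 0]? = some x := by simpa using h 0
    have hs' : s.length = n := by simpa using hs
    have ht' : (t.eraseIdx (σ 0)).length = n := by
      rw [List.length_eraseIdx_of_lt (by rw [ht]; exact (σ 0).2), ht]; rfl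
    have ih := isPerm_permMor n (restPerm σ) s (t.eraseIdx (σ 0)) hs' ht' (by
      intro p
      have h1 := h p.succ
      rw [← succAbove_restPerm] at h1
      simp only [Fin.getElem?_fin, Fin.val_succ, List.getElem?_cons_succ] at h1 ⊢
      rw [← h1, List.getElem?_eraseIdx]
      simp only [Fin.succAbove, Fin.lt_def, Fin.val_castSucc]
      split <;> rfl)
    have hlen : (x :: t.eraseIdx (σ 0)).length = n + 1 := by simpa using ht'
    have h2 := isPerm_insertMor (K := K) n (σ 0) x (t.eraseIdx (σ 0)) t hlen ht hx rfl
    have h3 := (ih.cons x).trans h2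
    have e1 : addMod (permMor K (n + 1) σ) = (consLie (addMod (permMor K n (restPerm σ))) ⨾
        addMod (insertMor K n (σ 0)) :
          Hom K (.lie :: (lies n ++ [.mod])) (lies (n + 1) ++ [.mod])) :=
      (tensor_id_comp _ _ _).trans (congrArg₂ Hom.comp (tensor_consLie _ _) rfl)
    rw [consLie_cast_comp_cast (strands_eq hs') (strands_eq ht')
      (congrArg (Color.lie :: ·) (strands_eq hs'))
      (congrArg (Color.lie :: ·) (strands_eq ht').symm)] at h3
    rw [e1]
    have := cast_comp_comp_cast (K := K) (strands_eq hs) (strands_eq hlen) (strands_eq ht)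
      (consLie (addMod (permMor K n (restPerm σ)))) (addMod (insertMor K n (σ 0)))
    exact this ▸ h3

theorem mor_coacts : (n : ℕ) → (l : List α) → (hl : l.length = n) →
    Mor K (l.map .coact) [] l (iterCoact K n ⨾ Hom.cast K (strands_eq hl).symm)
  | 0, [], _ => by
    have h := Mor.perm (IsPerm.refl (K := K) ([] : List α))
    exact (Hom.comp_id (Hom.id K [Color.mod])).symm ▸ h
  | n + 1, x :: l, hl => by
    have hl' : l.length = n := by simpa using hl
    have h := Mor.coact x ((mor_coacts n l hl').cons x)
    have key : ∀ {A B B' : List Color} (c : Hom K A (.lie :: A)) (f : Hom K A B) (h : B = B')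
        (h' : Color.lie :: B = .lie :: B'),
        (c ⨾ consLie f) ⨾ Hom.cast K h' = c ⨾ consLie (f ⨾ Hom.cast K h) := by
      intro A B B' c f h h'
      subst h
      simp only [Hom.cast_rfl, Hom.comp_id]
    exact (key (Hom.coact K) (iterCoact K n) (strands_eq hl').symm (strands_eq hl).symm) ▸ h

/-- The iterated action lets the last tensor factor act first. Hence the reversed list of letters,
here and in `normalWord`. -/
theorem mor_acts : (n : ℕ) → (l : List α) → (hl : l.length = n) →
    Mor K (l.map .act).reverse l [] (Hom.cast K (strands_eq hl) ⨾ iterAct K n)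
  | 0, [], _ => by
    have h := Mor.perm (IsPerm.refl (K := K) ([] : List α))
    exact (Hom.comp_id (Hom.id K [Color.mod])).symm ▸ h
  | n + 1, x :: l, hl => by
    have hl' : l.length = n := by simpa using hl
    have h := ((mor_acts n l hl').cons x).append
      (Mor.act x (.refl [x]) (.perm (.refl ([] : List α))))
    have key : ∀ {A B B' : List Color} (c : Hom K (.lie :: A) A) (f : Hom K B A) (h : B' = B)
        (h' : Color.lie :: B' = .lie :: B),
        Hom.cast K h' ⨾ consLie f ⨾ c = consLie (Hom.cast K h ⨾ f) ⨾ Hom.id K _ ⨾ c ⨾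
          Hom.id K _ := by
      intro A B B' c f h h'
      subst h
      simp only [Hom.cast_rfl, Hom.comp_id, Hom.id_comp]
    have e := key (Hom.act K) (iterAct K n) (strands_eq hl') (strands_eq hl)
    have e2 : (List.map Letter.act (x :: l)).reverse = (List.map Letter.act l).reverse ++ [.act x] := by
      simp
    rw [e2]
    exact e.symm ▸ h

/-- The chord word with all coactions before all actions. -/
def normalWord (c a : List α) : List (Letter α) := c.map .coact ++ (a.map .act).reverse

theorem mor_normalWord {n : ℕ} (σ : Equiv.Perm (Fin n)) (c a : List α) (hc : c.length = n)
    (ha : a.length = n) (h : ∀ p : Fin n, a[σ p]? = (c)[p]?) :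
    Mor K (normalWord c a) [] [] (r K σ) := by
  have hm := (mor_coacts (K := K) n c hc).append
    ((mor_acts n a ha).precomp (isPerm_permMor n σ c a hc ha h))
  have e : r K σ = (iterCoact K n ⨾ Hom.cast K (strands_eq hc).symm) ⨾
      (Hom.cast K (strands_eq hc) ⨾ addMod (permMor K n σ) ⨾ Hom.cast K (strands_eq ha).symm) ⨾
        Hom.cast K (strands_eq ha) ⨾ iterAct K n := by
    have key : ∀ {A B B' C C' : List Color} (hB : B = B') (hC : C = C') (f : Hom K A B)
        (g : Hom K B C) (k : Hom K C A), f ⨾ g ⨾ k =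
        (f ⨾ Hom.cast K hB) ⨾ (Hom.cast K hB.symm ⨾ g ⨾ Hom.cast K hC) ⨾
          Hom.cast K hC.symm ⨾ k := by
      intro A B B' C C' hB hC f g k
      subst hB hC
      simp only [Hom.cast_rfl, Hom.id_comp, Hom.comp_id]
    exact key _ _ _ _ _
  exact e ▸ hm

theorem coacts_map_coact (c : List α) : Letter.coacts (c.map .coact) = c := by
  induction c with
  | nil => rfl
  | cons x c ih => simp [Letter.coacts, ih]

theorem coacts_map_act (c : List α) : Letter.coacts (c.map .act) = [] := by
  induction c with
  | nil => rfl
  | cons x c ih => simp [Letter.coacts, ih]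

theorem coacts_normalWord (c a : List α) : Letter.coacts (normalWord c a) = c := by
  rw [normalWord, coacts_append, coacts_map_coact, ← List.map_reverse, coacts_map_act,
    List.append_nil]

/-- The label at position `p` among the coactions reappears at position `σ p` among the actions.
This is how a permutation is read off from a pair of lists of labels. -/
theorem eval_normalWord {n : ℕ} (σ : Equiv.Perm (Fin n)) (c a : List α) (hc : c.length = n)
    (ha : a.length = n) (hn : c.Nodup) (h : ∀ p : Fin n, a[σ p]? = (c)[p]?) :
    eval K (normalWord c a) = r K σ :=
  (mor_normalWord σ c a hc ha h).eval_eq (by rwa [coacts_normalWord])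

end NormalWords

/-! ### Shapes of tiles and the bookkeeping of labels in a row. -/

namespace Tile

variable {n m : ℕ}

/-- Whether there are strings on the left edge. -/
def hasLeft : Tile n m → Bool
  | vertical _ => false
  | empty => false
  | _ => true

/-- Whether there are strings on the right edge. -/
def hasRight : Tile n m → Bool
  | bracketLeft _ => false
  | bracketRight _ => false
  | vertical _ => false
  | empty => false
  | _ => true

/-- Whether there are strings on the top edge. -/
def hasTop : Tile n m → Bool
  | horizontal _ => false
  | empty => false
  | _ => true

/-- Whether there are strings on the bottom edge. -/
def hasBottom : Tile n m → Bool
  | cobracketAbove _ => false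
  | cobracketBelow _ => false
  | horizontal _ => false
  | empty => false
  | _ => true

/-- The sign of a tile. -/
def sign (t : Tile n m) : ℤ := if t.negative then -1 else 1

/-- The strings on the top edge, when the row carries the string `x`, the column carries the string
`y` and the strings on the bottom edge are `b`. -/
def topBundle (x y : ℕ) (b : List ℕ) : Tile n m → List ℕ
  | bracketLeft _ => x :: b
  | bracketRight _ => b ++ [x]
  | cobracketAbove _ => [y]
  | cobracketBelow _ => [y]
  | _ => b

/-- The strings on the left edge, when the row carries the string `x`, the column carries the string
`y` and the strings on the right edge are `l`. -/
def leftBundle (x y : ℕ) (l : List ℕ) : Tile n m → List ℕ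
  | bracketLeft _ => [x]
  | bracketRight _ => [x]
  | cobracketAbove _ => y :: l
  | cobracketBelow _ => l ++ [y]
  | _ => l

end Tile

section Rows

variable {n m : ℕ}

/-- The label of every column which carries a string. -/
def activeLabels {q : ℕ} (y : Fin q → ℕ) (Y : Fin q → Bool) (j : Fin q) : List ℕ :=
  if Y j then [y j] else []

/-- The tiles of a row fit together, where `a` and `Y` tell whether there are strings on the left
end and on the top edges. -/
def RowFits : {q : ℕ} → (Fin q → Tile n m) → Bool → (Fin q → Bool) → Prop
  | 0, _, _, _ => True
  | _ + 1, T, a, Y =>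
    (T 0).hasLeft = a ∧ (T 0).hasTop = Y 0 ∧ RowFits (Fin.tail T) (T 0).hasRight (Fin.tail Y)

/-- Whether there are strings on the right end of a row. -/
def rowEnd : {q : ℕ} → (Fin q → Tile n m) → Bool → Bool
  | 0, _, a => a
  | _ + 1, T, _ => rowEnd (Fin.tail T) (T 0).hasRight

/-- The bundle of strings on the left end of a row. -/
def rowBundle : {q : ℕ} → (Fin q → Tile n m) → ℕ → (Fin q → ℕ) → List ℕ
  | 0, _, x, _ => [x]
  | _ + 1, T, x, y => (T 0).leftBundle x (y 0) (rowBundle (Fin.tail T) x (Fin.tail y))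

/-- Replace the label of every column by the bundle of strings on top of the row. -/
def rowSubst : {q : ℕ} → (Fin q → Tile n m) → ℕ → (Fin q → ℕ) → ℕ → List ℕ
  | 0, _, _, _, z => [z]
  | _ + 1, T, x, y, z =>
    if z = y 0 then (T 0).topBundle x (y 0) [y 0] else rowSubst (Fin.tail T) x (Fin.tail y) z

/-- Replace the label `x` by the list `l`. -/
def labelSubst (x : ℕ) (l : List ℕ) (z : ℕ) : List ℕ := if z = x then l else [z]

/-- The sign of a row. -/
def rowSign {q : ℕ} (T : Fin q → Tile n m) : ℤ := ∏ j, (T j).sign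

theorem flatMap_eq_self {α : Type*} {l : List α} {f : α → List α} (h : ∀ z ∈ l, f z = [z]) :
    l.flatMap f = l := by
  induction l with
  | nil => rfl
  | cons a l ih =>
    rw [List.flatMap_cons, h a List.mem_cons_self,
      ih fun z hz => h z (List.mem_cons_of_mem _ hz)]
    rfl

theorem flatMap_labelSubst {l : List ℕ} (u v : List ℕ) (x : ℕ) (hn : (u ++ x :: v).Nodup) :
    (u ++ x :: v).flatMap (labelSubst x l) = u ++ (l ++ v) := by
  rw [List.nodup_middle, List.nodup_cons, List.mem_append, not_or] at hn
  have hu : u.flatMap (labelSubst x l) = u :=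
    flatMap_eq_self fun z hz => if_neg fun h : z = x => hn.1.1 (h ▸ hz)
  have hv : v.flatMap (labelSubst x l) = v :=
    flatMap_eq_self fun z hz => if_neg fun h : z = x => hn.1.2 (h ▸ hz)
  rw [List.flatMap_append, List.flatMap_cons, hu, hv, labelSubst, if_pos rfl]

theorem rowSubst_of_forall_ne : {q : ℕ} → (T : Fin q → Tile n m) → (x : ℕ) → (y : Fin q → ℕ) →
    (z : ℕ) → (∀ j, z ≠ y j) → rowSubst T x y z = [z]
  | 0, _, _, _, _, _ => rfl
  | _ + 1, T, x, y, z, h => by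
    rw [rowSubst, if_neg (h 0)]
    exact rowSubst_of_forall_ne _ _ _ _ fun j => h j.succ

theorem rowSubst_apply : {q : ℕ} → (T : Fin q → Tile n m) → (x : ℕ) → (y : Fin q → ℕ) →
    Function.Injective y → (j : Fin q) → rowSubst T x y (y j) = (T j).topBundle x (y j) [y j]
  | 0, _, _, _, _, j => j.elim0
  | q + 1, T, x, y, hy, j => by
    refine Fin.cases ?_ (fun j => ?_) j
    · rw [rowSubst, if_pos rfl]
    · rw [rowSubst, if_neg fun h => Fin.succ_ne_zero j (hy h)]
      exact rowSubst_apply (Fin.tail T) x (Fin.tail y)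
        (fun a b h => Fin.succ_injective _ (hy h)) j

/-- The only way to continue a row once its string has been absorbed. -/
def deadRow {q : ℕ} (Y : Fin q → Bool) (j : Fin q) : Tile 1 1 := if Y j then .vertical 0 else .empty

/-- Without a string entering from the left, a tile can only transmit or omit the vertical strings,
as its top edge dictates. A bracket therefore ends the expansion of its row with exactly one term.
-/
theorem rowFits_false_iff : {q : ℕ} → (T : Fin q → Tile 1 1) → (Y : Fin q → Bool) →
    (RowFits T false Y ↔ T = deadRow Y)
  | 0, T, Y => by simp [RowFits, eq_iff_true_of_subsingleton]
  | q + 1, T, Y => by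
    have key : ∀ (t : Tile 1 1) (b : Bool), (t.hasLeft = false ∧ t.hasTop = b) ↔
        t = if b then .vertical 0 else .empty := by decide
    have ih := rowFits_false_iff (Fin.tail T) (Fin.tail Y)
    rw [RowFits]
    constructor
    · rintro ⟨h1, h2, h3⟩
      have h4 := (key _ _).1 ⟨h1, h2⟩
      have h5 : (T 0).hasRight = false := by rw [h4]; cases Y 0 <;> rfl
      rw [h5, ih] at h3
      refine funext fun j => Fin.cases ?_ (fun j => ?_) j
      · exact h4
      · exact congrFun h3 j
    · intro h
      have h4 : T 0 = if Y 0 then .vertical 0 else .empty := congrFun h 0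
      obtain ⟨h1, h2⟩ := (key _ _).2 h4
      have h5 : (T 0).hasRight = false := by rw [h4]; cases Y 0 <;> rfl
      refine ⟨h1, h2, ?_⟩
      rw [h5, ih]
      exact funext fun j => congrFun h j.succ

theorem rowEnd_deadRow : {q : ℕ} → (Y : Fin q → Bool) → rowEnd (deadRow Y) false = false
  | 0, _ => rfl
  | q + 1, Y => by
    have h : (deadRow Y 0).hasRight = false := by
      rw [deadRow]; cases Y 0 <;> rfl
    rw [rowEnd, h]
    exact rowEnd_deadRow (Fin.tail Y)

theorem rowSign_deadRow {q : ℕ} (Y : Fin q → Bool) : rowSign (deadRow Y) = 1 :=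
  Finset.prod_eq_one fun j _ => by rw [deadRow]; cases Y j <;> rfl

theorem hasBottom_deadRow {q : ℕ} (Y : Fin q → Bool) : (fun j => (deadRow Y j).hasBottom) = Y :=
  funext fun j => by rw [deadRow]; cases Y j <;> rfl

theorem rowSubst_deadRow : {q : ℕ} → (Y : Fin q → Bool) → (x : ℕ) → (y : Fin q → ℕ) → (z : ℕ) →
    rowSubst (deadRow Y) x y z = [z]
  | 0, _, _, _, _ => rfl
  | q + 1, Y, x, y, z => by
    rw [rowSubst]
    split
    · next h => rw [h, deadRow]; cases Y 0 <;> rfl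
    · exact rowSubst_deadRow (Fin.tail Y) x (Fin.tail y) z

end Rows

/-! ### Moving one action through a row of coactions. -/

section Expansion

variable {K : Type u} [Field K]

/-- The chord word with coactions `c`, then a word `W`, then actions whose order is given by `a`. -/
def framedWord (c : List ℕ) (W : List (Letter ℕ)) (a : List ℕ) : List (Letter ℕ) :=
  c.map .coact ++ (W ++ (a.map .act).reverse)

/-- The letters of the word are distinct and it defines an endomorphism of `[V₁]`. -/
def IsChordWord (K : Type u) [Field K] (W : List (Letter ℕ)) : Prop := W.Nodup ∧ IsClosed K W

/-- The word obtained by moving the action `x` through a row of coactions. -/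
def rowWord {q : ℕ} (T : Fin q → Tile 1 1) (x : ℕ) (y : Fin q → ℕ) (c : List ℕ)
    (M Z : List (Letter ℕ)) (a : List ℕ) : List (Letter ℕ) :=
  framedWord (c.flatMap (labelSubst x (rowBundle T x y)))
    (M ++ ((concat (activeLabels y fun j => (T j).hasBottom)).map .coact ++
      ((if rowEnd T true then [.act x] else []) ++ Z)))
    (a.flatMap (rowSubst T x y))

/-- `eval_exchange` rewritten as substitutions. The outer coactions are listed in `c` and the outer
actions in `a`, so resolving a bracket or cobracket amounts to replacing `y` in `a`, or `x` in `c`,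
by the two labels in either order. -/
theorem framedWord_exchange {x y : ℕ} {c a : List ℕ} {M W : List (Letter ℕ)}
    (hx : x ∈ c) (hy : y ∈ a)
    (h : IsChordWord K (framedWord c (M ++ .act x :: .coact y :: W) a)) :
    (IsChordWord K (framedWord c (M ++ .coact y :: .act x :: W) a) ∧
      IsChordWord K (framedWord c (M ++ .coact y :: W) (a.flatMap (labelSubst y [x, y]))) ∧
      IsChordWord K (framedWord c (M ++ .coact y :: W) (a.flatMap (labelSubst y [y, x]))) ∧
      IsChordWord K (framedWord (c.flatMap (labelSubst x [y, x])) (M ++ .act x :: W) a) ∧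
      IsChordWord K (framedWord (c.flatMap (labelSubst x [x, y])) (M ++ .act x :: W) a)) ∧
    eval K (framedWord c (M ++ .act x :: .coact y :: W) a) =
      eval K (framedWord c (M ++ .coact y :: .act x :: W) a) +
      eval K (framedWord c (M ++ .coact y :: W) (a.flatMap (labelSubst y [x, y]))) -
      eval K (framedWord c (M ++ .coact y :: W) (a.flatMap (labelSubst y [y, x]))) +
      eval K (framedWord (c.flatMap (labelSubst x [y, x])) (M ++ .act x :: W) a) -
      eval K (framedWord (c.flatMap (labelSubst x [x, y])) (M ++ .act x :: W) a) := by
  have hcn : c.Nodup := (List.Nodup.of_append_left h.1).of_map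
  have han : a.Nodup := by
    have := (List.Nodup.of_append_right h.1).of_append_right
    exact (List.nodup_reverse.1 this).of_map
  obtain ⟨c₁, c₂, rfl⟩ := List.append_of_mem hx
  obtain ⟨a₁, a₂, rfl⟩ := List.append_of_mem hy
  rw [flatMap_labelSubst _ _ _ hcn, flatMap_labelSubst _ _ _ hcn, flatMap_labelSubst _ _ _ han,
    flatMap_labelSubst _ _ _ han]
  have e₀ := eval_exchange (K := K) (x := x) (y := y) (U := c₁.map .coact)
    (P := c₂.map .coact ++ M) (Q := W ++ (a₂.map .act).reverse) (Z := (a₁.map .act).reverse)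
  simp only [framedWord, IsChordWord, List.map_append, List.map_cons, List.reverse_append,
    List.reverse_cons, List.append_assoc, List.cons_append, List.nil_append] at h e₀ ⊢
  obtain ⟨⟨h₁, h₂, h₃, h₄, h₅⟩, e⟩ := e₀ h.1 h.2
  refine ⟨⟨⟨?_, h₁⟩, ⟨?_, h₂⟩, ⟨?_, h₃⟩, ⟨?_, h₄⟩, ⟨?_, h₅⟩⟩, e⟩
  -- Each resulting word is a rearrangement of the letters of the original one, so distinctness is
  -- inherited.
  all_goals
    refine (List.Perm.nodup_iff ?_).1 h.1
    classical
    rw [List.perm_iff_count]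
    intro z
    simp only [List.count_append, List.count_cons]
    omega

theorem sum_tile (f : Tile 1 1 → Hom K [.mod] [.mod]) : ∑ t, f t =
    f (.cross 0 0) + (f (.bracketLeft 0) + (f (.bracketRight 0) + (f (.cobracketAbove 0) +
      (f (.cobracketBelow 0) + (f (.horizontal 0) + (f (.vertical 0) + f .empty)))))) := by
  have h : (Finset.univ : Finset (Tile 1 1)) = {.cross 0 0, .bracketLeft 0, .bracketRight 0,
    .cobracketAbove 0, .cobracketBelow 0, .horizontal 0, .vertical 0, .empty} := by decide
  rw [h]
  repeat rw [Finset.sum_insert (by decide)]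
  rw [Finset.sum_singleton]

theorem sum_finCons {M β : Type*} [AddCommMonoid M] [Fintype β] {q : ℕ}
    (f : (Fin (q + 1) → β) → M) : ∑ T, f T = ∑ t, ∑ T : Fin q → β, f (Fin.cons t T) := by
  classical
  rw [← (Fin.consEquiv fun _ => β).sum_comp, Fintype.sum_prod_type]
  rfl

theorem rowFits_cons {q : ℕ} (t : Tile 1 1) (T : Fin q → Tile 1 1) (b : Bool)
    (Y : Fin (q + 1) → Bool) : RowFits (Fin.cons t T : Fin (q + 1) → Tile 1 1) b Y ↔
      t.hasLeft = b ∧ t.hasTop = Y 0 ∧ RowFits T t.hasRight (Fin.tail Y) := Iff.rfl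

theorem rowSign_cons {q : ℕ} (t : Tile 1 1) (T : Fin q → Tile 1 1) :
    rowSign (Fin.cons t T : Fin (q + 1) → Tile 1 1) = t.sign * rowSign T := by
  rw [rowSign, Fin.prod_univ_succ]
  rfl

/-- A tile that is not a bracket leaves the label of its column alone, and that label does not occur
among the later columns. -/
theorem rowSubst_cons {q : ℕ} {t : Tile 1 1} {x : ℕ} {y : Fin (q + 1) → ℕ}
    (hy : Function.Injective y) (ht : t.topBundle x (y 0) [y 0] = [y 0])
    (T : Fin q → Tile 1 1) :
    rowSubst (Fin.cons t T : Fin (q + 1) → Tile 1 1) x y = rowSubst T x (Fin.tail y) := by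
  funext z
  rw [rowSubst, Fin.cons_zero, Fin.tail_cons, ht]
  split
  · next h =>
    rw [h, rowSubst_of_forall_ne]
    exact fun j h => Fin.succ_ne_zero j (hy h).symm
  · rfl

theorem rowSubst_cons_deadRow {q : ℕ} (t : Tile 1 1) (x : ℕ) (y : Fin (q + 1) → ℕ)
    (Y : Fin q → Bool) :
    rowSubst (Fin.cons t (deadRow Y) : Fin (q + 1) → Tile 1 1) x y =
      labelSubst (y 0) (t.topBundle x (y 0) [y 0]) := by
  funext z
  rw [rowSubst, Fin.cons_zero, Fin.tail_cons, rowSubst_deadRow]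
  rfl

theorem concat_activeLabels {q : ℕ} (y : Fin (q + 1) → ℕ) (Y : Fin (q + 1) → Bool) :
    concat (activeLabels y Y) =
      (if Y 0 then [y 0] else []) ++ concat (activeLabels (Fin.tail y) (Fin.tail Y)) := by
  rw [concat_succ]
  rfl

theorem labelSubst_labelSubst {x : ℕ} {l l' : List ℕ} (z : ℕ) :
    (labelSubst x l z).flatMap (labelSubst x l') =
      labelSubst x (l.flatMap (labelSubst x l')) z := by
  by_cases h : z = x <;> simp [labelSubst, h]

theorem labelSubst_self (x : ℕ) : labelSubst x [x] = fun z => [z] := by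
  funext z
  by_cases h : z = x <;> simp [labelSubst, h]

theorem mem_flatMap_of_mem {s : ℕ → List ℕ} {z : ℕ} {l : List ℕ} (h : z ∈ l) (hs : z ∈ s z) :
    z ∈ l.flatMap s := List.mem_flatMap.2 ⟨z, h, hs⟩

open Classical in
/-- Move an action through a row of coactions. -/
theorem eval_row : {q : ℕ} → (y : Fin q → ℕ) → (Y : Fin q → Bool) → (x : ℕ) → (c a : List ℕ) →
    (M Z : List (Letter ℕ)) → Function.Injective y → (∀ j, y j ≠ x) → x ∈ c →
    (∀ j, Y j = true → y j ∈ a) →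
    IsChordWord K
      (framedWord c (M ++ .act x :: ((concat (activeLabels y Y)).map .coact ++ Z)) a) →
    (∀ T, RowFits T true Y → IsChordWord K (rowWord T x y c M Z a)) ∧
    eval K (framedWord c (M ++ .act x :: ((concat (activeLabels y Y)).map .coact ++ Z)) a) =
      ∑ T, if RowFits T true Y then rowSign T • eval K (rowWord T x y c M Z a) else 0
  | 0, y, Y, x, c, a, M, Z, _, _, _, _, h => by
    have e : ∀ T : Fin 0 → Tile 1 1, rowWord T x y c M Z a =
        framedWord c (M ++ .act x :: ((concat (activeLabels y Y)).map .coact ++ Z)) a := by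
      intro T
      have h1 : rowBundle T x y = [x] := rfl
      have h2 : rowSubst T x y = fun z => [z] := rfl
      have h3 : rowEnd T true = true := rfl
      rw [rowWord, h1, h2, h3, labelSubst_self, flatMap_eq_self fun _ _ => rfl,
        flatMap_eq_self fun _ _ => rfl]
      simp [concat]
    refine ⟨fun T _ => e T ▸ h, ?_⟩
    rw [Fintype.sum_unique, if_pos (show RowFits _ true Y from trivial), e, rowSign, Finset.prod_of_isEmpty, one_smul]
  | q + 1, y, Y, x, c, a, M, Z, hy, hyx, hxc, hya, h => by
    have hy' : Function.Injective (Fin.tail y) := fun i j h => Fin.succ_injective _ (hy h)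
    have hyx' : ∀ j, Fin.tail y j ≠ x := fun j => hyx _
    have hcross : ∀ T' : Fin q → Tile 1 1, rowWord (Fin.cons (.cross 0 0) T' : Fin (q + 1) → _)
        x y c M Z a = rowWord T' x (Fin.tail y) c (M ++ [.coact (y 0)]) Z a := by
      intro T'
      rw [rowWord, rowSubst_cons hy rfl, concat_activeLabels]
      simp [rowWord, rowBundle, rowEnd, Tile.leftBundle, Tile.hasBottom, Tile.hasRight]
      rfl
    have hhor : ∀ T' : Fin q → Tile 1 1, rowWord (Fin.cons (.horizontal 0) T' : Fin (q + 1) → _)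
        x y c M Z a = rowWord T' x (Fin.tail y) c M Z a := by
      intro T'
      rw [rowWord, rowSubst_cons hy rfl, concat_activeLabels]
      simp [rowWord, rowBundle, rowEnd, Tile.leftBundle, Tile.hasBottom, Tile.hasRight]
      rfl
    have hca : ∀ T' : Fin q → Tile 1 1, rowWord (Fin.cons (.cobracketAbove 0) T' : Fin (q + 1) → _)
        x y c M Z a =
          rowWord T' x (Fin.tail y) (c.flatMap (labelSubst x [y 0, x])) M Z a := by
      intro T'
      rw [rowWord, rowSubst_cons hy rfl, concat_activeLabels, rowWord, List.flatMap_assoc]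
      simp only [labelSubst_labelSubst]
      simp [rowBundle, rowEnd, Tile.leftBundle, Tile.hasBottom, Tile.hasRight, labelSubst, hyx 0]
      rfl
    have hcb : ∀ T' : Fin q → Tile 1 1, rowWord (Fin.cons (.cobracketBelow 0) T' : Fin (q + 1) → _)
        x y c M Z a =
          rowWord T' x (Fin.tail y) (c.flatMap (labelSubst x [x, y 0])) M Z a := by
      intro T'
      rw [rowWord, rowSubst_cons hy rfl, concat_activeLabels, rowWord, List.flatMap_assoc]
      simp only [labelSubst_labelSubst]
      simp [rowBundle, rowEnd, Tile.leftBundle, Tile.hasBottom, Tile.hasRight, labelSubst, hyx 0]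
      rfl
    -- After a bracket the letter `act x` has joined the outer actions next to `y 0`; all remaining
    -- active coactions stay untouched.
    have hdead : ∀ t : Tile 1 1, t = .bracketLeft 0 ∨ t = .bracketRight 0 →
        rowWord (Fin.cons t (deadRow (Fin.tail Y)) : Fin (q + 1) → Tile 1 1) x y c M Z a =
          framedWord c (M ++ .coact (y 0) ::
            ((concat (activeLabels (Fin.tail y) (Fin.tail Y))).map .coact ++ Z))
            (a.flatMap (labelSubst (y 0) (t.topBundle x (y 0) [y 0]))) := by
      intro t ht
      have h1 : rowBundle (Fin.cons t (deadRow (Fin.tail Y)) : Fin (q + 1) → Tile 1 1) x y =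
          [x] := by rcases ht with rfl | rfl <;> rfl
      have h2 : t.hasBottom = true := by rcases ht with rfl | rfl <;> rfl
      have h3 : rowEnd (Fin.cons t (deadRow (Fin.tail Y)) : Fin (q + 1) → Tile 1 1) true =
          false := by
        rcases ht with rfl | rfl <;> exact rowEnd_deadRow _
      rw [rowWord, rowSubst_cons_deadRow, concat_activeLabels, h1, labelSubst_self,
        flatMap_eq_self fun _ _ => rfl, h3]
      have h4 : (Fin.tail fun j => Tile.hasBottom
          ((Fin.cons t (deadRow (Fin.tail Y)) : Fin (q + 1) → Tile 1 1) j)) = Fin.tail Y :=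
        hasBottom_deadRow _
      rw [h4]
      simp [h2]
    -- `S t` collects the tilings of the row whose first tile is `t`, so the eight tiles can be
    -- compared one by one with the terms of the exchange relation.
    set S : Tile 1 1 → Hom K [.mod] [.mod] := fun t => ∑ T' : Fin q → Tile 1 1,
      if RowFits (Fin.cons t T' : Fin (q + 1) → Tile 1 1) true Y then
        rowSign (Fin.cons t T' : Fin (q + 1) → Tile 1 1) •
          eval K (rowWord (Fin.cons t T' : Fin (q + 1) → Tile 1 1) x y c M Z a) else 0 with hS
    have hsum : (∑ T, if RowFits T true Y then rowSign T • eval K (rowWord T x y c M Z a) else 0) =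
        ∑ t, S t := sum_finCons _
    -- If `t` passes the string of the row on, its contribution is the expansion of the shorter row,
    -- to which the induction hypothesis applies.
    have alive : ∀ (t : Tile 1 1) (c' : List ℕ) (M' : List (Letter ℕ)),
        t.hasLeft = true → t.hasTop = Y 0 → t.hasRight = true →
        (∀ T', rowWord (Fin.cons t T' : Fin (q + 1) → Tile 1 1) x y c M Z a =
          rowWord T' x (Fin.tail y) c' M' Z a) →
        S t = t.sign • ∑ T', if RowFits T' true (Fin.tail Y) then
          rowSign T' • eval K (rowWord T' x (Fin.tail y) c' M' Z a) else 0 := by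
      intro t c' M' h1 h2 h3 h4
      simp only [hS, rowFits_cons, h1, h2, h3, true_and, h4, rowSign_cons, mul_smul]
      rw [Finset.smul_sum]
      exact Finset.sum_congr rfl fun T _ => by split <;> simp
    have dead : ∀ t : Tile 1 1, t.hasLeft = true → t.hasTop = Y 0 → t.hasRight = false →
        S t = t.sign • eval K
          (rowWord (Fin.cons t (deadRow (Fin.tail Y)) : Fin (q + 1) → Tile 1 1) x y c M Z a) := by
      intro t h1 h2 h3
      simp only [hS, rowFits_cons, h1, h2, h3, true_and, rowFits_false_iff, rowSign_cons]
      rw [Finset.sum_ite_eq' Finset.univ, if_pos (Finset.mem_univ _), rowSign_deadRow, mul_one]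
    have none : ∀ t : Tile 1 1, ¬ (t.hasLeft = true ∧ t.hasTop = Y 0) → S t = 0 := by
      intro t ht
      refine Finset.sum_eq_zero fun T _ => if_neg fun hT => ht ⟨hT.1, hT.2.1⟩
    have hcons : ∀ T : Fin (q + 1) → Tile 1 1, T = Fin.cons (T 0) (Fin.tail T) :=
      fun T => (Fin.cons_self_tail T).symm
    rw [hsum, sum_tile]
    -- A column without a string contributes no letter and only the horizontal tile fits. An active
    -- column forces one exchange, whose five terms are the five other tiles with strings on the
    -- left edge.
    rcases hY : Y 0 with _ | _
    · rw [concat_activeLabels, hY] at h ⊢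
      obtain ⟨ih, ih'⟩ := eval_row (Fin.tail y) (Fin.tail Y) x c a M Z hy' hyx' hxc
        (fun j hj => hya _ hj) h
      constructor
      · intro T hT
        rw [hcons T] at hT ⊢
        rw [rowFits_cons, hY] at hT
        revert hT
        generalize Fin.tail T = T'
        rcases T 0 with ⟨k, l⟩ | l | l | k | k | k | l | _ <;>
          simp only [Tile.hasLeft, Tile.hasTop, Bool.true_eq_false, Bool.false_eq_true, false_and,
            and_false, IsEmpty.forall_iff, true_and]
        obtain rfl : k = 0 := Subsingleton.elim _ _
        intro hT
        rw [hhor]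
        exact ih _ hT
      · rw [none (.cross 0 0) (by simp [hY, Tile.hasTop]), none (.bracketLeft 0) (by simp [hY, Tile.hasTop]),
          none (.bracketRight 0) (by simp [hY, Tile.hasTop]),
          none (.cobracketAbove 0) (by simp [hY, Tile.hasTop]),
          none (.cobracketBelow 0) (by simp [hY, Tile.hasTop]),
          none (.vertical 0) (by simp [Tile.hasLeft]), none .empty (by simp [Tile.hasLeft]),
          alive (.horizontal 0) c M rfl hY.symm rfl hhor, ← ih']
        simp [Tile.sign, Tile.negative]
    · have hya0 : y 0 ∈ a := hya 0 hY
      have hW : ((if true = true then [y 0] else []) ++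
          concat (activeLabels (Fin.tail y) (Fin.tail Y))).map Letter.coact ++ Z =
          .coact (y 0) :: ((concat (activeLabels (Fin.tail y) (Fin.tail Y))).map .coact ++ Z) := rfl
      rw [concat_activeLabels, hY, hW] at h ⊢
      obtain ⟨⟨h₁, h₂, h₃, h₄, h₅⟩, e⟩ := framedWord_exchange hxc hya0 h
      have hassoc : ∀ W : List (Letter ℕ), M ++ .coact (y 0) :: W = (M ++ [.coact (y 0)]) ++ W := by
        intro W; simp
      have hyab : ∀ j, Fin.tail Y j = true → Fin.tail y j ∈ a := fun j hj => hya _ hj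
      rw [hassoc] at h₁
      obtain ⟨i₁, j₁⟩ := eval_row (Fin.tail y) (Fin.tail Y) x c a (M ++ [.coact (y 0)]) Z hy' hyx'
        hxc hyab h₁
      obtain ⟨i₄, j₄⟩ := eval_row (Fin.tail y) (Fin.tail Y) x _ a M Z hy' hyx'
        (mem_flatMap_of_mem hxc (by simp [labelSubst])) hyab h₄
      obtain ⟨i₅, j₅⟩ := eval_row (Fin.tail y) (Fin.tail Y) x _ a M Z hy' hyx'
        (mem_flatMap_of_mem hxc (by simp [labelSubst])) hyab h₅
      constructor
      · intro T hT
        rw [hcons T] at hT ⊢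
        rw [rowFits_cons, hY] at hT
        revert hT
        generalize Fin.tail T = T'
        rcases T 0 with ⟨k, l⟩ | l | l | k | k | k | l | _ <;>
          simp only [Tile.hasLeft, Tile.hasTop, Tile.hasRight,
            Bool.false_eq_true, false_and, and_false, IsEmpty.forall_iff, true_and,
            rowFits_false_iff]
        · obtain rfl : k = 0 := Subsingleton.elim _ _
          obtain rfl : l = 0 := Subsingleton.elim _ _
          intro hT
          rw [hcross]
          exact i₁ _ hT
        · obtain rfl : l = 0 := Subsingleton.elim _ _
          rintro rfl
          rw [hdead _ (.inl rfl)]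
          exact h₂
        · obtain rfl : l = 0 := Subsingleton.elim _ _
          rintro rfl
          rw [hdead _ (.inr rfl)]
          exact h₃
        · obtain rfl : k = 0 := Subsingleton.elim _ _
          intro hT
          rw [hca]
          exact i₄ _ hT
        · obtain rfl : k = 0 := Subsingleton.elim _ _
          intro hT
          rw [hcb]
          exact i₅ _ hT
      · refine e.trans ?_
        rw [hassoc, j₁, j₄, j₅, alive (.cross 0 0) _ _ rfl hY.symm rfl hcross,
          alive (.cobracketAbove 0) _ _ rfl hY.symm rfl hca,
          alive (.cobracketBelow 0) _ _ rfl hY.symm rfl hcb,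
          dead (.bracketLeft 0) rfl hY.symm rfl, dead (.bracketRight 0) rfl hY.symm rfl,
          hdead _ (.inl rfl), hdead _ (.inr rfl), none (.horizontal 0) (by simp [hY, Tile.hasTop]),
          none (.vertical 0) (by simp [Tile.hasLeft]), none .empty (by simp [Tile.hasLeft])]
        simp only [Tile.sign, Tile.negative, Tile.topBundle, if_true, if_false, neg_smul, one_smul,
          Bool.false_eq_true, List.singleton_append]
        abel

end Expansion

/-! ### Moving all actions through all coactions. -/

section Grids

variable {n m q : ℕ}

/-- The tiles of a grid fit together, all rows start with strings on the left end, and `Y` tells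
which columns have strings on the top end. -/
def GridFits : {p : ℕ} → (Fin p → Fin q → Tile n m) → (Fin q → Bool) → Prop
  | 0, _, _ => True
  | _ + 1, L, Y => RowFits (L 0) true Y ∧ GridFits (Fin.tail L) fun j => (L 0 j).hasBottom

/-- Whether there are strings on the bottom ends of the columns. -/
def gridBottom : {p : ℕ} → (Fin p → Fin q → Tile n m) → (Fin q → Bool) → Fin q → Bool
  | 0, _, Y => Y
  | _ + 1, L, _ => gridBottom (Fin.tail L) fun j => (L 0 j).hasBottom

/-- Replace the label of every row by the bundle of strings on its left end. -/
def leftSubst : {p : ℕ} → (Fin p → Fin q → Tile n m) → (Fin p → ℕ) → (Fin q → ℕ) → ℕ → List ℕ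
  | 0, _, _, _, z => [z]
  | _ + 1, L, x, y, z =>
    if z = x 0 then rowBundle (L 0) (x 0) y else leftSubst (Fin.tail L) (Fin.tail x) y z

/-- Replace the label of every column by the bundle of strings on its top end. -/
def topSubst : {p : ℕ} → (Fin p → Fin q → Tile n m) → (Fin p → ℕ) → (Fin q → ℕ) → ℕ → List ℕ
  | 0, _, _, _, z => [z]
  | _ + 1, L, x, y, z => (rowSubst (L 0) (x 0) y z).flatMap (topSubst (Fin.tail L) (Fin.tail x) y)

/-- The sign of a grid. -/
def gridSign {p : ℕ} (L : Fin p → Fin q → Tile n m) : ℤ := ∏ i, rowSign (L i)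

/-- The labels on the right end of the rows. -/
def rightLabels {p : ℕ} (L : Fin p → Fin q → Tile n m) (x : Fin p → ℕ) : Fin p → List ℕ :=
  activeLabels x fun i => rowEnd (L i) true

theorem leftSubst_of_forall_ne : {p : ℕ} → (L : Fin p → Fin q → Tile n m) → (x : Fin p → ℕ) →
    (y : Fin q → ℕ) → (z : ℕ) → (∀ i, z ≠ x i) → leftSubst L x y z = [z]
  | 0, _, _, _, _, _ => rfl
  | _ + 1, L, x, y, z, h => by
    rw [leftSubst, if_neg (h 0)]
    exact leftSubst_of_forall_ne _ _ _ _ fun i => h i.succ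

theorem leftSubst_apply : {p : ℕ} → (L : Fin p → Fin q → Tile n m) → (x : Fin p → ℕ) →
    (y : Fin q → ℕ) → Function.Injective x → (i : Fin p) →
    leftSubst L x y (x i) = rowBundle (L i) (x i) y
  | 0, _, _, _, _, i => i.elim0
  | p + 1, L, x, y, hx, i => by
    refine Fin.cases ?_ (fun i => ?_) i
    · rw [leftSubst, if_pos rfl]
    · rw [leftSubst, if_neg fun h => Fin.succ_ne_zero i (hx h)]
      exact leftSubst_apply (Fin.tail L) (Fin.tail x) y
        (fun a b h => Fin.succ_injective _ (hx h)) i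

theorem topSubst_of_forall_ne : {p : ℕ} → (L : Fin p → Fin q → Tile n m) → (x : Fin p → ℕ) →
    (y : Fin q → ℕ) → (z : ℕ) → (∀ j, z ≠ y j) → topSubst L x y z = [z]
  | 0, _, _, _, _, _ => rfl
  | _ + 1, L, x, y, z, h => by
    rw [topSubst, rowSubst_of_forall_ne _ _ _ _ h, List.flatMap_singleton]
    exact topSubst_of_forall_ne _ _ _ _ h

theorem mem_rowBundle_iff : {q : ℕ} → (T : Fin q → Tile n m) → (x : ℕ) → (y : Fin q → ℕ) →
    (z : ℕ) → z ∈ rowBundle T x y → z = x ∨ ∃ j, z = y j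
  | 0, _, x, _, z, h => .inl (List.mem_singleton.1 h)
  | q + 1, T, x, y, z, h => by
    have ih := mem_rowBundle_iff (Fin.tail T) x (Fin.tail y) z
    have ih' : z ∈ rowBundle (Fin.tail T) x (Fin.tail y) → z = x ∨ ∃ j, z = y j := fun h =>
      (ih h).imp _root_.id fun ⟨j, hj⟩ => ⟨j.succ, hj⟩
    rw [rowBundle] at h
    cases hT : T 0 <;> simp only [hT, Tile.leftBundle, List.mem_cons, List.mem_append,
      List.not_mem_nil, or_false] at h
    case cobracketAbove => exact h.elim (fun h => .inr ⟨0, h⟩) ih'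
    case cobracketBelow => exact h.elim ih' fun h => .inr ⟨0, h⟩
    case bracketLeft => exact .inl h
    case bracketRight => exact .inl h
    all_goals exact ih' h

theorem RowFits.hasTop_eq : {q : ℕ} → {T : Fin q → Tile n m} → {a : Bool} → {Y : Fin q → Bool} →
    RowFits T a Y → ∀ j, (T j).hasTop = Y j
  | 0, _, _, _, _, j => j.elim0
  | _ + 1, _, _, _, h, j => Fin.cases h.2.1 (RowFits.hasTop_eq h.2.2) j

theorem hasTop_of_hasBottom (t : Tile n m) (h : t.hasBottom = true) : t.hasTop = true := by
  cases t <;> first | rfl | exact h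

end Grids

section Expansion

variable {K : Type u} [Field K] {q : ℕ}

/-- The word obtained by moving all actions through all coactions. -/
def gridWord {p : ℕ} (L : Fin p → Fin q → Tile 1 1) (x : Fin p → ℕ) (y : Fin q → ℕ)
    (Y : Fin q → Bool) (c : List ℕ) (Z : List (Letter ℕ)) (a : List ℕ) : List (Letter ℕ) :=
  framedWord (c.flatMap (leftSubst L x y))
    ((concat (activeLabels y (gridBottom L Y))).map .coact ++
      (((concat (rightLabels L x)).map .act).reverse ++ Z))
    (a.flatMap (topSubst L x y))

/-- The substitutions of a grid are those of its top row followed by those of the rows below, and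
the string surviving the top row joins the letters in `Z`. This is the recursion behind `eval_grid`.
-/
theorem gridWord_cons {p : ℕ} (T : Fin q → Tile 1 1) (L : Fin p → Fin q → Tile 1 1)
    (x : Fin (p + 1) → ℕ) (y : Fin q → ℕ) (Y : Fin q → Bool) (c : List ℕ) (Z : List (Letter ℕ))
    (a : List ℕ) (hx : Function.Injective x) (hyx : ∀ i j, y j ≠ x i) :
    gridWord (Fin.cons T L : Fin (p + 1) → Fin q → Tile 1 1) x y Y c Z a =
      gridWord L (Fin.tail x) y (fun j => (T j).hasBottom)
        (c.flatMap (labelSubst (x 0) (rowBundle T (x 0) y)))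
        ((if rowEnd T true then [.act (x 0)] else []) ++ Z) (a.flatMap (rowSubst T (x 0) y)) := by
  have h1 : leftSubst (Fin.cons T L : Fin (p + 1) → Fin q → Tile 1 1) x y = fun z =>
      (labelSubst (x 0) (rowBundle T (x 0) y) z).flatMap (leftSubst L (Fin.tail x) y) := by
    funext z
    rw [leftSubst, labelSubst, Fin.cons_zero, Fin.tail_cons]
    split
    -- The bundle of the top row contains only its own label and labels of columns, which the lower
    -- rows do not replace on the left.
    · rw [flatMap_eq_self]
      intro z hz
      refine leftSubst_of_forall_ne _ _ _ _ fun i => ?_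
      rcases mem_rowBundle_iff _ _ _ _ hz with rfl | ⟨j, rfl⟩
      · exact fun h => Fin.succ_ne_zero i (hx h.symm)
      · exact hyx _ _
    · rw [List.flatMap_singleton]
  have h2 : concat (rightLabels (Fin.cons T L : Fin (p + 1) → Fin q → Tile 1 1) x) =
      (if rowEnd T true then [x 0] else []) ++ concat (rightLabels L (Fin.tail x)) := by
    rw [concat_succ]
    rfl
  have h3 : (((if rowEnd T true then [x 0] else []).map Letter.act).reverse) =
      if rowEnd T true then [.act (x 0)] else [] := by split <;> rfl
  rw [gridWord, gridWord, h1, h2, List.flatMap_assoc, List.flatMap_assoc, List.map_append,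
    List.reverse_append, h3, List.append_assoc]
  rfl

open Classical in
/-- Move all actions through all coactions. -/
theorem eval_grid : {p : ℕ} → (x : Fin p → ℕ) → (y : Fin q → ℕ) → (Y : Fin q → Bool) →
    (c a : List ℕ) → (Z : List (Letter ℕ)) → Function.Injective x → Function.Injective y →
    (∀ i j, y j ≠ x i) → (∀ i, x i ∈ c) → (∀ j, Y j = true → y j ∈ a) →
    IsChordWord K (framedWord c (((List.ofFn x).map .act).reverse ++
      ((concat (activeLabels y Y)).map .coact ++ Z)) a) →
    (∀ L : Fin p → Fin q → Tile 1 1, GridFits L Y → IsChordWord K (gridWord L x y Y c Z a)) ∧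
    eval K (framedWord c (((List.ofFn x).map .act).reverse ++
      ((concat (activeLabels y Y)).map .coact ++ Z)) a) =
      ∑ L : Fin p → Fin q → Tile 1 1,
        if GridFits L Y then gridSign L • eval K (gridWord L x y Y c Z a) else 0
  | 0, x, y, Y, c, a, Z, _, _, _, _, _, h => by
    have e : ∀ L : Fin 0 → Fin q → Tile 1 1, gridWord L x y Y c Z a =
        framedWord c (((List.ofFn x).map .act).reverse ++
          ((concat (activeLabels y Y)).map .coact ++ Z)) a := by
      intro L
      have h1 : leftSubst L x y = fun z => [z] := rfl
      have h2 : topSubst L x y = fun z => [z] := rfl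
      rw [gridWord, h1, h2, flatMap_eq_self fun _ _ => rfl, flatMap_eq_self fun _ _ => rfl]
      simp [concat, gridBottom]
    refine ⟨fun L _ => e L ▸ h, ?_⟩
    have hfit : ∀ L : Fin 0 → Fin q → Tile 1 1, GridFits L Y := fun _ => trivial
    rw [Fintype.sum_unique, if_pos (hfit _), e, gridSign,
      Finset.prod_of_isEmpty, one_smul]
  | p + 1, x, y, Y, c, a, Z, hx, hy, hyx, hxc, hya, h => by
    -- Actions are listed in reverse, so `act (x 0)` is the one adjacent to the coactions: the top
    -- row is expanded before the rows below it.
    have hofFn : ((List.ofFn x).map Letter.act).reverse ++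
        ((concat (activeLabels y Y)).map .coact ++ Z) =
        ((List.ofFn (Fin.tail x)).map .act).reverse ++
          .act (x 0) :: ((concat (activeLabels y Y)).map .coact ++ Z) := by
      rw [List.ofFn_succ, List.map_cons, List.reverse_cons, List.append_assoc]
      rfl
    rw [hofFn] at h ⊢
    obtain ⟨hr, er⟩ := eval_row y Y (x 0) c a _ Z hy (fun j => hyx 0 j) (hxc 0) hya h
    have ih := fun (T : Fin q → Tile 1 1) (hT : RowFits T true Y) =>
      eval_grid (Fin.tail x) y (fun j => (T j).hasBottom)
        (c.flatMap (labelSubst (x 0) (rowBundle T (x 0) y))) (a.flatMap (rowSubst T (x 0) y))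
        ((if rowEnd T true then [Letter.act (x 0)] else []) ++ Z)
        (fun a b h => Fin.succ_injective _ (hx h)) hy (fun i j => hyx _ j)
        (fun i => mem_flatMap_of_mem (hxc i.succ) (by
          have : x i.succ ≠ x 0 := fun h => Fin.succ_ne_zero i (hx h)
          simp [labelSubst, Fin.tail, this]))
        -- A column still active below the row was active above it, and its label belongs to its own
        -- top bundle, hence remains among the outer actions.
        (fun j hj => mem_flatMap_of_mem
          (hya j ((hT.hasTop_eq j).symm.trans (hasTop_of_hasBottom _ hj))) (by
            rw [rowSubst_apply _ _ _ hy]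
            cases T j <;> simp [Tile.topBundle]))
        (hr T hT)
    constructor
    · intro L hL
      have e := gridWord_cons (L 0) (Fin.tail L) x y Y c Z a hx hyx
      rw [Fin.cons_self_tail] at e
      rw [e]
      exact (ih _ hL.1).1 _ hL.2
    · rw [er, sum_finCons]
      refine Finset.sum_congr rfl fun T _ => ?_
      have hfit : ∀ L : Fin p → Fin q → Tile 1 1,
          GridFits (Fin.cons T L : Fin (p + 1) → Fin q → Tile 1 1) Y ↔
            RowFits T true Y ∧ GridFits L fun j => (T j).hasBottom := fun L => Iff.rfl
      by_cases hT : RowFits T true Y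
      · rw [if_pos hT]
        refine (congrArg _ (ih T hT).2).trans ?_
        rw [Finset.smul_sum]
        refine Finset.sum_congr rfl fun L _ => ?_
        have hs : gridSign (Fin.cons T L : Fin (p + 1) → Fin q → Tile 1 1) =
            rowSign T * gridSign L := by
          rw [gridSign, Fin.prod_univ_succ]
          rfl
        rw [gridWord_cons _ _ _ _ _ _ _ _ hx hyx, hs, mul_smul]
        simp only [hfit, hT, true_and]
        split <;> simp
      · rw [if_neg hT]
        exact (Finset.sum_eq_zero fun L _ => if_neg fun h => hT ((hfit L).1 h).1).symm

end Expansion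

/-! ### Running bundles of strings through a grid. -/

section Pass

variable {n m q : ℕ}

/-- The left bundle is built so that each tile peels off exactly what it needs: a cobracket sends
the column's label to the top, and a bracket sends the row's own label there. A surviving row ends
with the single label `x`. -/
theorem rowPass_rowBundle : {q : ℕ} → (T : Fin q → Tile n m) → (x : ℕ) → (y : Fin q → ℕ) →
    (a : Bool) → (Y : Fin q → Bool) → (b : Fin q → List ℕ) → RowFits T a Y →
    (∀ j, (T j).hasBottom = false → b j = []) →
    rowPass T (if a then rowBundle T x y else []) b =
      (fun j => (T j).topBundle x (y j) (b j), if rowEnd T a then [x] else [])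
  | 0, T, x, y, a, Y, b, _, _ => by
    rw [rowPass]
    exact congrArg₂ Prod.mk (Subsingleton.elim _ _) rfl
  | q + 1, T, x, y, a, Y, b, h, hb => by
    obtain ⟨h1, h2, h3⟩ := h
    have ih := rowPass_rowBundle (Fin.tail T) x (Fin.tail y) _ _ (Fin.tail b) h3
      fun j => hb j.succ
    have hp : (T 0).pass (if a then rowBundle T x y else []) (b 0) =
        ((T 0).topBundle x (y 0) (b 0),
          if (T 0).hasRight then rowBundle (Fin.tail T) x (Fin.tail y) else []) := by
      rw [rowBundle, ← h1]
      have hb0 := hb 0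
      cases hT : T 0 <;> simp [hT, Tile.pass, Tile.hasLeft, Tile.hasRight, Tile.leftBundle,
        Tile.topBundle, Tile.hasBottom] at hb0 ⊢
      all_goals exact hb0
    rw [rowPass, hp, ih]
    refine congrArg₂ Prod.mk (funext fun j => Fin.cases ?_ (fun j => ?_) j) ?_
    · rfl
    · rfl
    · rfl

/-- A column without a string on top has none further down, so no bracket can occur in it. Below a
cobracket the label of the column is thus never expanded. -/
theorem topSubst_of_eq_false : {p : ℕ} → (L : Fin p → Fin q → Tile n m) → (x : Fin p → ℕ) →
    (y : Fin q → ℕ) → (Y : Fin q → Bool) → Function.Injective y → GridFits L Y → (j : Fin q) →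
    Y j = false → topSubst L x y (y j) = [y j]
  | 0, _, _, _, _, _, _, _, _ => rfl
  | p + 1, L, x, y, Y, hy, h, j, hj => by
    have h1 := (h.1.hasTop_eq j).trans hj
    have h2 : (L 0 j).hasBottom = false ∧ (L 0 j).topBundle (x 0) (y j) [y j] = [y j] := by
      cases hT : L 0 j <;> simp [hT, Tile.hasTop] at h1 <;> exact ⟨rfl, rfl⟩
    rw [topSubst, rowSubst_apply _ _ _ hy, h2.2, List.flatMap_singleton]
    exact topSubst_of_eq_false _ _ _ _ hy h.2 j h2.1

/-- The bundles of strings run through a grid as prescribed by the substitutions. -/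
theorem gridPass_rowBundle : {p : ℕ} → (L : Fin p → Fin q → Tile n m) → (x : Fin p → ℕ) →
    (y : Fin q → ℕ) → (Y : Fin q → Bool) → Function.Injective y →
    (∀ i j, y j ≠ x i) → GridFits L Y →
    gridPass L (fun i => rowBundle (L i) (x i) y) (activeLabels y (gridBottom L Y)) =
      (fun j => if Y j then topSubst L x y (y j) else [], rightLabels L x)
  | 0, L, x, y, Y, _, _, _ => by
    rw [gridPass]
    exact congrArg₂ Prod.mk rfl (Subsingleton.elim _ _)
  | p + 1, L, x, y, Y, hy, hyx, h => by
    have ih := gridPass_rowBundle (Fin.tail L) (Fin.tail x) y _ hy (fun i j => hyx _ j) h.2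
    have hr := rowPass_rowBundle (L 0) (x 0) y true Y
      (fun j => if (L 0 j).hasBottom then topSubst (Fin.tail L) (Fin.tail x) y (y j) else [])
      h.1 fun j hj => by simp [hj]
    have ih' : gridPass (Fin.tail L) (Fin.tail fun i => rowBundle (L i) (x i) y)
      (activeLabels y (gridBottom L Y)) = _ := ih
    rw [if_pos rfl] at hr
    rw [gridPass, ih', hr]
    refine congrArg₂ Prod.mk (funext fun j => ?_) (funext fun i => Fin.cases ?_ (fun i => ?_) i)
    · have h1 := h.1.hasTop_eq j
      -- The label of the top row added by a bracket is not the label of any column, so the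
      -- substitutions of the lower rows fix it.
      have hxs : topSubst (Fin.tail L) (Fin.tail x) y (x 0) = [x 0] :=
        topSubst_of_forall_ne _ _ _ _ fun j => (hyx 0 j).symm
      have hf := topSubst_of_eq_false (Fin.tail L) (Fin.tail x) y _ hy h.2 j
      rw [topSubst, rowSubst_apply _ _ _ hy, ← h1]
      cases hT : L 0 j <;>
        simp [hT, Tile.topBundle, Tile.hasBottom, Tile.hasTop, hxs] at hf ⊢
      all_goals exact hf.symm
    · rfl
    · rfl

end Pass

/-! ### Tile shapes against string multiplicities. -/

namespace Tile

variable {n m : ℕ}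

/-- Forget the numbers of parallel strings of a tile. -/
def unit : Tile n m → Tile 1 1
  | cross _ _ => cross 0 0
  | bracketLeft _ => bracketLeft 0
  | bracketRight _ => bracketRight 0
  | cobracketAbove _ => cobracketAbove 0
  | cobracketBelow _ => cobracketBelow 0
  | horizontal _ => horizontal 0
  | vertical _ => vertical 0
  | empty => empty

/-- The tile of the shape `t` with prescribed numbers of parallel strings. -/
def fill (k : Fin m) (l : Fin n) : Tile 1 1 → Tile n m
  | cross _ _ => cross k l
  | bracketLeft _ => bracketLeft l
  | bracketRight _ => bracketRight l
  | cobracketAbove _ => cobracketAbove k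
  | cobracketBelow _ => cobracketBelow k
  | horizontal _ => horizontal k
  | vertical _ => vertical l
  | empty => empty

/-- The number of brackets of a tile. -/
def brackets : Tile n m → ℕ
  | bracketLeft _ => 1
  | bracketRight _ => 1
  | _ => 0

/-- The number of cobrackets of a tile. -/
def cobrackets : Tile n m → ℕ
  | cobracketAbove _ => 1
  | cobracketBelow _ => 1
  | _ => 0

theorem unit_fill (k : Fin m) (l : Fin n) (t : Tile 1 1) : (t.fill k l).unit = t := by
  rcases t with ⟨a, b⟩ | b | b | a | a | a | b | _ <;> try rfl
  all_goals simp [fill, unit, eq_iff_true_of_subsingleton]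

theorem left_eq (t : Tile n m) : t.left = t.right + (t.brackets + t.cobrackets) := by
  cases t <;> rfl

theorem top_eq (t : Tile n m) : t.top = t.bottom + (t.brackets + t.cobrackets) := by
  cases t <;> simp [top, bottom, brackets, cobrackets]

theorem hasLeft_eq (t : Tile n m) : t.hasLeft.toNat = t.hasRight.toNat + t.brackets := by
  cases t <;> rfl

theorem hasTop_eq (t : Tile n m) : t.hasTop.toNat = t.hasBottom.toNat + t.cobrackets := by
  cases t <;> rfl

theorem hasLeft_eq_decide (t : Tile n m) : t.hasLeft = decide (0 < t.left) := by
  cases t <;> simp [hasLeft, left]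

theorem hasRight_eq_decide (t : Tile n m) : t.hasRight = decide (0 < t.right) := by
  cases t <;> simp [hasRight, right]

theorem hasTop_eq_decide (t : Tile n m) : t.hasTop = decide (0 < t.top) := by
  cases t <;> simp [hasTop, top]

theorem hasBottom_eq_decide (t : Tile n m) : t.hasBottom = decide (0 < t.bottom) := by
  cases t <;> simp [hasBottom, bottom]

theorem hasRight_le (t : Tile n m) : t.hasRight.toNat ≤ t.right := by
  cases t <;> simp [hasRight, right]

theorem hasBottom_le (t : Tile n m) : t.hasBottom.toNat ≤ t.bottom := by
  cases t <;> simp [hasBottom, bottom]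

theorem unit_hasLeft (t : Tile n m) : t.unit.hasLeft = t.hasLeft := by cases t <;> rfl

theorem unit_hasRight (t : Tile n m) : t.unit.hasRight = t.hasRight := by cases t <;> rfl

theorem unit_hasTop (t : Tile n m) : t.unit.hasTop = t.hasTop := by cases t <;> rfl

theorem unit_hasBottom (t : Tile n m) : t.unit.hasBottom = t.hasBottom := by cases t <;> rfl

theorem unit_negative (t : Tile n m) : t.unit.negative = t.negative := by cases t <;> rfl

theorem unit_brackets (t : Tile n m) : t.unit.brackets = t.brackets := by cases t <;> rfl

theorem unit_cobrackets (t : Tile n m) : t.unit.cobrackets = t.cobrackets := by cases t <;> rfl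

theorem unit_pass (t : Tile n m) (l b : List ℕ) : t.unit.pass l b = t.pass l b := by
  cases t <;> rfl

theorem eq_of_unit {t t' : Tile n m} (h : t.unit = t'.unit) (hr : t.right = t'.right)
    (hb : t.bottom = t'.bottom) : t = t' := by
  cases t <;> cases t' <;>
    simp_all [unit, right, bottom, Fin.ext_iff]

theorem pass_map (t : Tile n m) (f : ℕ → ℕ) (l b : List ℕ) :
    t.pass (l.map f) (b.map f) = ((t.pass l b).1.map f, (t.pass l b).2.map f) := by
  cases t <;> simp [pass, List.map_take, List.map_drop]

end Tile

section Fits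

variable {n m q : ℕ}

/-- The recursive condition serves the expansion; this edge-by-edge form is the one comparable with
`IsLoom`. -/
theorem rowFits_iff : {q : ℕ} → (T : Fin q → Tile n m) → (a : Bool) → (Y : Fin q → Bool) →
    (RowFits T a Y ↔ (∀ j : Fin q, (j : ℕ) = 0 → (T j).hasLeft = a) ∧
      (∀ j j' : Fin q, (j' : ℕ) = j + 1 → (T j).hasRight = (T j').hasLeft) ∧
      ∀ j, (T j).hasTop = Y j)
  | 0, T, a, Y => by simp [RowFits]
  | q + 1, T, a, Y => by
    rw [RowFits, rowFits_iff]
    constructor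
    · rintro ⟨h1, h2, h3, h4, h5⟩
      refine ⟨fun j hj => ?_, fun j j' h => ?_, fun j => Fin.cases h2 h5 j⟩
      · rw [show j = 0 from Fin.ext hj, h1]
      · revert h
        refine Fin.cases (fun h => absurd h (by simp)) (fun j' => ?_) j'
        refine Fin.cases (fun h => ?_) (fun j h => ?_) j
        · exact (h3 j' (by simpa using h)).symm
        · exact h4 j j' (by simpa using h)
    · rintro ⟨h1, h2, h3⟩
      exact ⟨h1 0 rfl, h3 0, fun j hj => (h2 0 j.succ (by simp [hj])).symm,
        fun j j' h => h2 j.succ j'.succ (by simp [h]), fun j => h3 j.succ⟩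

theorem gridFits_iff : {p : ℕ} → (L : Fin p → Fin q → Tile n m) → (Y : Fin q → Bool) →
    (GridFits L Y ↔ (∀ i, ∀ j : Fin q, (j : ℕ) = 0 → (L i j).hasLeft = true) ∧
      (∀ i, ∀ j j' : Fin q, (j' : ℕ) = j + 1 → (L i j).hasRight = (L i j').hasLeft) ∧
      (∀ i : Fin p, (i : ℕ) = 0 → ∀ j, (L i j).hasTop = Y j) ∧
      ∀ i i' : Fin p, (i' : ℕ) = i + 1 → ∀ j, (L i j).hasBottom = (L i' j).hasTop)
  | 0, L, Y => by simp [GridFits]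
  | p + 1, L, Y => by
    rw [GridFits, gridFits_iff, rowFits_iff]
    constructor
    · rintro ⟨⟨h1, h2, h3⟩, h4, h5, h6, h7⟩
      refine ⟨fun i => Fin.cases h1 h4 i, fun i => Fin.cases h2 h5 i, fun i hi => ?_,
        fun i i' h => ?_⟩
      · rw [show i = 0 from Fin.ext hi]
        exact h3
      · revert h
        refine Fin.cases (fun h => absurd h (by simp)) (fun i' => ?_) i'
        refine Fin.cases (fun h j => ?_) (fun i h => ?_) i
        · exact (h6 i' (by simpa using h) j).symm
        · exact h7 i i' (by simpa using h)
    · rintro ⟨h1, h2, h3, h4⟩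
      exact ⟨⟨h1 0, h2 0, h3 0 rfl⟩, fun i => h1 i.succ, fun i => h2 i.succ,
        fun i hi j => (h4 0 i.succ (by simp [hi]) j).symm,
        fun i i' h => h4 i.succ i'.succ (by simp [h])⟩

theorem GridFits.rowFits : {p : ℕ} → {L : Fin p → Fin q → Tile n m} → {Y : Fin q → Bool} →
    GridFits L Y → ∀ i, ∃ Y', RowFits (L i) true Y'
  | 0, _, _, _, i => i.elim0
  | _ + 1, _, _, h, i => Fin.cases ⟨_, h.1⟩ (GridFits.rowFits h.2) i

theorem rowEnd_eq : {q : ℕ} → (T : Fin q → Tile n m) → (a : Bool) →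
    rowEnd T a = if h : 0 < q then (T ⟨q - 1, Nat.sub_one_lt_of_lt h⟩).hasRight else a
  | 0, _, _ => rfl
  | 1, _, _ => rfl
  | q + 2, T, a => by
    rw [rowEnd, rowEnd_eq, dif_pos (Nat.succ_pos _), dif_pos (Nat.succ_pos _)]
    rfl

theorem gridBottom_eq : {p : ℕ} → (L : Fin p → Fin q → Tile n m) → (Y : Fin q → Bool) →
    (j : Fin q) → gridBottom L Y j =
      if h : 0 < p then (L ⟨p - 1, Nat.sub_one_lt_of_lt h⟩ j).hasBottom else Y j
  | 0, _, _, _ => rfl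
  | 1, _, _, _ => rfl
  | p + 2, L, Y, j => by
    rw [gridBottom, gridBottom_eq, dif_pos (Nat.succ_pos _), dif_pos (Nat.succ_pos _)]
    rfl

/-- The string of a row either reaches the right end or is absorbed by a bracket, so a row starting
with a string has at most one bracket. -/
theorem RowFits.toNat_eq : {q : ℕ} → {T : Fin q → Tile n m} → {a : Bool} → {Y : Fin q → Bool} →
    RowFits T a Y → a.toNat = (rowEnd T a).toNat + ∑ j, (T j).brackets
  | 0, _, _, _, _ => by simp [rowEnd]
  | _ + 1, T, a, Y, h => by
    have ih := h.2.2.toNat_eq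
    rw [Fin.sum_univ_succ, rowEnd, ← h.1, Tile.hasLeft_eq, ih]
    simp only [Fin.tail]
    omega

/-- The left bundle consists of the row's own string and one string for every cobracket of the row.
-/
theorem RowFits.length_rowBundle : {q : ℕ} → {T : Fin q → Tile n m} → {a : Bool} →
    {Y : Fin q → Bool} → RowFits T a Y → ∀ (x : ℕ) (y : Fin q → ℕ),
    (if a then rowBundle T x y else []).length = a.toNat + ∑ j, (T j).cobrackets
  | 0, T, a, _, _, x, y => by cases a <;> simp [rowBundle]
  | _ + 1, T, a, Y, h, x, y => by
    have ih := h.2.2.length_rowBundle x (Fin.tail y)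
    have e : ∑ j, (Fin.tail T j).cobrackets = ∑ j : Fin _, (T j.succ).cobrackets := rfl
    rw [e] at ih
    rw [Fin.sum_univ_succ, rowBundle, ← h.1]
    generalize ∑ j : Fin _, (T j.succ).cobrackets = s at ih ⊢
    cases hT : T 0 <;>
      simp [hT, Tile.hasRight, Tile.hasLeft, Tile.leftBundle, Tile.cobrackets] at ih ⊢ <;> omega

theorem GridFits.toNat_eq : {p : ℕ} → {L : Fin p → Fin q → Tile n m} → {Y : Fin q → Bool} →
    GridFits L Y → ∀ j, (Y j).toNat = (gridBottom L Y j).toNat + ∑ i, (L i j).cobrackets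
  | 0, _, _, _, _ => by simp [gridBottom]
  | _ + 1, L, Y, h, j => by
    have ih := h.2.toNat_eq j
    rw [Fin.sum_univ_succ, gridBottom, ← h.1.hasTop_eq j, Tile.hasTop_eq, ih]
    simp only [Fin.tail]
    omega

end Fits

section Telescope

/-- Consecutive edge weights add up. -/
theorem telescope : {q : ℕ} → (f g d : Fin q → ℕ) → (∀ j, f j = g j + d j) →
    (∀ j j' : Fin q, (j' : ℕ) = j + 1 → g j = f j') →
    (if h : 0 < q then f ⟨0, h⟩ else 1) =
      (if h : 0 < q then g ⟨q - 1, Nat.sub_one_lt_of_lt h⟩ else 1) + ∑ j, d j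
  -- Both default values are 1, matching the convention that a grid without columns or rows is a
  -- bundle of parallel single strings.
  | 0, _, _, _, _, _ => by simp
  | 1, f, g, d, h, _ => by simp [h]
  | q + 2, f, g, d, h, h' => by
    have ih := telescope (Fin.tail f) (Fin.tail g) (Fin.tail d) (fun j => h _)
      (fun j j' hj => h' _ _ (by simp [hj]))
    rw [dif_pos (Nat.succ_pos _), dif_pos (Nat.succ_pos _)] at ih ⊢
    have h0 : f ⟨0, Nat.succ_pos _⟩ = g 0 + d 0 := h 0
    have h1 : g 0 = Fin.tail f ⟨0, Nat.succ_pos _⟩ := h' 0 1 rfl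
    have h2 : Fin.tail g ⟨q + 1 - 1, Nat.sub_one_lt_of_lt (Nat.succ_pos _)⟩ =
      g ⟨q + 2 - 1, Nat.sub_one_lt_of_lt (Nat.succ_pos _)⟩ := rfl
    have h3 : ∑ j, Fin.tail d j = ∑ j : Fin (q + 1), d j.succ := rfl
    rw [h0, h1, ih, h2, h3, Fin.sum_univ_succ d]
    omega

/-- Edge weights are determined by the last one. -/
theorem eq_of_last_eq {q : ℕ} (f g f' g' d : Fin q → ℕ) (h : ∀ j, f j = g j + d j)
    (h' : ∀ j, f' j = g' j + d j) (hg : ∀ j j' : Fin q, (j' : ℕ) = j + 1 → g j = f j')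
    (hg' : ∀ j j' : Fin q, (j' : ℕ) = j + 1 → g' j = f' j')
    (hl : ∀ j : Fin q, (j : ℕ) + 1 = q → g j = g' j) : ∀ j, g j = g' j := by
  -- Downward induction; `k` is the distance from the last position.
  have key : ∀ (k : ℕ) (j : Fin q), (j : ℕ) + k + 1 = q → g j = g' j := by
    intro k
    induction k with
    | zero => exact fun j hj => hl j hj
    | succ k ih =>
      intro j hj
      have e := ih ⟨j + 1, by omega⟩ (by simp only; omega)
      rw [hg j ⟨j + 1, by omega⟩ rfl, hg' j ⟨j + 1, by omega⟩ rfl, h, h', e]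
  exact fun j => key (q - 1 - j) j (by omega)

/-- Once there is no string on an edge there is none on any later edge, and events recorded by `d`
need an incoming string. -/
theorem sum_lt_eq_zero {q : ℕ} (f g : Fin q → Bool) (d : Fin q → ℕ)
    (hg : ∀ j j' : Fin q, (j' : ℕ) = j + 1 → g j = f j') (hfg : ∀ j, f j = false → g j = false)
    (hd : ∀ j, f j = false → d j = 0) (j : Fin q) (hj : g j = false) :
    ∑ j', (if j < j' then d j' else 0) = 0 := by
  have key : ∀ (k : ℕ) (j' : Fin q), (j' : ℕ) = j + k + 1 → f j' = false := by
    intro k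
    induction k with
    | zero => exact fun j' h => (hg j j' h).symm.trans hj
    | succ k ih =>
      intro j' h
      have e := ih ⟨j + k + 1, by omega⟩ rfl
      exact (hg ⟨j + k + 1, by omega⟩ j' h).symm.trans (hfg _ e)
  refine Finset.sum_eq_zero fun j' _ => ?_
  split
  · next h => exact hd _ (key (j' - j - 1) j' (by have := Fin.lt_def.1 h; omega))
  · rfl

theorem sum_lt_succ {q : ℕ} (d : Fin q → ℕ) (j j' : Fin q) (h : (j' : ℕ) = j + 1) :
    ∑ i, (if j < i then d i else 0) = ∑ i, (if j' < i then d i else 0) + d j' := by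
  rw [← Finset.sum_ite_eq' Finset.univ j' d |>.trans (if_pos (Finset.mem_univ _)),
    ← Finset.sum_add_distrib]
  refine Finset.sum_congr rfl fun i _ => ?_
  simp only [Fin.lt_def, Fin.ext_iff]
  split_ifs <;> omega

theorem sum_lt_last {q : ℕ} (d : Fin q → ℕ) (j : Fin q) (h : (j : ℕ) + 1 = q) :
    ∑ i, (if j < i then d i else 0) = 0 :=
  Finset.sum_eq_zero fun i _ => if_neg (by rw [Fin.lt_def]; omega)

theorem sum_lt_lt {q : ℕ} (d : Fin q → ℕ) (hd : ∀ j, d j ≤ 1) (j : Fin q) :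
    ∑ i, (if j < i then d i else 0) < q := by
  have h : ∑ i, (if j < i then d i else 0) < ∑ _i : Fin q, 1 := by
    refine Finset.sum_lt_sum (fun i _ => ?_) ⟨j, Finset.mem_univ _, by simp⟩
    split
    · exact hd _
    · omega
  simpa using h

end Telescope

/-! ### Looms correspond to consistent tilings by shapes. -/

section Skeleton

variable {n m : ℕ}

/-- The shapes of the tiles of a tiling. -/
def skeleton (L : Fin n → Fin m → Tile n m) (i : Fin n) (j : Fin m) : Tile 1 1 := (L i j).unit

theorem rowEnd_skeleton (L : Fin n → Fin m → Tile n m) (i : Fin n) (a : Bool) :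
    rowEnd (skeleton L i) a = rowEnd (L i) a := by
  rw [rowEnd_eq, rowEnd_eq]
  simp only [skeleton, Tile.unit_hasRight]

theorem gridBottom_skeleton (L : Fin n → Fin m → Tile n m) (Y : Fin m → Bool) (j : Fin m) :
    gridBottom (skeleton L) Y j = gridBottom L Y j := by
  rw [gridBottom_eq, gridBottom_eq]
  simp only [skeleton, Tile.unit_hasBottom]

theorem gridFits_skeleton (L : Fin n → Fin m → Tile n m) (Y : Fin m → Bool) :
    GridFits (skeleton L) Y ↔ GridFits L Y := by
  rw [gridFits_iff, gridFits_iff]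
  simp only [skeleton, Tile.unit_hasBottom, Tile.unit_hasRight, Tile.unit_hasLeft,
    Tile.unit_hasTop]

theorem leftWeight_eq {L : Fin n → Fin m → Tile n m}
    (h : ∀ (i : Fin n) (j j' : Fin m), (j' : ℕ) = j + 1 → (L i j).right = (L i j').left)
    (i : Fin n) : leftWeight L i =
      rightWeight L i + ∑ j, ((L i j).brackets + (L i j).cobrackets) :=
  telescope (fun j => (L i j).left) (fun j => (L i j).right) _ (fun j => (L i j).left_eq) (h i)

theorem topWeight_eq {L : Fin n → Fin m → Tile n m}
    (h : ∀ (i i' : Fin n) (j : Fin m), (i' : ℕ) = i + 1 → (L i j).bottom = (L i' j).top)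
    (j : Fin m) : topWeight L j =
      bottomWeight L j + ∑ i, ((L i j).brackets + (L i j).cobrackets) :=
  telescope (fun i => (L i j).top) (fun i => (L i j).bottom) _ (fun i => (L i j).top_eq)
    (fun i i' => h i i' j)

theorem rowEnd_le (L : Fin n → Fin m → Tile n m) (i : Fin n) :
    (rowEnd (L i) true).toNat ≤ rightWeight L i := by
  rw [rowEnd_eq, rightWeight]
  split
  · exact Tile.hasRight_le _
  · rfl

theorem gridBottom_le (L : Fin n → Fin m → Tile n m) (j : Fin m) :
    (gridBottom L (fun _ => true) j).toNat ≤ bottomWeight L j := by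
  rw [gridBottom_eq, bottomWeight]
  split
  · exact Tile.hasBottom_le _
  · rfl

/-- The number of strings which enter a tiling. -/
theorem sum_leftWeight_add {L : Fin n → Fin m → Tile n m}
    (hL : ∀ (i : Fin n) (j j' : Fin m), (j' : ℕ) = j + 1 → (L i j).right = (L i j').left)
    (h : GridFits L fun _ => true) :
    ∑ i, leftWeight L i + ∑ j, bottomWeight L j +
      (∑ i, (rowEnd (L i) true).toNat + ∑ j, (gridBottom L (fun _ => true) j).toNat) =
      ∑ i, rightWeight L i + ∑ j, bottomWeight L j + (n + m) := by
  have h1 : ∑ i, leftWeight L i = ∑ i, rightWeight L i +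
      (∑ i, ∑ j, (L i j).brackets + ∑ i, ∑ j, (L i j).cobrackets) := by
    simp only [leftWeight_eq hL, Finset.sum_add_distrib]
  -- Every one of the `n` row strings either survives to the right end or meets one bracket. The
  -- next equation says the same of columns and cobrackets.
  have h2 : n = ∑ i, (rowEnd (L i) true).toNat + ∑ i, ∑ j, (L i j).brackets := by
    rw [← Finset.sum_add_distrib]
    refine Eq.trans ?_ (Finset.sum_congr rfl fun i _ => (h.rowFits i).choose_spec.toNat_eq)
    simp
  have h3 : m = ∑ j, (gridBottom L (fun _ => true) j).toNat +
      ∑ j, ∑ i, (L i j).cobrackets := by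
    rw [← Finset.sum_add_distrib]
    refine Eq.trans ?_ (Finset.sum_congr rfl fun j _ => h.toNat_eq j)
    simp
  rw [Finset.sum_comm] at h3
  omega

theorem IsLoom.gridFits {L : Fin n → Fin m → Tile n m} (h : IsLoom L) :
    GridFits L fun _ => true := by
  rw [gridFits_iff]
  refine ⟨fun i j hj => ?_, fun i j j' hj => ?_, fun i hi j => ?_, fun i i' hi j => ?_⟩
  · obtain ⟨h1, h2⟩ := h.first_column i j hj
    cases hT : L i j <;> first | rfl | simp [hT] at h1 h2
  · rw [Tile.hasRight_eq_decide, Tile.hasLeft_eq_decide, h.right_eq_left i j j' hj]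
  · obtain ⟨h1, h2⟩ := h.first_row i j hi
    cases hT : L i j <;> first | rfl | simp [hT] at h1 h2
  · rw [Tile.hasBottom_eq_decide, Tile.hasTop_eq_decide, h.bottom_eq_top i i' j hi]

theorem eq_of_sum_add_eq {ι κ : Type*} [Fintype ι] [Fintype κ] {f g : ι → ℕ} {f' g' : κ → ℕ}
    (h : ∀ i, f i ≤ g i) (h' : ∀ i, f' i ≤ g' i)
    (e : ∑ i, f i + ∑ i, f' i = ∑ i, g i + ∑ i, g' i) :
    (∀ i, f i = g i) ∧ ∀ i, f' i = g' i := by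
  have h1 := Finset.sum_le_sum fun i (_ : i ∈ Finset.univ) => h i
  have h2 := Finset.sum_le_sum fun i (_ : i ∈ Finset.univ) => h' i
  exact ⟨fun i => (Finset.sum_eq_sum_iff_of_le fun i _ => h i).1 (by omega) i (Finset.mem_univ _),
    fun i => (Finset.sum_eq_sum_iff_of_le fun i _ => h' i).1 (by omega) i (Finset.mem_univ _)⟩

/-- By `sum_leftWeight_add`, having exactly `n + m` ingoing strings means that the total weight of
the right and bottom ends equals the number of ends carrying strings. Each such end has weight at
least one, so every inequality is an equality. -/
theorem IsLoom.ends {L : Fin n → Fin m → Tile n m} (h : IsLoom L) :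
    (∀ i, (rowEnd (L i) true).toNat = rightWeight L i) ∧
      ∀ j, (gridBottom L (fun _ => true) j).toNat = bottomWeight L j := by
  refine eq_of_sum_add_eq (rowEnd_le L) (gridBottom_le L) ?_
  have h1 := sum_leftWeight_add h.right_eq_left h.gridFits
  have h2 := h.ingoing
  omega

theorem IsLoom.length_rowBundle {L : Fin n → Fin m → Tile n m} (h : IsLoom L) (i : Fin n) (x : ℕ)
    (y : Fin m → ℕ) : (rowBundle (L i) x y).length = leftWeight L i := by
  obtain ⟨Y, hY⟩ := h.gridFits.rowFits i
  have h1 := hY.length_rowBundle x y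
  have h2 := hY.toNat_eq
  rw [if_pos rfl] at h1
  rw [h1, leftWeight_eq h.right_eq_left, ← h.ends.1 i, h2, Finset.sum_add_distrib, add_assoc]

/-- The shapes fix the weights at the right and bottom ends by `IsLoom.ends`, and also all
differences between consecutive edges, which count brackets and cobrackets. All multiplicities are
therefore determined. -/
theorem skeleton_injective {L L' : Fin n → Fin m → Tile n m} (h : IsLoom L) (h' : IsLoom L')
    (e : skeleton L = skeleton L') : L = L' := by
  have e' : ∀ i j, (L i j).unit = (L' i j).unit := fun i j => congrFun (congrFun e i) j
  have hb : ∀ i j, (L i j).brackets = (L' i j).brackets := fun i j => by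
    rw [← Tile.unit_brackets, e', Tile.unit_brackets]
  have hc : ∀ i j, (L i j).cobrackets = (L' i j).cobrackets := fun i j => by
    rw [← Tile.unit_cobrackets, e', Tile.unit_cobrackets]
  funext i j
  refine Tile.eq_of_unit (e' i j) ?_ ?_
  · refine eq_of_last_eq _ _ (fun j => (L' i j).left) _ _ (fun j => (L i j).left_eq)
      (fun j => by rw [hb, hc]; exact (L' i j).left_eq) (h.right_eq_left i)
      (h'.right_eq_left i) (fun j hj => ?_) j
    have h1 := h.ends.1 i
    have h2 := h'.ends.1 i
    rw [← rowEnd_skeleton, e, rowEnd_skeleton, h2] at h1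
    have hj' : j = ⟨m - 1, Nat.sub_one_lt_of_lt j.pos⟩ := Fin.ext (by simp only; omega)
    rw [rightWeight, rightWeight, dif_pos j.pos, dif_pos j.pos, ← hj'] at h1
    exact h1.symm
  · refine eq_of_last_eq (fun i => (L i j).top) (fun i => (L i j).bottom)
      (fun i => (L' i j).top) (fun i => (L' i j).bottom) _ (fun i => (L i j).top_eq)
      (fun i => by rw [hb, hc]; exact (L' i j).top_eq) (fun i i' => h.bottom_eq_top i i' j)
      (fun i i' => h'.bottom_eq_top i i' j) (fun i hi => ?_) i
    have h1 := h.ends.2 j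
    have h2 := h'.ends.2 j
    rw [← gridBottom_skeleton, e, gridBottom_skeleton, h2] at h1
    have hi' : i = ⟨n - 1, Nat.sub_one_lt_of_lt i.pos⟩ := Fin.ext (by simp only; omega)
    rw [bottomWeight, bottomWeight, dif_pos i.pos, dif_pos i.pos, ← hi'] at h1
    exact h1.symm

theorem brackets_le_one (t : Tile n m) : t.brackets ≤ 1 := by cases t <;> simp [Tile.brackets]

theorem cobrackets_le_one (t : Tile n m) : t.cobrackets ≤ 1 := by
  cases t <;> simp [Tile.cobrackets]

/-- The tiling with prescribed shapes of the tiles and with the smallest numbers of strings. -/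
def fillSkeleton (S : Fin n → Fin m → Tile 1 1) (i : Fin n) (j : Fin m) : Tile n m :=
  (S i j).fill
    ⟨∑ j', (if j < j' then (S i j').cobrackets else 0),
      sum_lt_lt _ (fun _ => cobrackets_le_one _) j⟩
    ⟨∑ i', (if i < i' then (S i' j).brackets else 0),
      sum_lt_lt _ (fun _ => brackets_le_one _) i⟩

theorem skeleton_fillSkeleton (S : Fin n → Fin m → Tile 1 1) : skeleton (fillSkeleton S) = S :=
  funext fun _ => funext fun _ => Tile.unit_fill _ _ _

theorem fill_right (k : Fin m) (l : Fin n) (t : Tile 1 1) :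
    (t.fill k l).right = if t.hasRight then (k : ℕ) + 1 else 0 := by cases t <;> rfl

theorem fill_bottom (k : Fin m) (l : Fin n) (t : Tile 1 1) :
    (t.fill k l).bottom = if t.hasBottom then (l : ℕ) + 1 else 0 := by cases t <;> rfl

theorem fill_left (k : Fin m) (l : Fin n) (t : Tile 1 1) (h : t.hasRight = false → (k : ℕ) = 0) :
    (t.fill k l).left = if t.hasLeft then (k : ℕ) + t.cobrackets + 1 else 0 := by
  cases t <;> simp [Tile.fill, Tile.left, Tile.hasLeft, Tile.cobrackets, Tile.hasRight] at h ⊢ <;>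
    exact h

theorem fill_top (k : Fin m) (l : Fin n) (t : Tile 1 1)
    (h : t.hasBottom = false → (l : ℕ) = 0) :
    (t.fill k l).top = if t.hasTop then (l : ℕ) + t.brackets + 1 else 0 := by
  cases t <;> simp [Tile.fill, Tile.top, Tile.hasTop, Tile.brackets, Tile.hasBottom] at h ⊢ <;>
    exact h

/-- Starting from single strings at the live right and bottom ends, a horizontal bundle gains one
string for each cobracket to its right, and a vertical bundle one for each bracket below. With these
multiplicities the edges match and the boundary count is `n + m`. -/
theorem isLoom_fillSkeleton {S : Fin n → Fin m → Tile 1 1} (h : GridFits S fun _ => true) :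
    IsLoom (fillSkeleton S) := by
  have hfit : GridFits (fillSkeleton S) fun _ => true := by
    rw [← gridFits_skeleton, skeleton_fillSkeleton]
    exact h
  obtain ⟨h1, h2, h3, h4⟩ := (gridFits_iff _ _).1 h
  -- Needed for brackets and other tiles with empty right edge: no cobracket follows, so the
  -- prescribed extra multiplicity is zero, in agreement with the left edge of such a tile.
  have hR : ∀ i j, (S i j).hasRight = false →
      ∑ j', (if j < j' then (S i j').cobrackets else 0) = 0 := fun i j =>
    sum_lt_eq_zero (fun j => (S i j).hasLeft) (fun j => (S i j).hasRight) _ (h2 i)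
      (fun j => by cases S i j <;> simp [Tile.hasLeft, Tile.hasRight])
      (fun j => by cases S i j <;> simp [Tile.hasLeft, Tile.cobrackets]) j
  have hB : ∀ i j, (S i j).hasBottom = false →
      ∑ i', (if i < i' then (S i' j).brackets else 0) = 0 := fun i j =>
    sum_lt_eq_zero (fun i => (S i j).hasTop) (fun i => (S i j).hasBottom) _
      (fun i i' hi => h4 i i' hi j)
      (fun i => by cases S i j <;> simp [Tile.hasTop, Tile.hasBottom])
      (fun i => by cases S i j <;> simp [Tile.hasTop, Tile.brackets]) i
  have hrl : ∀ (i : Fin n) (j j' : Fin m), (j' : ℕ) = j + 1 →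
      (fillSkeleton S i j).right = (fillSkeleton S i j').left := by
    intro i j j' hj
    rw [fillSkeleton, fillSkeleton, fill_right, fill_left _ _ _ (hR i j'), h2 i j j' hj]
    dsimp only
    rw [sum_lt_succ _ j j' hj]
  have hbt : ∀ (i i' : Fin n) (j : Fin m), (i' : ℕ) = i + 1 →
      (fillSkeleton S i j).bottom = (fillSkeleton S i' j).top := by
    intro i i' j hi
    rw [fillSkeleton, fillSkeleton, fill_bottom, fill_top _ _ _ (hB i' j), h4 i i' hi j]
    dsimp only
    rw [sum_lt_succ _ i i' hi]
  have hr : ∀ i, rightWeight (fillSkeleton S) i = (rowEnd (fillSkeleton S i) true).toNat := by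
    intro i
    rw [← rowEnd_skeleton, skeleton_fillSkeleton, rowEnd_eq, rightWeight]
    split
    · next hm =>
      rw [fillSkeleton, fill_right]
      dsimp only
      rw [sum_lt_last _ _ (Nat.sub_add_cancel hm)]
      cases (S i _).hasRight <;> rfl
    · rfl
  have hb : ∀ j, bottomWeight (fillSkeleton S) j =
      (gridBottom (fillSkeleton S) (fun _ => true) j).toNat := by
    intro j
    rw [← gridBottom_skeleton, skeleton_fillSkeleton, gridBottom_eq, bottomWeight]
    split
    · next hn =>
      rw [fillSkeleton, fill_bottom]
      dsimp only
      rw [sum_lt_last _ _ (Nat.sub_add_cancel hn)]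
      cases (S _ j).hasBottom <;> rfl
    · rfl
  have hin : ∑ i, leftWeight (fillSkeleton S) i + ∑ j, bottomWeight (fillSkeleton S) j =
      n + m := by
    have e := sum_leftWeight_add hrl hfit
    have e1 : ∑ i, rightWeight (fillSkeleton S) i =
      ∑ i, (rowEnd (fillSkeleton S i) true).toNat := Finset.sum_congr rfl fun i _ => hr i
    have e2 : ∑ j, bottomWeight (fillSkeleton S) j =
      ∑ j, (gridBottom (fillSkeleton S) (fun _ => true) j).toNat :=
      Finset.sum_congr rfl fun j _ => hb j
    omega
  obtain ⟨h1', h2', h3', h4'⟩ := (gridFits_iff _ _).1 hfit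
  refine ⟨hbt, hrl, hin, ?_, fun i j hi => ?_, fun i j hj => ?_⟩
  -- Left weights exceed right weights by the total number of brackets and cobrackets, and top
  -- weights exceed bottom weights by the same total. The outgoing count therefore equals the
  -- ingoing one.
  · have e1 : ∑ i, leftWeight (fillSkeleton S) i = ∑ i, rightWeight (fillSkeleton S) i +
        ∑ i, ∑ j, ((fillSkeleton S i j).brackets + (fillSkeleton S i j).cobrackets) := by
      simp only [leftWeight_eq hrl, Finset.sum_add_distrib]
    have e2 : ∑ j, topWeight (fillSkeleton S) j = ∑ j, bottomWeight (fillSkeleton S) j +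
        ∑ j, ∑ i, ((fillSkeleton S i j).brackets + (fillSkeleton S i j).cobrackets) := by
      simp only [topWeight_eq hbt, Finset.sum_add_distrib]
    rw [Finset.sum_comm] at e2
    omega
  · have := h3' i hi j
    constructor
    · intro k hk
      rw [hk] at this
      cases this
    · intro hk
      rw [hk] at this
      cases this
  · have := h1' i j hj
    constructor
    · intro k hk
      rw [hk] at this
      cases this
    · intro hk
      rw [hk] at this
      cases this

end Skeleton

/-! ### Relabelling strings and reading off consecutive bundles. -/

section Labels

variable {n m : ℕ}

theorem rowPass_unit : {q : ℕ} → (T : Fin q → Tile n m) → (l : List ℕ) → (b : Fin q → List ℕ) →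
    rowPass (fun j => (T j).unit) l b = rowPass T l b
  | 0, _, _, _ => rfl
  | q + 1, T, l, b => by
    have ih := rowPass_unit (Fin.tail T) ((T 0).pass l (b 0)).2 (Fin.tail b)
    rw [rowPass, rowPass, Tile.unit_pass, ← ih]
    rfl

theorem gridPass_unit {q : ℕ} : {p : ℕ} → (L : Fin p → Fin q → Tile n m) →
    (l : Fin p → List ℕ) → (b : Fin q → List ℕ) →
    gridPass (fun i j => (L i j).unit) l b = gridPass L l b
  | 0, _, _, _ => rfl
  | p + 1, L, l, b => by
    have ih := gridPass_unit (Fin.tail L) (Fin.tail l) b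
    have hr := rowPass_unit (L 0) (l 0) (gridPass (Fin.tail L) (Fin.tail l) b).1
    rw [gridPass, gridPass, ← hr, ← ih]
    rfl

theorem rowPass_map (f : ℕ → ℕ) : {q : ℕ} → (T : Fin q → Tile n m) → (l : List ℕ) →
    (b : Fin q → List ℕ) → rowPass T (l.map f) (fun j => (b j).map f) =
      (fun j => ((rowPass T l b).1 j).map f, (rowPass T l b).2.map f)
  | 0, _, _, _ => rfl
  | q + 1, T, l, b => by
    have ih := rowPass_map f (Fin.tail T) ((T 0).pass l (b 0)).2 (Fin.tail b)
    have e : (Fin.tail fun j => (b j).map f) = fun j => (Fin.tail b j).map f := rfl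
    rw [rowPass, rowPass, Tile.pass_map, e, ih]
    exact congrArg₂ Prod.mk (funext fun j => Fin.cases rfl (fun _ => rfl) j) rfl

/-- Tiles only rearrange lists, so tracing strings commutes with relabelling. This compares the
numbering of the ingoing strings with the labels of chords. -/
theorem gridPass_map (f : ℕ → ℕ) {q : ℕ} : {p : ℕ} → (L : Fin p → Fin q → Tile n m) →
    (l : Fin p → List ℕ) → (b : Fin q → List ℕ) →
    gridPass L (fun i => (l i).map f) (fun j => (b j).map f) =
      (fun j => ((gridPass L l b).1 j).map f, fun i => ((gridPass L l b).2 i).map f)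
  | 0, _, _, _ => congrArg₂ Prod.mk rfl (Subsingleton.elim _ _)
  | p + 1, L, l, b => by
    have ih := gridPass_map f (Fin.tail L) (Fin.tail l) b
    have e : (Fin.tail fun j => (l j).map f) = fun j => (Fin.tail l j).map f := rfl
    rw [gridPass, gridPass, e, ih, rowPass_map]
    exact congrArg₂ Prod.mk rfl (funext fun j => Fin.cases rfl (fun _ => rfl) j)

theorem concat_map (f : ℕ → ℕ) : {q : ℕ} → (g : Fin q → List ℕ) →
    (concat g).map f = concat fun j => (g j).map f
  | 0, _ => rfl
  | q + 1, g => by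
    rw [concat_succ, concat_succ, List.map_append, concat_map f]
    rfl

theorem concat_flatMap {q : ℕ} (y : Fin q → ℕ) (s : ℕ → List ℕ) :
    (List.ofFn y).flatMap s = concat fun j => s (y j) := by
  rw [concat, List.flatMap_def, List.map_ofFn]
  rfl

theorem length_concat : {q : ℕ} → (g : Fin q → List ℕ) → (concat g).length = ∑ j, (g j).length
  | 0, _ => rfl
  | q + 1, g => by
    rw [concat_succ, List.length_append, length_concat, Fin.sum_univ_succ]
    rfl

theorem concat_singleton {q : ℕ} (y : Fin q → ℕ) : concat (fun j => [y j]) = List.ofFn y := by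
  rw [← concat_flatMap y fun z => [z], flatMap_eq_self fun _ _ => rfl]

/-- Reading off the labels of consecutive bundles of strings. -/
theorem map_chunks : {q : ℕ} → (g : Fin q → List ℕ) → (pre post : List ℕ) → (w : Fin q → ℕ) →
    (∀ j, w j = (g j).length) → (j : Fin q) →
    (chunks w pre.length j).map (fun k => (pre ++ (concat g ++ post)).getD k 0) = g j
  | 0, _, _, _, _, _, j => j.elim0
  | q + 1, g, pre, post, w, hw, j => by
    refine Fin.cases ?_ (fun j => ?_) j
    · rw [chunks, Fin.cons_zero, concat_succ, hw 0]
      refine List.ext_getElem (by simp) fun i h1 h2 => ?_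
      simp only [List.getElem_map, List.getElem_range', one_mul]
      rw [List.getD_append_right _ _ _ _ (Nat.le_add_right _ _), Nat.add_sub_cancel_left,
        List.append_assoc, List.getD_append _ _ _ _ h2, List.getD_eq_getElem _ _ h2]
    · have ih := map_chunks (Fin.tail g) (pre ++ g 0) post (Fin.tail w) (fun j => hw j.succ) j
      rw [List.length_append, ← hw 0] at ih
      rw [chunks, Fin.cons_succ, concat_succ]
      rw [List.append_assoc, ← List.append_assoc (g 0)] at ih
      exact ih

end Labels

/-! ### The product formula. -/

section Product

variable {K : Type u} [Field K] {n m : ℕ}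

/-- The label of a row. -/
def rowLabel (i : Fin n) : ℕ := i

/-- The label of a column. -/
def columnLabel (n : ℕ) (j : Fin m) : ℕ := n + j

theorem rowLabel_injective : Function.Injective (rowLabel (n := n)) := fun _ _ h => Fin.ext h

theorem columnLabel_injective : Function.Injective (columnLabel (m := m) n) :=
  fun _ _ h => Fin.ext (Nat.add_left_cancel h)

theorem columnLabel_ne (i : Fin n) (j : Fin m) : columnLabel n j ≠ rowLabel i := by
  have := i.2
  rw [columnLabel, rowLabel]
  omega

/-- The chord word of the product of `r σ` and `r τ`. -/
def productWord (σ : Equiv.Perm (Fin n)) (τ : Equiv.Perm (Fin m)) : List (Letter ℕ) :=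
  normalWord (List.ofFn fun p => rowLabel (σ p)) (List.ofFn (rowLabel (n := n))) ++
    normalWord (List.ofFn (columnLabel (m := m) n)) (List.ofFn fun q => columnLabel n (τ.symm q))

theorem mor_productWord (σ : Equiv.Perm (Fin n)) (τ : Equiv.Perm (Fin m)) :
    Mor K (productWord σ τ) [] [] (Hom.comp (r K σ) (r K τ)) := by
  refine Mor.append (mor_normalWord σ _ _ (by simp) (by simp) fun p => ?_)
    (mor_normalWord τ _ _ (by simp) (by simp) fun p => ?_)
  · simp
  · simp

theorem nodup_append_ofFn {f : Fin n → ℕ} {g : Fin m → ℕ} (hf : Function.Injective f)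
    (hg : Function.Injective g) (h : ∀ i j, f i ≠ g j) :
    (List.ofFn f ++ List.ofFn g).Nodup := by
  refine List.Nodup.append (List.nodup_ofFn.2 hf) (List.nodup_ofFn.2 hg) ?_
  intro z h1 h2
  obtain ⟨i, rfl⟩ := List.mem_ofFn.1 h1
  obtain ⟨j, hj⟩ := List.mem_ofFn.1 h2
  exact h i j hj.symm

theorem productWord_nodup (σ : Equiv.Perm (Fin n)) (τ : Equiv.Perm (Fin m)) :
    (productWord σ τ).Nodup := by
  have h1 : (List.ofFn (fun p => rowLabel (σ p)) ++ List.ofFn (columnLabel (m := m) n)).Nodup :=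
    nodup_append_ofFn (rowLabel_injective.comp σ.injective) columnLabel_injective
      fun i j => (columnLabel_ne _ _).symm
  have h2 : (List.ofFn (rowLabel (n := n)) ++
      List.ofFn fun q => columnLabel n (τ.symm q)).Nodup :=
    nodup_append_ofFn rowLabel_injective (columnLabel_injective.comp τ.symm.injective)
      fun i j => (columnLabel_ne _ _).symm
  have h3 : ∀ c a : List ℕ, c.Nodup → a.Nodup →
      (c.map Letter.coact ++ a.map Letter.act).Nodup := by
    intro c a hc ha
    refine List.Nodup.append (hc.map fun _ _ h => by cases h; rfl)
      (ha.map fun _ _ h => by cases h; rfl) ?_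
    intro z h1 h2
    obtain ⟨x, -, rfl⟩ := List.mem_map.1 h1
    obtain ⟨y, -, hy⟩ := List.mem_map.1 h2
    cases hy
  refine (List.Perm.nodup_iff ?_).1 (h3 _ _ h1 h2)
  classical
  rw [List.perm_iff_count]
  intro z
  simp only [productWord, normalWord, List.map_append, List.count_append, List.count_reverse]
  omega

theorem concat_activeLabels_true {q : ℕ} (y : Fin q → ℕ) :
    concat (activeLabels y fun _ => true) = List.ofFn y := by
  rw [← concat_singleton]
  rfl

/-- Rows are labelled by the order of the actions of the first factor and columns by the order of
the coactions of the second. Thus `σ` enters only through the outer coactions and `τ` only through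
the outer actions, just as they are glued to the left and top edges of a loom. -/
theorem productWord_eq (σ : Equiv.Perm (Fin n)) (τ : Equiv.Perm (Fin m)) :
    productWord σ τ = framedWord (List.ofFn fun p => rowLabel (σ p))
      (((List.ofFn (rowLabel (n := n))).map .act).reverse ++
        ((concat (activeLabels (columnLabel (m := m) n) fun _ => true)).map .coact ++ []))
      (List.ofFn fun q => columnLabel n (τ.symm q)) := by
  rw [concat_activeLabels_true]
  simp only [productWord, normalWord, framedWord, List.append_assoc, List.append_nil]

open Classical in
theorem isChordWord_and_comp_eq (σ : Equiv.Perm (Fin n)) (τ : Equiv.Perm (Fin m)) :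
    (∀ S : Fin n → Fin m → Tile 1 1, (GridFits S fun _ => true) →
      IsChordWord K (gridWord S rowLabel (columnLabel n) (fun _ => true)
        (List.ofFn fun p => rowLabel (σ p)) [] (List.ofFn fun q => columnLabel n (τ.symm q)))) ∧
    (Hom.comp (r K σ) (r K τ) : Hom K [.mod] [.mod]) =
      ∑ S : Fin n → Fin m → Tile 1 1, if GridFits S fun _ => true then
        gridSign S • eval K (gridWord S rowLabel (columnLabel n) (fun _ => true)
          (List.ofFn fun p => rowLabel (σ p)) [] (List.ofFn fun q => columnLabel n (τ.symm q)))
      else 0 := by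
  have hm := mor_productWord (K := K) σ τ
  have hn := productWord_nodup σ τ
  have he := hm.eval_eq (coacts_nodup hn)
  have hc : IsChordWord K (productWord σ τ) := ⟨hn, _, hm⟩
  rw [productWord_eq] at he hc
  have h := eval_grid rowLabel (columnLabel n) (fun _ => true)
    (List.ofFn fun p => rowLabel (σ p)) (List.ofFn fun q => columnLabel n (τ.symm q)) []
    rowLabel_injective columnLabel_injective columnLabel_ne
    (fun i => List.mem_ofFn.2 ⟨σ.symm i, by simp⟩)
    (fun j _ => List.mem_ofFn.2 ⟨τ j, by simp⟩) hc
  exact ⟨h.1, he.symm.trans h.2⟩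

theorem getElem?_gamma (σ : Equiv.Perm (Fin n)) (L : Loom n m) (τ : Equiv.Perm (Fin m))
    (p : Fin (n + m)) : (outgoingList σ L.1 τ)[(gamma σ L τ p : ℕ)]? = some (p : ℕ) := by
  have h : (outgoingList σ L.1 τ).Perm (List.range (n + m)) :=
    L.2.ingoing ▸ outgoingList_perm σ L.1 τ
  have hlen : (outgoingList σ L.1 τ).length = n + m := by simpa using h.length_eq
  -- By construction the inverse of `gamma` reads the list of outgoing numbers.
  have h1 : ∀ q : Fin (n + m), (((gamma σ L τ).symm q : Fin (n + m)) : ℕ) =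
      (outgoingList σ L.1 τ)[(q : ℕ)]'(by rw [hlen]; exact q.2) := fun q => rfl
  have h2 := h1 (gamma σ L τ p)
  rw [Equiv.symm_apply_apply] at h2
  rw [List.getElem?_eq_getElem (by rw [hlen]; exact Fin.is_lt _), ← h2]

theorem outgoingList_length (σ : Equiv.Perm (Fin n)) (L : Loom n m) (τ : Equiv.Perm (Fin m)) :
    (outgoingList σ L.1 τ).length = n + m := by
  rw [(outgoingList_perm σ L.1 τ).length_eq, List.length_range, L.2.ingoing]

/-- The chord word of a loom evaluates to the element of its permutation. -/
theorem eval_gridWord_skeleton (σ : Equiv.Perm (Fin n)) (L : Loom n m) (τ : Equiv.Perm (Fin m))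
    (hW : IsChordWord K (gridWord (skeleton L.1) rowLabel (columnLabel n) (fun _ => true)
      (List.ofFn fun p => rowLabel (σ p)) [] (List.ofFn fun q => columnLabel n (τ.symm q)))) :
    eval K (gridWord (skeleton L.1) rowLabel (columnLabel n) (fun _ => true)
      (List.ofFn fun p => rowLabel (σ p)) [] (List.ofFn fun q => columnLabel n (τ.symm q))) =
      r K (gamma σ L τ) := by
  set S := skeleton L.1 with hS
  have hfit : GridFits S fun _ => true := (gridFits_skeleton _ _).2 L.2.gridFits
  set y : Fin m → ℕ := columnLabel n with hy
  set G : Fin n → List ℕ := fun p => rowBundle (S (σ p)) (rowLabel (σ p)) y with hG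
  set B : Fin m → List ℕ := activeLabels y (gridBottom S fun _ => true) with hB
  set A : List ℕ := concat fun q => topSubst S rowLabel y (y (τ.symm q)) with hA
  set R : List ℕ := concat (rightLabels S rowLabel) with hR
  -- The fully expanded word is normal. Its coactions list the left bundles and then the bottom
  -- ones, its actions the top bundles and then the right ones: the order in which the strings of a
  -- loom are numbered.
  have hword : gridWord S rowLabel y (fun _ => true) (List.ofFn fun p => rowLabel (σ p)) []
      (List.ofFn fun q => y (τ.symm q)) = normalWord (concat G ++ concat B) (A ++ R) := by
    rw [gridWord, concat_flatMap, concat_flatMap]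
    simp only [leftSubst_apply _ _ _ rowLabel_injective]
    simp only [framedWord, normalWord, List.map_append, List.reverse_append, List.append_assoc,
      List.append_nil]
    rfl
  have hGlen : ∀ i, leftWeight L.1 (σ i) = (G i).length := by
    intro i
    have h1 := (L.2.gridFits.rowFits (σ i)).choose_spec.length_rowBundle (rowLabel (σ i)) y
    have h2 := (hfit.rowFits (σ i)).choose_spec.length_rowBundle (rowLabel (σ i)) y
    rw [if_pos rfl, L.2.length_rowBundle] at h1
    rw [if_pos rfl] at h2
    rw [hG, h1, h2]
    simp only [hS, skeleton, Tile.unit_cobrackets]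
  have hBlen : ∀ j, bottomWeight L.1 j = (B j).length := by
    intro j
    rw [← L.2.ends.2 j, hB, activeLabels, hS, gridBottom_skeleton]
    cases gridBottom L.1 (fun _ => true) j <;> rfl
  set c := concat G ++ concat B with hc
  have hGsum : ∑ i, leftWeight L.1 i = (concat G).length := by
    rw [length_concat, ← Equiv.sum_comp σ]
    exact Finset.sum_congr rfl fun i _ => hGlen i
  have hclen : c.length = n + m := by
    rw [hc, List.length_append, ← hGsum, length_concat, ← L.2.ingoing]
    exact congrArg _ (Finset.sum_congr rfl fun i _ => (hBlen i).symm)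
  -- `f` converts the number of an ingoing string into the label of its chord; the default value is
  -- not reached for numbers below `n + m`.
  set f : ℕ → ℕ := fun k => c.getD k 0 with hf
  have hl : ∀ i, (chunks (fun p => leftWeight L.1 (σ p)) 0 (σ.symm i)).map f =
      rowBundle (S i) (rowLabel i) y := by
    intro i
    have h := map_chunks G [] (concat B) (fun p => leftWeight L.1 (σ p)) hGlen (σ.symm i)
    simp only [hG, Equiv.apply_symm_apply] at h
    exact h
  have hb : ∀ j, (chunks (bottomWeight L.1) (∑ i, leftWeight L.1 i) j).map f = B j := by
    intro j
    have h := map_chunks B (concat G) [] (bottomWeight L.1) hBlen j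
    rw [List.append_nil, ← hGsum] at h
    exact h
  -- Tracing commutes with `f`, depends only on the shapes of the tiles, and on bundles of labels it
  -- is computed by `gridPass_rowBundle`.
  have hout : (outgoingList σ L.1 τ).map f = A ++ R := by
    have h1 := gridPass_map f L.1
      (fun i => chunks (fun p => leftWeight L.1 (σ p)) 0 (σ.symm i))
      (chunks (bottomWeight L.1) (∑ i, leftWeight L.1 i))
    simp only [hl, hb] at h1
    have h2 := gridPass_rowBundle S rowLabel y (fun _ => true) columnLabel_injective
      columnLabel_ne hfit
    have h3 : gridPass S (fun i => rowBundle (S i) (rowLabel i) y) B =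
      gridPass L.1 (fun i => rowBundle (S i) (rowLabel i) y) B := gridPass_unit L.1 _ _
    have h4 := (h1.symm.trans h3.symm).trans h2
    have h5 := congrArg Prod.fst h4
    have h6 := congrArg Prod.snd h4
    simp only [if_true] at h5 h6
    rw [outgoingList, List.map_append, concat_map, concat_map, hA, hR, ← h6]
    congr 2
    funext q
    exact congrFun h5 (τ.symm q)
  have hlen : (A ++ R).length = n + m := by
    rw [← hout, List.length_map, outgoingList_length]
  have hn : c.Nodup := by
    have := coacts_nodup hW.1
    rw [hword, coacts_normalWord] at this
    exact this
  rw [hword]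
  refine eval_normalWord (gamma σ L τ) c (A ++ R) hclen hlen hn fun p => ?_
  simp only [Fin.getElem?_fin]
  rw [← hout, List.getElem?_map, getElem?_gamma, Option.map_some, hf]
  have hp : (p : ℕ) < c.length := by rw [hclen]; exact p.2
  rw [List.getElem?_eq_getElem hp]
  simp only [List.getD_eq_getElem _ _ hp]

theorem gridSign_skeleton (L : Loom n m) : gridSign (skeleton L.1) = (-1) ^ negCount L := by
  rw [negCount, ← Finset.prod_const, Finset.prod_filter, Fintype.prod_prod_type]
  refine Finset.prod_congr rfl fun i _ => Finset.prod_congr rfl fun j _ => ?_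
  rw [Tile.sign, skeleton, Tile.unit_negative]

noncomputable instance : Fintype (Loom n m) := by
  classical
  exact inferInstanceAs (Fintype {L : Fin n → Fin m → Tile n m // IsLoom L})

theorem posLooms_sub_negLooms [DecidableEq (Equiv.Perm (Fin (n + m)))]
    (σ : Equiv.Perm (Fin n)) (τ : Equiv.Perm (Fin m))
    (π : Equiv.Perm (Fin (n + m))) : (posLooms σ τ π : ℤ) - (negLooms σ τ π : ℤ) =
      ∑ L : Loom n m, if gamma σ L τ = π then (-1) ^ negCount L else 0 := by
  classical
  rw [posLooms, negLooms, Nat.card_eq_fintype_card, Nat.card_eq_fintype_card,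
    Fintype.card_subtype, Fintype.card_subtype, Finset.card_filter, Finset.card_filter]
  push_cast
  rw [← Finset.sum_sub_distrib]
  refine Finset.sum_congr rfl fun L _ => ?_
  rcases neg_one_pow_eq_or ℤ (negCount L) with h | h <;> by_cases hg : gamma σ L τ = π <;>
    simp [h, hg]

end Product

end DrinfeldYetter

-- The product formula before grouping by permutations: taking shapes is a sign-preserving bijection
-- from looms to the tilings indexing the expansion of the product word.
open DrinfeldYetter in
theorem DrinfeldYetter.comp_eq_sum_looms {K : Type*} [Field K] {n m : ℕ}
    (σ : Equiv.Perm (Fin n)) (τ : Equiv.Perm (Fin m)) :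
    r K σ ≫ r K τ = ∑ L : Loom n m, ((-1 : ℤ) ^ negCount L) • r K (gamma σ L τ) := by
  classical
  obtain ⟨hW, e⟩ := isChordWord_and_comp_eq (K := K) σ τ
  refine e.trans ?_
  rw [← Finset.sum_filter]
  refine (Finset.sum_bij (fun (L : Loom n m) _ => skeleton L.1) (fun L _ => ?_)
    (fun L _ L' _ h => Subtype.ext (skeleton_injective L.2 L'.2 h)) (fun S hS => ?_)
    (fun L _ => ?_)).symm
  · exact Finset.mem_filter.2 ⟨Finset.mem_univ _, (gridFits_skeleton _ _).2 L.2.gridFits⟩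
  · exact ⟨⟨fillSkeleton S, isLoom_fillSkeleton (Finset.mem_filter.1 hS).2⟩, Finset.mem_univ _,
      skeleton_fillSkeleton S⟩
  · rw [gridSign_skeleton, eval_gridWord_skeleton σ L τ
      (hW _ ((gridFits_skeleton _ _).2 L.2.gridFits))]
    rfl

theorem corollary4p7 (K : Type*) [Field K] [CharZero K] (n m : ℕ)
    (σ : Equiv.Perm (Fin n)) (τ : Equiv.Perm (Fin m)) :
    DrinfeldYetter.r K σ ≫ DrinfeldYetter.r K τ =
      ∑ π : Equiv.Perm (Fin (n + m)),
        ((DrinfeldYetter.posLooms σ τ π : ℤ) - (DrinfeldYetter.negLooms σ τ π : ℤ)) •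
          DrinfeldYetter.r K π := by
  classical
  rw [DrinfeldYetter.comp_eq_sum_looms]
  simp only [DrinfeldYetter.posLooms_sub_negLooms, Finset.sum_smul]
  -- With the sum over looms outside, exactly one permutation contributes for each loom, namely
  -- `gamma σ L τ`.
  rw [Finset.sum_comm]
  refine Finset.sum_congr rfl fun L _ => ?_
  simp only [ite_smul, zero_smul]
  rw [Finset.sum_ite_eq Finset.univ, if_pos (Finset.mem_univ _)]
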